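/- Let $(E_i)_{1\le i\le k}$ and $(E^j)_{1\le j\le m}$ be finite-dimensional real inner product spaces, each with its Lebesgue measure. Let $E_0=\bigoplus_i E_i$ and $E^0=\bigoplus_j E^j$ be the orthogonal direct sums, with orthogonal projections $\pi_{E_i}:E_0\to E_i$ and $\pi_{E^j}:E^0\to E^j$. A Forward-Reverse Brascamp--Lieb datum $(\mathbf c,\mathbf d,\mathbf Q)$ consists of positive numbers $\mathbf c=(c_i)$, $\mathbf d=(d_j)$ with $\sum_i c_i\dim E_i=\sum_j d_j\dim E^j$ and a linear map $\mathbf Q:E_0\to E^0$. Put $\mathbf Q_{ji}=\pi_{E^j}\mathbf Q\pi_{E_i}^*$, $\Lambda_{\mathbf c}=\sum_i c_i\pi_{E_i}^*\pi_{E_i}$ and $\Lambda_{\mathbf d}=\sum_j d_j\pi_{E^j}^*\pi_{E^j}$. The datum is *geometric* if $\mathbf Q^*\Lambda_{\mathbf d}\mathbf Q\le\Lambda_{\mathbf c}$ (that is, the difference is self-adjoint and positive semidefinite) and there is a self-adjoint positive semidefinite $\Sigma:E_0\to E_0$ with $\pi_{E_i}\Sigma\pi_{E_i}^*=\mathrm{id}_{E_i}$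 for all $i$ and $\pi_{E^j}\mathbf Q\Sigma\mathbf Q^*\pi_{E^j}^*=\mathrm{id}_{E^j}$ for all $j$. Two data $(\mathbf c,\mathbf d,\mathbf Q)$ and $(\mathbf c',\mathbf d',\mathbf Q')$ on these spaces are *equivalent* if $\mathbf c=\mathbf c'$, $\mathbf d=\mathbf d'$ and there are invertible linear maps $C_i:E_i\to E_i$, $D_j:E^j\to E^j$ with $\mathbf Q'_{ji}=D_j^{-1}\mathbf Q_{ji}C_i^{-1}$ for all $i,j$. For non-negative functions $f_i$ on $E_i$ and $g_j$ on $E^j$ consider the relation $$\prod_{i=1}^k f_i(\pi_{E_i}x)^{c_i}\le\prod_{j=1}^m g_j(\pi_{E^j}\mathbf Qx)^{d_j}\qquad\text{for all }x\in E_0.\tag{R}$$ Let $C(\mathbf c,\mathbf d,\mathbf Q)\in[0,\infty]$ be the smallest constant $C$ such that $$\prod_{i=1}^k\Big(\int_{E_i}f_i\Big)^{c_i}\le C\prod_{j=1}^m\Big(\int_{E^j}g_j\Big)^{d_j}$$ for all non-negative measurable $(f_i),(g_j)$ satisfying (R), with the convention $0\cdot\infty=0$. *Extremizers* are non-negative measurable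 $(f_i),(g_j)$ satisfying (R) for which this holds with equality for $C=C(\mathbf c,\mathbf d,\mathbf Q)$, both sides being positive and finite. They are *Gaussian extremizers* if every $f_i$ and every $g_j$ has the form $x\mapsto e^{-\langle Ax,x\rangle}$ with $A$ self-adjoint positive definite. For a self-adjoint positive definite linear map $A$ on a finite-dimensional inner product space $V$ and $t>0$, let $e^{t\Delta_A}$ be the heat semigroup generated by $\Delta_A f=\mathrm{div}(A\nabla f)$, that is, $$(e^{t\Delta_A}f)(x)=\int_V f(y)\,\frac{1}{(4\pi t)^{\dim V/2}\sqrt{\det A}}\,e^{-\langle A^{-1}(x-y),x-y\rangle/(4t)}\,dy .$$ **Theorem.** For a Forward-Reverse Brascamp--Lieb datum $(\mathbf c,\mathbf d,\mathbf Q)$ the following are equivalent: (i) $(\mathbf c,\mathbf d,\mathbf Q)$ is equivalent to a geometric datum; (ii) there are self-adjoint positive definite linear maps $A_i$ on $E_i$ $(1\le i\le k)$ and $A^j$ on $E^j$ $(1\le j\le m)$ such that, whenever $(f_i),(g_j)$ are non-negative, integrable and satisfy (R), one has $$\prod_{i=1}^k (e^{t\Delta_{A_i}}f_i)(\pi_{E_i}x)^{c_i}\le\prod_{j=1}^m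 (e^{t\Delta_{A^j}}g_j)(\pi_{E^j}\mathbf Qx)^{d_j}\qquad\text{for all }x\in E_0,\ t>0;$$ (iii) Gaussian extremizers exist. -/

import Mathlib

open MeasureTheory
open scoped ENNReal

noncomputable section

namespace FRBL

section SingleSpace

variable {V : Type*} [NormedAddCommGroup V] [InnerProductSpace ℝ V]

/-- Membership in `𝒮⁺(V)`: self-adjoint and positive definite linear maps. -/
def IsPosDef (A : V →ₗ[ℝ] V) : Prop :=
  A.IsSymmetric ∧ ∀ v : V, v ≠ 0 → 0 < inner ℝ (A v) v

/-- A centred Gaussian function `x ↦ exp (-⟨A x, x⟩)` with `A ∈ 𝒮⁺(V)`. -/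
def IsCentredGaussian (f : V → ℝ) : Prop :=
  ∃ A : V →ₗ[ℝ] V, IsPosDef A ∧ f = fun x => Real.exp (-inner ℝ (A x) x)

/-- The heat kernel of `div (A ∇ ·)` at time `t`:
`(4 π t) ^ (-dim V / 2) (det A) ^ (-1 / 2) exp (-⟨A⁻¹ x, x⟩ / (4 t))`.
For positive definite `A` the ring inverse is the inverse linear map. -/
def heatKernel (A : V →ₗ[ℝ] V) (t : ℝ) (x : V) : ℝ :=
  1 / ((4 * Real.pi * t) ^ ((Module.finrank ℝ V : ℝ) / 2) * Real.sqrt (LinearMap.det A)) *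
    Real.exp (-(inner ℝ ((Ring.inverse A : V →ₗ[ℝ] V) x) x) / (4 * t))

variable [FiniteDimensional ℝ V] [MeasurableSpace V] [BorelSpace V]

/-- The heat semigroup `e^{t Δ_{V,A}}`, acting by convolution with the heat kernel. -/
def heatSemigroup (A : V →ₗ[ℝ] V) (t : ℝ) (f : V → ℝ) (x : V) : ℝ :=
  ∫ y, f y * heatKernel A t (x - y)

end SingleSpace

section Blocks

variable {ι : Type*} [Fintype ι] (E : ι → Type*)
  [∀ i, NormedAddCommGroup (E i)] [∀ i, InnerProductSpace ℝ (E i)]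

/-- The orthogonal projection of the orthogonal direct sum `⨁ i, E i` onto `E i`. -/
def proj (i : ι) : PiLp 2 E →ₗ[ℝ] E i :=
  PiLp.projₗ 2 E i

variable [∀ i, FiniteDimensional ℝ (E i)]

/-- `Λ_c = ∑ i, c i • π_i^* π_i`. -/
def blockScalar (c : ι → ℝ) : PiLp 2 E →ₗ[ℝ] PiLp 2 E :=
  ∑ i, c i • (LinearMap.adjoint (proj E i) ∘ₗ proj E i)

variable {E}

/-- `A₀ ∈ Π((A i)_i)`: `A₀` is self-adjoint positive semidefinite on the direct sum, and its
diagonal blocks are the `A i`. -/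
def IsCoupling (A : ∀ i, E i →ₗ[ℝ] E i) (A₀ : PiLp 2 E →ₗ[ℝ] PiLp 2 E) : Prop :=
  A₀.IsPositive ∧ ∀ i, proj E i ∘ₗ A₀ ∘ₗ LinearMap.adjoint (proj E i) = A i

end Blocks

/-- A Forward-Reverse Brascamp--Lieb datum on the Euclidean spaces `(E i)_i` and `(F j)_j`. -/
structure Datum {ι κ : Type*} [Fintype ι] [Fintype κ] (E : ι → Type*) (F : κ → Type*)
    [∀ i, NormedAddCommGroup (E i)] [∀ i, InnerProductSpace ℝ (E i)]
    [∀ j, NormedAddCommGroup (F j)] [∀ j, InnerProductSpace ℝ (F j)] where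
  /-- the exponents on the side of `E` -/
  c : ι → ℝ
  /-- the exponents on the side of `F` -/
  d : κ → ℝ
  /-- the linear map between the direct sums -/
  Q : PiLp 2 E →ₗ[ℝ] PiLp 2 F
  c_pos : ∀ i, 0 < c i
  d_pos : ∀ j, 0 < d j
  scaling : ∑ i, c i * (Module.finrank ℝ (E i) : ℝ) = ∑ j, d j * (Module.finrank ℝ (F j) : ℝ)

namespace Datum

variable {ι κ : Type*} [Fintype ι] [Fintype κ] {E : ι → Type*} {F : κ → Type*}
  [∀ i, NormedAddCommGroup (E i)] [∀ i, InnerProductSpace ℝ (E i)]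
  [∀ j, NormedAddCommGroup (F j)] [∀ j, InnerProductSpace ℝ (F j)]

/-- The pointwise relation
`∏ i, f_i ^ c_i (π_i x) ≤ ∏ j, g_j ^ d_j (π_j Q x)` for all `x` in the direct sum of the `E i`. -/
def Relation (D : Datum E F) (f : ∀ i, E i → ℝ) (g : ∀ j, F j → ℝ) : Prop :=
  ∀ x : PiLp 2 E,
    ∏ i, f i (proj E i x) ^ D.c i ≤ ∏ j, g j (proj F j (D.Q x)) ^ D.d j

variable [∀ i, FiniteDimensional ℝ (E i)] [∀ j, FiniteDimensional ℝ (F j)]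

/-- The block `Q_{ji} = π_j Q π_i^*`. -/
def block (D : Datum E F) (j : κ) (i : ι) : E i →ₗ[ℝ] F j :=
  proj F j ∘ₗ D.Q ∘ₗ LinearMap.adjoint (proj E i)

/-- Geometric data: `Q^* Λ_d Q ≤ Λ_c`, and some `Σ ∈ Π(id, …, id)` has
`Q Σ Q^* ∈ Π(id, …, id)`. -/
def IsGeometric (D : Datum E F) : Prop :=
  (blockScalar E D.c - LinearMap.adjoint D.Q ∘ₗ blockScalar F D.d ∘ₗ D.Q).IsPositive ∧
    ∃ S : PiLp 2 E →ₗ[ℝ] PiLp 2 E,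
      IsCoupling (fun _ => LinearMap.id) S ∧
        IsCoupling (fun _ => LinearMap.id) (D.Q ∘ₗ S ∘ₗ LinearMap.adjoint D.Q)

/-- Equivalence of data: same exponents, and `Q'_{ji} = D_j⁻¹ Q_{ji} C_i⁻¹` for invertible linear
maps `C_i` of `E i` and `D_j` of `F j`. -/
def Equivalent (D D' : Datum E F) : Prop :=
  D.c = D'.c ∧ D.d = D'.d ∧
    ∃ (C : ∀ i, E i ≃ₗ[ℝ] E i) (B : ∀ j, F j ≃ₗ[ℝ] F j), ∀ i j,
      D'.block j i = (B j).symm.toLinearMap ∘ₗ D.block j i ∘ₗ (C i).symm.toLinearMap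

variable [∀ i, MeasurableSpace (E i)] [∀ i, BorelSpace (E i)]
  [∀ j, MeasurableSpace (F j)] [∀ j, BorelSpace (F j)]

/-- Admissible functions for the inequality: non-negative, (Lebesgue) measurable, and satisfying
the pointwise relation. -/
def Admissible (D : Datum E F) (f : ∀ i, E i → ℝ) (g : ∀ j, F j → ℝ) : Prop :=
  (∀ i, AEMeasurable (f i) volume ∧ ∀ x, 0 ≤ f i x) ∧
    (∀ j, AEMeasurable (g j) volume ∧ ∀ y, 0 ≤ g j y) ∧ D.Relation f g

/-- `∏ i, (∫ f_i) ^ c_i`, with integrals of non-negative functions in `[0, ∞]`. -/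
def forwardProd (D : Datum E F) (f : ∀ i, E i → ℝ) : ℝ≥0∞ :=
  ∏ i, (∫⁻ x, ENNReal.ofReal (f i x)) ^ D.c i

/-- `∏ j, (∫ g_j) ^ d_j`, with integrals of non-negative functions in `[0, ∞]`. -/
def reverseProd (D : Datum E F) (g : ∀ j, F j → ℝ) : ℝ≥0∞ :=
  ∏ j, (∫⁻ y, ENNReal.ofReal (g j y)) ^ D.d j

/-- The Forward-Reverse Brascamp--Lieb constant: the smallest `C ∈ [0, ∞]` with
`∏ i, (∫ f_i) ^ c_i ≤ C ∏ j, (∫ g_j) ^ d_j` for all admissible functions. -/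
def constant (D : Datum E F) : ℝ≥0∞ :=
  sInf {C : ℝ≥0∞ | ∀ (f : ∀ i, E i → ℝ) (g : ∀ j, F j → ℝ),
    D.Admissible f g → D.forwardProd f ≤ C * D.reverseProd g}

/-- Extremizers: admissible functions for which the inequality with the best constant is an
equality, with a positive and finite value on both sides. -/
def IsExtremizer (D : Datum E F) (f : ∀ i, E i → ℝ) (g : ∀ j, F j → ℝ) : Prop :=
  D.Admissible f g ∧ D.forwardProd f = D.constant * D.reverseProd g ∧
    0 < D.forwardProd f ∧ D.forwardProd f < ∞

end Datum

end FRBL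

end

/-! ### Positive definite operators: inverses and square roots. -/

set_option linter.unusedSectionVars false

noncomputable section

namespace FRBL

section SingleSpace

variable {V : Type*} [NormedAddCommGroup V] [InnerProductSpace ℝ V] [FiniteDimensional ℝ V]

/-! All three conditions pass through critical pairs (U, V): positive definite U_i, V_j with Q^*(⊕
d_j V_j)Q ≤ ⊕ c_i U_i, together with a positive semidefinite Σ whose diagonal blocks are U_i⁻¹ and
for which QΣQ^* has diagonal blocks V_j⁻¹ (`IsCritical`). A datum is geometric exactly when the
identities form a critical pair, and block changes of variables built from √U_i and √V_j reduce the
general case to this one (`exists_equivalent_isGeometric_iff`).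

Gaussian extremizers give a critical pair. For centred Gaussians, (R) is the inequality of quadratic
forms above, and the integrals are powers of determinants, so extremal exponents minimise ∑ c_i log
det U_i - ∑ d_j log det V_j under a linear cone constraint. Σ is the Lagrange multiplier of that
constraint: the derivative of the objective is a functional of the constraint map, non-negative on
the cone, and the Riesz extension theorem extends it to a non-negative functional on all operators,
which is the pairing with some Σ ≥ 0. Rank-one perturbations of a single block then read off the
blocks of Σ (`isCritical_of_logDet_le`).

A critical pair makes the heat flows with A_i = U_i⁻¹ and A^j = V_j⁻¹ preserve (R). If ξ is standard
Gaussian on E_0 and R = √Σ, the blocks of Rξ and of QRξ have covariances U_i⁻¹ and V_j⁻¹, so a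
single noise drives all the flows. As in Borell's stochastic proof, translating the noise by a drift
and applying Jensen's inequality bounds the logarithm of each evolved g_j from below, at a quadratic
cost measured by V_j (`IsPosDef.integral_log_shift_le`). For f_i the drift U_i⁻¹∇ log f_i gives the
matching bound in the other direction, up to O(h^(3/2)) over a time step h (`exists_log_flow_le`).
Using these drifts for the f_i and their image under Q for the g_j, the costs are compared by the
inequality of quadratic forms. With n steps of length t/n the total error is O(n^(-1/2))
(`IsCritical.logRelation_flow`). This needs smooth f_i and functions bounded away from 0 and ∞.
Integrable functions are reached by truncating f, passing to semicontinuous approximations, f from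
below and g from above, and mollifying f. Semicontinuity makes the relation, with a factor e^δ to
spare, an open condition, and that is why it survives the mollification
(`IsCritical.prod_heatSemigroup_le`).

Preservation of (R) gives Gaussian extremizers by letting t → ∞ at the points √t x. Each evolved
function, suitably normalised, tends to its mass times exp(-⟨A⁻¹x, x⟩/4), and the powers of t cancel
by the scaling condition. The limit at x = 0 bounds the constant by an explicit ratio of
determinants, the limit for large x is the inequality of quadratic forms for the A⁻¹, and the
Gaussians exp(-⟨A⁻¹x, x⟩) attain the bound. -/

lemma IsPosDef.isUnit {A : V →ₗ[ℝ] V} (hA : IsPosDef A) : IsUnit A := by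
  rw [LinearMap.isUnit_iff_ker_eq_bot, LinearMap.ker_eq_bot']
  intro v hv
  by_contra h
  have := hA.2 v h
  simp [hv] at this

lemma IsPosDef.inverse_apply_self {A : V →ₗ[ℝ] V} (hA : IsPosDef A) (v : V) :
    (Ring.inverse A : V →ₗ[ℝ] V) (A v) = v := by
  simpa using LinearMap.congr_fun (Ring.inverse_mul_cancel A hA.isUnit) v

lemma IsPosDef.self_apply_inverse {A : V →ₗ[ℝ] V} (hA : IsPosDef A) (v : V) :
    A ((Ring.inverse A : V →ₗ[ℝ] V) v) = v := by
  simpa using LinearMap.congr_fun (Ring.mul_inverse_cancel A hA.isUnit) v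

lemma IsPosDef.inverse {A : V →ₗ[ℝ] V} (hA : IsPosDef A) : IsPosDef (Ring.inverse A) := by
  refine ⟨fun x y => ?_, fun v hv => ?_⟩
  · conv_lhs => rw [← hA.self_apply_inverse y]
    rw [← hA.1, hA.self_apply_inverse]
  · have h : (Ring.inverse A : V →ₗ[ℝ] V) v ≠ 0 := by
      intro h0
      apply hv
      rw [← hA.self_apply_inverse v, h0, map_zero]
    have := hA.2 _ h
    rwa [hA.self_apply_inverse, real_inner_comm] at this

lemma IsPosDef.inverse_inverse {A : V →ₗ[ℝ] V} (hA : IsPosDef A) :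
    Ring.inverse (Ring.inverse A) = A := by
  ext v
  conv_lhs => rw [← hA.inverse_apply_self v]
  rw [hA.inverse.inverse_apply_self]

lemma IsPosDef.inner_nonneg {A : V →ₗ[ℝ] V} (hA : IsPosDef A) (v : V) : 0 ≤ inner ℝ (A v) v := by
  rcases eq_or_ne v 0 with rfl | hv
  · simp
  · exact (hA.2 v hv).le

lemma IsPosDef.isPositive {A : V →ₗ[ℝ] V} (hA : IsPosDef A) : A.IsPositive :=
  (LinearMap.isPositive_iff A).2 ⟨hA.1, hA.inner_nonneg⟩

lemma inverse_eq_of_apply {A B : V →ₗ[ℝ] V} (h : ∀ v, A (B v) = v) : Ring.inverse A = B := by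
  have h1 : A * B = 1 := LinearMap.ext h
  have h2 : B * A = 1 := mul_eq_one_comm.1 h1
  exact Ring.inverse_unit ⟨A, B, h1, h2⟩

/-- A positive operator has a symmetric square root. -/
lemma exists_symmetric_sqrt {S : V →ₗ[ℝ] V} (hS : S.IsPositive) :
    ∃ R : V →ₗ[ℝ] V, R.IsSymmetric ∧ ∀ v, R (R v) = S v := by
  set b := hS.isSymmetric.eigenvectorBasis rfl with hb
  set ev := hS.isSymmetric.eigenvalues rfl with hev
  let R : V →ₗ[ℝ] V :=
    ∑ k, Real.sqrt (ev k) • (LinearMap.toSpanSingleton ℝ V (b k) ∘ₗ innerₛₗ ℝ (b k))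
  have hR : ∀ v, R v = ∑ k, (Real.sqrt (ev k) * inner ℝ (b k) v) • b k := by
    intro v
    simp [R, smul_smul]
  refine ⟨R, fun x y => ?_, fun v => ?_⟩
  · simp only [hR, sum_inner, inner_sum, real_inner_smul_left, real_inner_smul_right]
    refine Finset.sum_congr rfl fun k _ => ?_
    rw [real_inner_comm x]
    ring
  · have hRb : ∀ k, R (b k) = Real.sqrt (ev k) • b k := by
      intro k
      rw [hR, Finset.sum_eq_single k]
      · simp
      · intro l _ hl
        simp [b.orthonormal.2 hl]
      · simp
    have : R ∘ₗ R = S := by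
      refine b.toBasis.ext fun k => ?_
      have h1 : S (b k) = ev k • b k := by
        exact hS.isSymmetric.apply_eigenvectorBasis rfl k
      simp only [OrthonormalBasis.coe_toBasis, LinearMap.comp_apply, hRb, map_smul, smul_smul, h1]
      rw [Real.mul_self_sqrt (hS.nonneg_eigenvalues rfl k)]
    exact LinearMap.congr_fun this v

lemma IsPosDef.exists_sqrt {A : V →ₗ[ℝ] V} (hA : IsPosDef A) :
    ∃ C : V ≃ₗ[ℝ] V, (∀ x y, inner ℝ (C x) y = inner ℝ x (C y)) ∧ ∀ v, C (C v) = A v := by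
  obtain ⟨R, hR, hRR⟩ := exists_symmetric_sqrt hA.isPositive
  have hinj : Function.Injective R := by
    rw [← LinearMap.ker_eq_bot, LinearMap.ker_eq_bot']
    intro v hv
    have : A v = 0 := by rw [← hRR, hv, map_zero]
    rw [← hA.inverse_apply_self v, this, map_zero]
  exact ⟨LinearEquiv.ofInjectiveEndo R hinj, fun x y => by simpa using hR x y,
    fun v => by simpa using hRR v⟩

lemma isPosDef_adjoint_comp_self (C : V ≃ₗ[ℝ] V) :
    IsPosDef (LinearMap.adjoint C.toLinearMap ∘ₗ C.toLinearMap) := by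
  refine ⟨fun x y => ?_, fun v hv => ?_⟩
  · simp [LinearMap.adjoint_inner_left, LinearMap.adjoint_inner_right]
  · simp only [LinearMap.comp_apply, LinearMap.adjoint_inner_left]
    rw [real_inner_self_eq_norm_sq]
    have : C v ≠ 0 := by simpa using hv
    positivity

lemma adjoint_apply_adjoint_symm (C : V ≃ₗ[ℝ] V) (v : V) :
    LinearMap.adjoint C.toLinearMap (LinearMap.adjoint C.symm.toLinearMap v) = v := by
  rw [← LinearMap.comp_apply, ← LinearMap.adjoint_comp]
  simp

lemma inverse_adjoint_comp_self (C : V ≃ₗ[ℝ] V) :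
    Ring.inverse (LinearMap.adjoint C.toLinearMap ∘ₗ C.toLinearMap) =
      C.symm.toLinearMap ∘ₗ LinearMap.adjoint C.symm.toLinearMap := by
  refine inverse_eq_of_apply fun v => ?_
  simp only [LinearMap.comp_apply, LinearEquiv.coe_coe, LinearEquiv.apply_symm_apply]
  exact adjoint_apply_adjoint_symm C v

end SingleSpace

/-! ### Block operators on orthogonal direct sums. -/

section Blocks

variable {ι : Type*} [Fintype ι] {E : ι → Type*}
  [∀ i, NormedAddCommGroup (E i)] [∀ i, InnerProductSpace ℝ (E i)]

@[simp] lemma proj_apply (i : ι) (x : PiLp 2 E) : proj E i x = x i := rfl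

variable [∀ i, FiniteDimensional ℝ (E i)]

variable (E) in
/-- The isometric embedding of `E i` into the orthogonal direct sum. -/
def emb (i : ι) : E i →ₗ[ℝ] PiLp 2 E := LinearMap.adjoint (proj E i)

lemma inner_emb_left (i : ι) (u : E i) (x : PiLp 2 E) :
    inner ℝ (emb E i u) x = inner ℝ u (x i) :=
  LinearMap.adjoint_inner_left _ _ _

lemma inner_emb_right (i : ι) (u : E i) (x : PiLp 2 E) :
    inner ℝ x (emb E i u) = inner ℝ (x i) u :=
  LinearMap.adjoint_inner_right _ _ _

lemma emb_eq_single [DecidableEq ι] (i : ι) (u : E i) : emb E i u = PiLp.single 2 i u := by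
  refine ext_inner_right ℝ fun x => ?_
  rw [inner_emb_left, PiLp.inner_apply, Finset.sum_eq_single i]
  · simp
  · intro j _ hj
    simp [hj]
  · simp

@[simp] lemma emb_apply_self (i : ι) (u : E i) : emb E i u i = u := by
  classical
  simp [emb_eq_single]

lemma emb_apply_of_ne {i j : ι} (h : j ≠ i) (u : E i) : emb E i u j = 0 := by
  classical
  simp [emb_eq_single, h]

lemma sum_emb (x : PiLp 2 E) : ∑ i, emb E i (x i) = x := by
  refine ext_inner_right ℝ fun y => ?_
  rw [sum_inner, PiLp.inner_apply]
  exact Finset.sum_congr rfl fun i _ => inner_emb_left i _ y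

/-- The block-diagonal operator with diagonal blocks `C i`. -/
def blockMap (C : ∀ i, E i →ₗ[ℝ] E i) : PiLp 2 E →ₗ[ℝ] PiLp 2 E :=
  ∑ i, emb E i ∘ₗ C i ∘ₗ proj E i

@[simp] lemma blockMap_apply (C : ∀ i, E i →ₗ[ℝ] E i) (x : PiLp 2 E) (i : ι) :
    blockMap C x i = C i (x i) := by
  refine ext_inner_right ℝ fun u => ?_
  rw [← inner_emb_right]
  simp only [blockMap, LinearMap.sum_apply, LinearMap.comp_apply, proj_apply, sum_inner]
  rw [Finset.sum_eq_single i]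
  · rw [inner_emb_left, emb_apply_self]
  · intro j _ hj
    rw [inner_emb_left, emb_apply_of_ne hj, inner_zero_right]
  · simp

lemma blockMap_emb (C : ∀ i, E i →ₗ[ℝ] E i) (i : ι) (u : E i) :
    blockMap C (emb E i u) = emb E i (C i u) := by
  ext j
  rcases eq_or_ne j i with rfl | h
  · simp
  · simp [emb_apply_of_ne h]

lemma adjoint_blockMap (C : ∀ i, E i →ₗ[ℝ] E i) :
    LinearMap.adjoint (blockMap C) = blockMap fun i => LinearMap.adjoint (C i) := by
  symm
  rw [LinearMap.eq_adjoint_iff]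
  intro x y
  simp [PiLp.inner_apply, LinearMap.adjoint_inner_left]

lemma blockScalar_apply (c : ι → ℝ) (x : PiLp 2 E) (i : ι) : blockScalar E c x i = c i • x i := by
  have : blockScalar E c = blockMap fun i => c i • LinearMap.id := by
    simp only [blockScalar, blockMap, emb, LinearMap.smul_comp, LinearMap.comp_smul,
      LinearMap.id_comp]
  simp [this]

lemma blockScalar_isSymmetric (c : ι → ℝ) : (blockScalar E c).IsSymmetric := by
  intro x y
  simp [PiLp.inner_apply, blockScalar_apply, real_inner_smul_left, real_inner_smul_right]

lemma inner_blockScalar_self (c : ι → ℝ) (x : PiLp 2 E) :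
    inner ℝ (blockScalar E c x) x = ∑ i, c i * inner ℝ (x i) (x i) := by
  simp [PiLp.inner_apply, blockScalar_apply, real_inner_smul_left]

lemma isCoupling_iff {A : ∀ i, E i →ₗ[ℝ] E i} {S : PiLp 2 E →ₗ[ℝ] PiLp 2 E} :
    IsCoupling A S ↔
      S.IsPositive ∧ ∀ i u v, inner ℝ (S (emb E i u)) (emb E i v) = inner ℝ (A i u) v := by
  refine and_congr_right fun _ => forall_congr' fun i => ⟨fun h u v => ?_, fun h => ?_⟩
  · rw [← h, inner_emb_right]
    rfl
  · refine LinearMap.ext fun u => ext_inner_right ℝ fun v => ?_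
    rw [← h, inner_emb_right]
    rfl

end Blocks

/-! ### Critical pairs and equivalence with geometric data. -/

namespace Datum

variable {ι κ : Type*} [Fintype ι] [Fintype κ] {E : ι → Type*} {F : κ → Type*}
  [∀ i, NormedAddCommGroup (E i)] [∀ i, InnerProductSpace ℝ (E i)]
  [∀ j, NormedAddCommGroup (F j)] [∀ j, InnerProductSpace ℝ (F j)]

/-- The quadratic-form inequality `Q^* (⨁ j, d_j V_j) Q ≤ ⨁ i, c_i U_i`. -/
def Dominates (D : Datum E F) (U : ∀ i, E i →ₗ[ℝ] E i) (V : ∀ j, F j →ₗ[ℝ] F j) : Prop :=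
  ∀ x : PiLp 2 E, ∑ j, D.d j * inner ℝ (V j (D.Q x j)) (D.Q x j) ≤
    ∑ i, D.c i * inner ℝ (U i (x i)) (x i)

variable [∀ i, FiniteDimensional ℝ (E i)] [∀ j, FiniteDimensional ℝ (F j)]

/-- The Karush-Kuhn-Tucker conditions for centred Gaussians with exponents `U`, `V`. -/
structure IsCritical (D : Datum E F) (U : ∀ i, E i →ₗ[ℝ] E i) (V : ∀ j, F j →ₗ[ℝ] F j) :
    Prop where
  posDef_left : ∀ i, IsPosDef (U i)
  posDef_right : ∀ j, IsPosDef (V j)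
  dominates : D.Dominates U V
  exists_coupling : ∃ S : PiLp 2 E →ₗ[ℝ] PiLp 2 E, S.IsPositive ∧
    (∀ i u v, inner ℝ (S (emb E i u)) (emb E i v) =
      inner ℝ ((Ring.inverse (U i) : E i →ₗ[ℝ] E i) u) v) ∧
    ∀ j u v, inner ℝ (S (LinearMap.adjoint D.Q (emb F j u))) (LinearMap.adjoint D.Q (emb F j v)) =
      inner ℝ ((Ring.inverse (V j) : F j →ₗ[ℝ] F j) u) v

lemma eq_of_block_eq {D D' : Datum E F} (h : ∀ i j, D'.block j i = D.block j i) :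
    D'.Q = D.Q := by
  refine LinearMap.ext fun x => ?_
  ext j
  conv_lhs => rw [← sum_emb x]
  conv_rhs => rw [← sum_emb x]
  rw [map_sum, map_sum]
  have : ∀ i, D'.Q (emb E i (x i)) j = D.Q (emb E i (x i)) j := fun i =>
    LinearMap.congr_fun (h i j) (x i)
  simp [this]

/-- The datum obtained by block-diagonal changes of variables. -/
def conj (D : Datum E F) (C : ∀ i, E i ≃ₗ[ℝ] E i) (B : ∀ j, F j ≃ₗ[ℝ] F j) : Datum E F :=
  { D with
    Q := blockMap (fun j => (B j).symm.toLinearMap) ∘ₗ D.Q ∘ₗ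
      blockMap fun i => (C i).symm.toLinearMap }

lemma conj_block (D : Datum E F) (C : ∀ i, E i ≃ₗ[ℝ] E i) (B : ∀ j, F j ≃ₗ[ℝ] F j) (i : ι)
    (j : κ) : (D.conj C B).block j i =
      (B j).symm.toLinearMap ∘ₗ D.block j i ∘ₗ (C i).symm.toLinearMap := by
  ext u
  change blockMap _ (D.Q (blockMap _ (emb E i u))) j = (B j).symm (D.Q (emb E i _) j)
  rw [blockMap_emb, blockMap_apply]
  rfl

/-- The blocks determine `Q`, so equivalence can be handled with global block-diagonal operators
instead of block by block. -/
lemma equivalent_iff_conj {D D' : Datum E F} :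
    D.Equivalent D' ↔ ∃ C B, D' = D.conj C B := by
  constructor
  · rintro ⟨hc, hd, C, B, h⟩
    refine ⟨C, B, ?_⟩
    have hQ : D'.Q = (D.conj C B).Q := eq_of_block_eq fun i j => by rw [h, conj_block]
    cases D
    cases D'
    simp only [conj] at *
    subst hc hd hQ
    rfl
  · rintro ⟨C, B, rfl⟩
    exact ⟨rfl, rfl, C, B, fun i j => conj_block D C B i j⟩

lemma adjoint_conj_Q_emb (D : Datum E F) (C : ∀ i, E i ≃ₗ[ℝ] E i) (B : ∀ j, F j ≃ₗ[ℝ] F j)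
    (j : κ) (u : F j) :
    LinearMap.adjoint (D.conj C B).Q (emb F j u) =
      LinearMap.adjoint (blockMap fun i => (C i).symm.toLinearMap)
        (LinearMap.adjoint D.Q (emb F j (LinearMap.adjoint (B j).symm.toLinearMap u))) := by
  simp only [conj, LinearMap.adjoint_comp, LinearMap.comp_apply]
  congr 2
  rw [adjoint_blockMap, blockMap_emb]

/-- This is the shape of `IsCritical` with identities for `U` and `V`. The symmetry of Λ_c - Q^*Λ_d
Q and the positivity of QΣQ^* hold automatically and are dropped. -/
lemma isGeometric_iff (D : Datum E F) : D.IsGeometric ↔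
    D.Dominates (fun _ => LinearMap.id) (fun _ => LinearMap.id) ∧
    ∃ S : PiLp 2 E →ₗ[ℝ] PiLp 2 E, S.IsPositive ∧
    (∀ i u v, inner ℝ (S (emb E i u)) (emb E i v) = inner ℝ u v) ∧
    ∀ j u v, inner ℝ (S (LinearMap.adjoint D.Q (emb F j u))) (LinearMap.adjoint D.Q (emb F j v)) =
      inner ℝ u v := by
  refine and_congr ?_ (exists_congr fun S => ?_)
  · rw [LinearMap.isPositive_iff]
    have hval : ∀ x, inner ℝ ((blockScalar E D.c -
        LinearMap.adjoint D.Q ∘ₗ blockScalar F D.d ∘ₗ D.Q) x) x =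
        ∑ i, D.c i * inner ℝ (x i) (x i) -
          ∑ j, D.d j * inner ℝ (D.Q x j) (D.Q x j) := by
      intro x
      simp only [LinearMap.sub_apply, inner_sub_left, LinearMap.comp_apply,
        LinearMap.adjoint_inner_left, inner_blockScalar_self]
    constructor
    · rintro ⟨-, h⟩ x
      have := h x
      rw [hval] at this
      simpa using this
    · intro h
      refine ⟨(blockScalar_isSymmetric _).sub fun x y => ?_, fun x => ?_⟩
      · simp only [LinearMap.comp_apply, LinearMap.adjoint_inner_left,
          LinearMap.adjoint_inner_right, blockScalar_isSymmetric D.d _ _]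
      · rw [hval]
        simpa using h x
  · rw [isCoupling_iff, isCoupling_iff]
    simp only [LinearMap.comp_apply, LinearMap.id_apply]
    constructor
    · rintro ⟨⟨h1, h2⟩, -, h3⟩
      refine ⟨h1, h2, fun j u v => ?_⟩
      rw [← h3, LinearMap.adjoint_inner_right]
    · rintro ⟨h1, h2, h3⟩
      refine ⟨⟨h1, h2⟩, ?_, fun j u v => ?_⟩
      · exact h1.conj_adjoint D.Q
      · rw [← h3, LinearMap.adjoint_inner_right]

/-- Pulling the identity forms back through C and B⁻¹ gives the two forms. The coupling is
transported contragrediently, Σ ↦ C⁻¹ΣC⁻*, which is why its blocks are the inverses of the forms. -/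
lemma isCritical_of_isGeometric_conj {D : Datum E F} {C : ∀ i, E i ≃ₗ[ℝ] E i}
    {B : ∀ j, F j ≃ₗ[ℝ] F j} (h : (D.conj C B).IsGeometric) :
    D.IsCritical (fun i => LinearMap.adjoint (C i).toLinearMap ∘ₗ (C i).toLinearMap)
      (fun j => LinearMap.adjoint (B j).symm.toLinearMap ∘ₗ (B j).symm.toLinearMap) := by
  obtain ⟨hdom, S, hS, hS1, hS2⟩ := (isGeometric_iff _).1 h
  refine ⟨fun i => isPosDef_adjoint_comp_self _, fun j => isPosDef_adjoint_comp_self _,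
    fun x => ?_, ?_⟩
  · have hx : blockMap (fun i => (C i).symm.toLinearMap) (blockMap (fun i => (C i).toLinearMap) x)
        = x := by
      ext i
      simp
    have := hdom (blockMap (fun i => (C i).toLinearMap) x)
    simp only [conj, LinearMap.comp_apply, hx, blockMap_apply, LinearMap.id_apply,
      LinearEquiv.coe_coe] at this
    simpa only [LinearMap.comp_apply, LinearMap.adjoint_inner_left, LinearEquiv.coe_coe] using this
  · refine ⟨blockMap (fun i => (C i).symm.toLinearMap) ∘ₗ S ∘ₗ
      LinearMap.adjoint (blockMap (fun i => (C i).symm.toLinearMap)), hS.conj_adjoint _,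
      fun i u v => ?_, fun j u v => ?_⟩
    · simp only [LinearMap.comp_apply]
      rw [← LinearMap.adjoint_inner_right, adjoint_blockMap, blockMap_emb, blockMap_emb, hS1,
        inverse_adjoint_comp_self, LinearMap.comp_apply,
        ← LinearMap.adjoint_inner_right (C i).symm.toLinearMap]
    · have key : ∀ u, LinearMap.adjoint (blockMap (fun i => (C i).symm.toLinearMap))
          (LinearMap.adjoint D.Q (emb F j u)) =
          LinearMap.adjoint (D.conj C B).Q (emb F j (LinearMap.adjoint (B j).toLinearMap u)) := by
        intro u
        rw [adjoint_conj_Q_emb]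
        have := adjoint_apply_adjoint_symm (B j).symm u
        simp only [LinearEquiv.symm_symm] at this
        rw [this]
      simp only [LinearMap.comp_apply]
      rw [← LinearMap.adjoint_inner_right, key, key, hS2]
      have := inverse_adjoint_comp_self (B j).symm
      rw [this, LinearMap.comp_apply, ← LinearMap.adjoint_inner_right (B j).symm.symm.toLinearMap]
      rfl

/-- The change of variables is C_i = √U_i and B_j = (√V_j)⁻¹, which turns both forms into
identities; the new coupling is CΣC^*. -/
lemma exists_equivalent_isGeometric_of_isCritical {D : Datum E F} {U : ∀ i, E i →ₗ[ℝ] E i}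
    {V : ∀ j, F j →ₗ[ℝ] F j} (h : D.IsCritical U V) :
    ∃ D' : Datum E F, D.Equivalent D' ∧ D'.IsGeometric := by
  choose C hC hCC using fun i => (h.posDef_left i).exists_sqrt
  choose b hb hbb using fun j => (h.posDef_right j).exists_sqrt
  refine ⟨D.conj C fun j => (b j).symm, equivalent_iff_conj.2 ⟨_, _, rfl⟩, ?_⟩
  have hCadj : ∀ i, LinearMap.adjoint (C i).toLinearMap = (C i).toLinearMap := fun i => by
    symm
    rw [LinearMap.eq_adjoint_iff]
    exact hC i
  have hbadj : ∀ j, LinearMap.adjoint (b j).toLinearMap = (b j).toLinearMap := fun j => by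
    symm
    rw [LinearMap.eq_adjoint_iff]
    exact hb j
  obtain ⟨S, hS, hS1, hS2⟩ := h.exists_coupling
  rw [isGeometric_iff]
  refine ⟨fun x => ?_, ?_⟩
  · have := h.dominates (blockMap (fun i => (C i).symm.toLinearMap) x)
    have h1 : ∀ i v, inner ℝ (U i v) v = inner ℝ (C i v) (C i v) := fun i v => by
      rw [← hCC, hC]
    have h2 : ∀ j v, inner ℝ (V j v) v = inner ℝ (b j v) (b j v) := fun j v => by
      rw [← hbb, hb]
    simp only [h1, h2] at this
    simpa [conj] using this
  · refine ⟨blockMap (fun i => (C i).toLinearMap) ∘ₗ S ∘ₗ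
      LinearMap.adjoint (blockMap (fun i => (C i).toLinearMap)), hS.conj_adjoint _,
      fun i u v => ?_, fun j u v => ?_⟩
    · simp only [LinearMap.comp_apply]
      rw [← LinearMap.adjoint_inner_right, adjoint_blockMap, blockMap_emb, blockMap_emb, hS1]
      simp only [hCadj, LinearEquiv.coe_coe]
      rw [← hC]
      have hcalc : (C i) ((Ring.inverse (U i) : E i →ₗ[ℝ] E i) (C i u)) = u := by
        apply (C i).injective
        rw [hCC, (h.posDef_left i).self_apply_inverse]
      rw [hcalc]
    · have key : ∀ u, LinearMap.adjoint (blockMap (fun i => (C i).toLinearMap))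
          (LinearMap.adjoint (D.conj C fun j => (b j).symm).Q (emb F j u)) =
          LinearMap.adjoint D.Q (emb F j (b j u)) := by
        intro u
        rw [adjoint_conj_Q_emb]
        have : blockMap (fun i => (C i).symm.toLinearMap) ∘ₗ
            blockMap (fun i => (C i).toLinearMap) = LinearMap.id := by
          ext x i
          simp
        have h2 := congrArg LinearMap.adjoint this
        rw [LinearMap.adjoint_comp] at h2
        have h3 := LinearMap.congr_fun h2
          (LinearMap.adjoint D.Q (emb F j (LinearMap.adjoint (b j).symm.symm.toLinearMap u)))
        rw [LinearMap.comp_apply] at h3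
        rw [h3]
        simp [hbadj]
      simp only [LinearMap.comp_apply]
      rw [← LinearMap.adjoint_inner_right, key, key, hS2, ← hb]
      have hcalc : (b j) ((Ring.inverse (V j) : F j →ₗ[ℝ] F j) (b j u)) = u := by
        apply (b j).injective
        rw [hbb, (h.posDef_right j).self_apply_inverse]
      rw [hcalc]

theorem exists_equivalent_isGeometric_iff (D : Datum E F) :
    (∃ D' : Datum E F, D.Equivalent D' ∧ D'.IsGeometric) ↔ ∃ U V, D.IsCritical U V := by
  constructor
  · rintro ⟨D', hD', hgeo⟩
    obtain ⟨C, B, rfl⟩ := equivalent_iff_conj.1 hD'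
    exact ⟨_, _, isCritical_of_isGeometric_conj hgeo⟩
  · rintro ⟨U, V, h⟩
    exact exists_equivalent_isGeometric_of_isCritical h

end Datum

end FRBL

end

/-! ### First-order optimality conditions for log-determinants. -/

set_option linter.unusedSectionVars false

noncomputable section

namespace FRBL

section SingleSpace

variable {V : Type*} [NormedAddCommGroup V] [InnerProductSpace ℝ V] [FiniteDimensional ℝ V]

lemma exists_forall_norm_apply_le {W : Type*} [NormedAddCommGroup W] [NormedSpace ℝ W]
    (X : V →ₗ[ℝ] W) : ∃ M : ℝ, 0 < M ∧ ∀ v, ‖X v‖ ≤ M * ‖v‖ := by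
  refine ⟨‖LinearMap.toContinuousLinearMap X‖ + 1, by positivity, fun v => ?_⟩
  have := (LinearMap.toContinuousLinearMap X).le_opNorm v
  simp only [LinearMap.coe_toContinuousLinearMap'] at this
  nlinarith [norm_nonneg v]

lemma exists_forall_abs_inner_le (X : V →ₗ[ℝ] V) :
    ∃ M : ℝ, 0 < M ∧ ∀ v, |inner ℝ (X v) v| ≤ M * ‖v‖ ^ 2 := by
  obtain ⟨M, hM, h⟩ := exists_forall_norm_apply_le X
  refine ⟨M, hM, fun v => (abs_real_inner_le_norm _ _).trans ?_⟩
  nlinarith [h v, norm_nonneg v]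

lemma IsPosDef.exists_lower_bound {A : V →ₗ[ℝ] V} (hA : IsPosDef A) :
    ∃ m : ℝ, 0 < m ∧ ∀ v, m * ‖v‖ ^ 2 ≤ inner ℝ (A v) v := by
  obtain ⟨C, hC, hCC⟩ := hA.exists_sqrt
  obtain ⟨M, hM, h⟩ := exists_forall_norm_apply_le C.symm.toLinearMap
  refine ⟨(M ^ 2)⁻¹, by positivity, fun v => ?_⟩
  have h1 := h (C v)
  simp only [LinearEquiv.coe_coe, LinearEquiv.symm_apply_apply] at h1
  rw [← hCC, hC, real_inner_self_eq_norm_sq, inv_mul_le_iff₀ (by positivity), ← mul_pow]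
  gcongr

lemma IsPosDef.eventually_add_smul {A : V →ₗ[ℝ] V} (hA : IsPosDef A) {X : V →ₗ[ℝ] V}
    (hX : X.IsSymmetric) : ∀ᶠ s : ℝ in nhdsWithin 0 (Set.Ioi 0), IsPosDef (A + s • X) := by
  obtain ⟨m, hm, h⟩ := hA.exists_lower_bound
  obtain ⟨M, hM, h'⟩ := exists_forall_abs_inner_le X
  have : Set.Ioo 0 (m / M) ∈ nhdsWithin (0 : ℝ) (Set.Ioi 0) :=
    Ioo_mem_nhdsGT (by positivity)
  filter_upwards [this] with s hs
  refine ⟨hA.1.add fun x y => ?_, fun v hv => ?_⟩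
  · simp [real_inner_smul_left, real_inner_smul_right, hX x y]
  · simp only [LinearMap.add_apply, LinearMap.smul_apply, inner_add_left, real_inner_smul_left]
    have h1 := h v
    have h2 := abs_le.1 (h' v)
    have h3 : s * M < m := by
      have := hs.2
      rwa [lt_div_iff₀ hM] at this
    have h4 : 0 < ‖v‖ ^ 2 := by
      have : v ≠ 0 := hv
      positivity
    have h5 : s * (-(M * ‖v‖ ^ 2)) ≤ s * inner ℝ (X v) v :=
      mul_le_mul_of_nonneg_left h2.1 hs.1.le
    nlinarith

/-- The determinant is the polynomial 1 + s tr M + s² p(s), and only its linear coefficient survives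
at 0. -/
lemma hasDerivAt_det_one_add_smul (M : V →ₗ[ℝ] V) :
    HasDerivAt (fun s : ℝ => LinearMap.det (1 + s • M)) (LinearMap.trace ℝ V M) 0 := by
  classical
  set b := Module.finBasis ℝ V
  set N := LinearMap.toMatrix b b M with hN
  set p := ((1 + (Polynomial.X : Polynomial ℝ) • N.map Polynomial.C).det.divX.divX)
  have h1 : (fun s : ℝ => LinearMap.det (1 + s • M)) =
      fun s => 1 + N.trace * s + p.eval s * s ^ 2 := by
    funext s
    rw [← LinearMap.det_toMatrix b, map_add, map_smul, LinearMap.toMatrix_one,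
      Matrix.det_one_add_smul]
  rw [h1, LinearMap.trace_eq_matrix_trace ℝ b, ← hN]
  have h2 := ((hasDerivAt_const (0 : ℝ) (1 : ℝ)).add ((hasDerivAt_id (0 : ℝ)).const_mul
    N.trace)).add ((p.hasDerivAt 0).mul ((hasDerivAt_id (0 : ℝ)).pow 2))
  convert! h2 using 1
  simp

lemma IsPosDef.det_ne_zero {A : V →ₗ[ℝ] V} (hA : IsPosDef A) : LinearMap.det A ≠ 0 :=
  (LinearMap.isUnit_det A hA.isUnit).ne_zero

/-- Factoring out A reduces this to the derivative of det at the identity. -/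
lemma IsPosDef.hasDerivAt_log_det {A : V →ₗ[ℝ] V} (hA : IsPosDef A) (X : V →ₗ[ℝ] V) :
    HasDerivAt (fun s : ℝ => Real.log (LinearMap.det (A + s • X)))
      (LinearMap.trace ℝ V (Ring.inverse A * X)) 0 := by
  have h1 : ∀ s : ℝ, LinearMap.det (A + s • X) =
      LinearMap.det A * LinearMap.det (1 + s • (Ring.inverse A * X)) := by
    intro s
    rw [← map_mul, mul_add, mul_one, mul_smul_comm, ← mul_assoc,
      Ring.mul_inverse_cancel A hA.isUnit, one_mul]
  simp only [h1]
  have h2 := ((hasDerivAt_det_one_add_smul (Ring.inverse A * X)).const_mul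
    (LinearMap.det A)).log (by simpa using hA.det_ne_zero)
  convert! h2 using 1
  have := hA.det_ne_zero
  simp [this]

/-- Pairing with a symmetric operator sees only the symmetric part of X, so non-symmetric
perturbations can be symmetrised. -/
lemma trace_mul_adjoint_of_isSymmetric {A : V →ₗ[ℝ] V} (hA : A.IsSymmetric) (X : V →ₗ[ℝ] V) :
    LinearMap.trace ℝ V (A * LinearMap.adjoint X) = LinearMap.trace ℝ V (A * X) := by
  rw [LinearMap.trace_mul_comm, LinearMap.trace_eq_sum_inner _ (stdOrthonormalBasis ℝ V),
    LinearMap.trace_eq_sum_inner _ (stdOrthonormalBasis ℝ V)]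
  refine Finset.sum_congr rfl fun k _ => ?_
  simp only [Module.End.mul_apply]
  rw [LinearMap.adjoint_inner_right, ← hA, real_inner_comm]

/-- The rank-one operator `z ↦ ⟨x, z⟩ y`. -/
def rankOneMap (x y : V) : V →ₗ[ℝ] V := LinearMap.toSpanSingleton ℝ V y ∘ₗ innerₛₗ ℝ x

@[simp] lemma rankOneMap_apply (x y z : V) : rankOneMap x y z = inner ℝ x z • y := by
  simp [rankOneMap]

lemma trace_mul_rankOneMap (A : V →ₗ[ℝ] V) (x y : V) :
    LinearMap.trace ℝ V (A * rankOneMap x y) = inner ℝ (A y) x := by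
  rw [LinearMap.trace_eq_sum_inner _ (stdOrthonormalBasis ℝ V)]
  simp only [Module.End.mul_apply, rankOneMap_apply, map_smul, real_inner_smul_right]
  rw [real_inner_comm, ← (stdOrthonormalBasis ℝ V).sum_inner_mul_inner x (A y)]

variable (V) in
/-- The cone of operators with non-negative quadratic form. -/
def nonnegFormCone : PointedCone ℝ (V →ₗ[ℝ] V) where
  carrier := {M | ∀ x, 0 ≤ inner ℝ (M x) x}
  add_mem' := by
    intro M N hM hN x
    simpa [inner_add_left] using add_nonneg (hM x) (hN x)
  zero_mem' := by simp
  smul_mem' := by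
    intro r M hM x
    change 0 ≤ inner ℝ ((r : ℝ) • M x) x
    rw [real_inner_smul_left]
    exact mul_nonneg r.2 (hM x)

lemma mem_nonnegFormCone {M : V →ₗ[ℝ] V} :
    M ∈ nonnegFormCone V ↔ ∀ x, 0 ≤ inner ℝ (M x) x := Iff.rfl

/-- A functional that is non-negative on operators with non-negative quadratic form is given by
pairing with a positive operator. -/
lemma exists_isPositive_of_nonneg {g : (V →ₗ[ℝ] V) →ₗ[ℝ] ℝ}
    (hg : ∀ M ∈ nonnegFormCone V, 0 ≤ g M) :
    ∃ S : V →ₗ[ℝ] V, S.IsPositive ∧ ∀ x y, inner ℝ (S x) y = g (rankOneMap x y) := by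
  set b := stdOrthonormalBasis ℝ V
  have hadd : ∀ x x' y : V, rankOneMap (x + x') y = rankOneMap x y + rankOneMap x' y := by
    intros; ext; simp [inner_add_left, add_smul]
  have hsmul : ∀ (r : ℝ) (x y : V), rankOneMap (r • x) y = r • rankOneMap x y := by
    intros; ext; simp [real_inner_smul_left, mul_smul]
  let S : V →ₗ[ℝ] V :=
    { toFun := fun x => ∑ k, g (rankOneMap x (b k)) • b k
      map_add' := by intro x y; simp [hadd, add_smul, Finset.sum_add_distrib]
      map_smul' := by intro r x; simp [hsmul, mul_smul, Finset.smul_sum] }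
  have hS : ∀ x y, inner ℝ (S x) y = g (rankOneMap x y) := by
    intro x y
    have hy : rankOneMap x y = ∑ k, inner ℝ (b k) y • rankOneMap x (b k) := by
      ext z
      conv_lhs => rw [rankOneMap_apply, ← b.sum_repr' y]
      simp only [LinearMap.sum_apply, LinearMap.smul_apply, rankOneMap_apply, Finset.smul_sum]
      exact Finset.sum_congr rfl fun k _ => smul_comm _ _ _
    rw [hy, map_sum]
    simp only [S, LinearMap.coe_mk, AddHom.coe_mk, sum_inner, real_inner_smul_left, map_smul,
      smul_eq_mul]
    exact Finset.sum_congr rfl fun k _ => mul_comm _ _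
  -- The cone contains every antisymmetric operator along with its negative, so g vanishes on them.
  -- Applied to the difference of the rank-one maps of (x, y) and (y, x), this makes S symmetric.
  have hanti : ∀ M : V →ₗ[ℝ] V, (∀ x, inner ℝ (M x) x = 0) → g M = 0 := by
    intro M hM
    have h1 := hg M fun x => (hM x).ge
    have h2 := hg (-M) fun x => by simp [hM x]
    rw [map_neg] at h2
    linarith
  refine ⟨S, (LinearMap.isPositive_iff S).2 ⟨fun x y => ?_, fun x => ?_⟩, hS⟩
  · rw [real_inner_comm _ x, hS, hS, ← sub_eq_zero, ← map_sub]
    refine hanti _ fun z => ?_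
    simp only [LinearMap.sub_apply, rankOneMap_apply, inner_sub_left, real_inner_smul_left]
    ring
  · rw [hS]
    refine hg _ fun z => ?_
    rw [rankOneMap_apply, real_inner_smul_left]
    exact mul_self_nonneg _

end SingleSpace

namespace Datum

variable {ι κ : Type*} [Fintype ι] [Fintype κ] {E : ι → Type*} {F : κ → Type*}
  [∀ i, NormedAddCommGroup (E i)] [∀ i, InnerProductSpace ℝ (E i)]
  [∀ j, NormedAddCommGroup (F j)] [∀ j, InnerProductSpace ℝ (F j)]

/-- `∑ i, c_i log det U_i - ∑ j, d_j log det V_j`. -/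
def logDet (D : Datum E F) (U : ∀ i, E i →ₗ[ℝ] E i) (V : ∀ j, F j →ₗ[ℝ] F j) : ℝ :=
  ∑ i, D.c i * Real.log (LinearMap.det (U i)) - ∑ j, D.d j * Real.log (LinearMap.det (V j))

variable [∀ i, FiniteDimensional ℝ (E i)] [∀ j, FiniteDimensional ℝ (F j)]

/-- The constraint map `(X, Y) ↦ ⨁ i, c_i X_i - Q^* (⨁ j, d_j Y_j) Q`. -/
def constraintMap (D : Datum E F) :
    ((∀ i, E i →ₗ[ℝ] E i) × (∀ j, F j →ₗ[ℝ] F j)) →ₗ[ℝ] (PiLp 2 E →ₗ[ℝ] PiLp 2 E) where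
  toFun p := blockMap (fun i => D.c i • p.1 i) -
    LinearMap.adjoint D.Q ∘ₗ blockMap (fun j => D.d j • p.2 j) ∘ₗ D.Q
  map_add' p q := by
    have h1 : ∀ (X X' : ∀ i, E i →ₗ[ℝ] E i), blockMap (fun i => D.c i • (X i + X' i)) =
        blockMap (fun i => D.c i • X i) + blockMap (fun i => D.c i • X' i) := by
      intros; ext; simp
    have h2 : ∀ (X X' : ∀ j, F j →ₗ[ℝ] F j), blockMap (fun i => D.d i • (X i + X' i)) =
        blockMap (fun i => D.d i • X i) + blockMap (fun i => D.d i • X' i) := by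
      intros; ext; simp
    simp only [Prod.fst_add, Prod.snd_add, Pi.add_apply, h1, h2, LinearMap.comp_add,
      LinearMap.add_comp]
    abel
  map_smul' r p := by
    have h1 : ∀ (X : ∀ i, E i →ₗ[ℝ] E i), blockMap (fun i => D.c i • (r • X i)) =
        r • blockMap (fun i => D.c i • X i) := by
      intro X; ext x i; simp [smul_comm r (D.c i)]
    have h2 : ∀ (X : ∀ j, F j →ₗ[ℝ] F j), blockMap (fun i => D.d i • (r • X i)) =
        r • blockMap (fun i => D.d i • X i) := by
      intro X; ext x i; simp [smul_comm r (D.d i)]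
    simp only [Prod.smul_fst, Prod.smul_snd, Pi.smul_apply, h1, h2, LinearMap.comp_smul,
      LinearMap.smul_comp, smul_sub, RingHom.id_apply]

lemma constraintMap_apply (D : Datum E F) (p : (∀ i, E i →ₗ[ℝ] E i) × (∀ j, F j →ₗ[ℝ] F j)) :
    D.constraintMap p = blockMap (fun i => D.c i • p.1 i) -
      LinearMap.adjoint D.Q ∘ₗ blockMap (fun j => D.d j • p.2 j) ∘ₗ D.Q := rfl

lemma inner_constraintMap (D : Datum E F) (X : ∀ i, E i →ₗ[ℝ] E i) (Y : ∀ j, F j →ₗ[ℝ] F j)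
    (x : PiLp 2 E) : inner ℝ (D.constraintMap (X, Y) x) x =
      ∑ i, D.c i * inner ℝ (X i (x i)) (x i) -
        ∑ j, D.d j * inner ℝ (Y j (D.Q x j)) (D.Q x j) := by
  simp only [constraintMap_apply, LinearMap.sub_apply, inner_sub_left, LinearMap.comp_apply,
    LinearMap.adjoint_inner_left]
  simp [PiLp.inner_apply, real_inner_smul_left]

/-- The derivative of `logDet` at `(U, V)`. -/
def logDetDeriv (D : Datum E F) (U : ∀ i, E i →ₗ[ℝ] E i) (V : ∀ j, F j →ₗ[ℝ] F j) :
    ((∀ i, E i →ₗ[ℝ] E i) × (∀ j, F j →ₗ[ℝ] F j)) →ₗ[ℝ] ℝ where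
  toFun p := ∑ i, D.c i * LinearMap.trace ℝ (E i) (Ring.inverse (U i) * p.1 i) -
    ∑ j, D.d j * LinearMap.trace ℝ (F j) (Ring.inverse (V j) * p.2 j)
  map_add' p q := by
    simp only [Prod.fst_add, Prod.snd_add, Pi.add_apply, mul_add, map_add,
      Finset.sum_add_distrib]
    ring
  map_smul' r p := by
    simp only [Prod.smul_fst, Prod.smul_snd, Pi.smul_apply, mul_smul_comm, map_smul, smul_eq_mul,
      RingHom.id_apply, mul_sub, Finset.mul_sum]
    congr 1 <;> exact Finset.sum_congr rfl fun _ _ => by ring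

lemma logDetDeriv_apply (D : Datum E F) (U : ∀ i, E i →ₗ[ℝ] E i) (V : ∀ j, F j →ₗ[ℝ] F j)
    (X : ∀ i, E i →ₗ[ℝ] E i) (Y : ∀ j, F j →ₗ[ℝ] F j) : D.logDetDeriv U V (X, Y) =
    ∑ i, D.c i * LinearMap.trace ℝ (E i) (Ring.inverse (U i) * X i) -
    ∑ j, D.d j * LinearMap.trace ℝ (F j) (Ring.inverse (V j) * Y j) := rfl

section FirstOrder

variable {D : Datum E F} {U : ∀ i, E i →ₗ[ℝ] E i} {V : ∀ j, F j →ₗ[ℝ] F j}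

/-- The constraint is a linear cone condition and positive definiteness is open among symmetric
operators, so (U + sX, V + sY) stays feasible for small s > 0. The one-sided difference quotients at
a minimum are then non-negative. -/
lemma logDetDeriv_nonneg_of_isSymmetric (hU : ∀ i, IsPosDef (U i)) (hV : ∀ j, IsPosDef (V j))
    (hdom : D.Dominates U V)
    (hopt : ∀ U' V', (∀ i, IsPosDef (U' i)) → (∀ j, IsPosDef (V' j)) → D.Dominates U' V' →
      D.logDet U V ≤ D.logDet U' V')
    {X : ∀ i, E i →ₗ[ℝ] E i} {Y : ∀ j, F j →ₗ[ℝ] F j}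
    (hX : ∀ i, (X i).IsSymmetric) (hY : ∀ j, (Y j).IsSymmetric) (hXY : D.Dominates X Y) :
    0 ≤ D.logDetDeriv U V (X, Y) := by
  have hder : HasDerivAt (fun s : ℝ => D.logDet (fun i => U i + s • X i) (fun j => V j + s • Y j))
      (D.logDetDeriv U V (X, Y)) 0 := by
    have h1 : HasDerivAt
        (fun s : ℝ => ∑ i, D.c i * Real.log (LinearMap.det (U i + s • X i)))
        (∑ i, D.c i * LinearMap.trace ℝ (E i) (Ring.inverse (U i) * X i)) 0 :=
      HasDerivAt.fun_sum fun i _ => ((hU i).hasDerivAt_log_det (X i)).const_mul (D.c i)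
    have h2 : HasDerivAt
        (fun s : ℝ => ∑ j, D.d j * Real.log (LinearMap.det (V j + s • Y j)))
        (∑ j, D.d j * LinearMap.trace ℝ (F j) (Ring.inverse (V j) * Y j)) 0 :=
      HasDerivAt.fun_sum fun j _ => ((hV j).hasDerivAt_log_det (Y j)).const_mul (D.d j)
    exact h1.sub h2
  have hlim := hder.tendsto_slope_zero_right
  refine ge_of_tendsto hlim ?_
  have hUs : ∀ᶠ s : ℝ in nhdsWithin 0 (Set.Ioi 0), ∀ i, IsPosDef (U i + s • X i) :=
    Filter.eventually_all.2 fun i => (hU i).eventually_add_smul (hX i)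
  have hVs : ∀ᶠ s : ℝ in nhdsWithin 0 (Set.Ioi 0), ∀ j, IsPosDef (V j + s • Y j) :=
    Filter.eventually_all.2 fun j => (hV j).eventually_add_smul (hY j)
  filter_upwards [hUs, hVs, self_mem_nhdsWithin] with s h1 h2 h3
  have hs : 0 < s := h3
  have hds : D.Dominates (fun i => U i + s • X i) (fun j => V j + s • Y j) := by
    intro x
    have ha := hdom x
    have hb := mul_le_mul_of_nonneg_left (hXY x) hs.le
    simp only [LinearMap.add_apply, LinearMap.smul_apply, inner_add_left, real_inner_smul_left,
      mul_add, Finset.sum_add_distrib]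
    simp only [Finset.mul_sum] at hb
    have e1 : ∀ i, D.c i * (s * inner ℝ (X i (x i)) (x i)) =
      s * (D.c i * inner ℝ (X i (x i)) (x i)) := fun i => by ring
    have e2 : ∀ j, D.d j * (s * inner ℝ (Y j (D.Q x j)) (D.Q x j)) =
      s * (D.d j * inner ℝ (Y j (D.Q x j)) (D.Q x j)) := fun i => by ring
    simp only [e1, e2]
    linarith
  have := hopt _ _ h1 h2 hds
  simp only [zero_add, zero_smul, add_zero, smul_eq_mul]
  exact mul_nonneg (inv_nonneg.2 hs.le) (sub_nonneg.2 this)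

/-- Symmetry of the directions is removed because the multiplier is sought as a functional on all
operators. Replacing X by X + X^* doubles both the quadratic forms and the derivative. -/
lemma logDetDeriv_nonneg (hU : ∀ i, IsPosDef (U i)) (hV : ∀ j, IsPosDef (V j))
    (hdom : D.Dominates U V)
    (hopt : ∀ U' V', (∀ i, IsPosDef (U' i)) → (∀ j, IsPosDef (V' j)) → D.Dominates U' V' →
      D.logDet U V ≤ D.logDet U' V')
    {X : ∀ i, E i →ₗ[ℝ] E i} {Y : ∀ j, F j →ₗ[ℝ] F j} (hXY : D.Dominates X Y) :
    0 ≤ D.logDetDeriv U V (X, Y) := by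
  have h := logDetDeriv_nonneg_of_isSymmetric hU hV hdom hopt
    (X := fun i => X i + LinearMap.adjoint (X i)) (Y := fun j => Y j + LinearMap.adjoint (Y j))
    (fun i x y => by
      simp only [LinearMap.add_apply, inner_add_left, inner_add_right,
        LinearMap.adjoint_inner_left, LinearMap.adjoint_inner_right]
      ring)
    (fun j x y => by
      simp only [LinearMap.add_apply, inner_add_left, inner_add_right,
        LinearMap.adjoint_inner_left, LinearMap.adjoint_inner_right]
      ring)
    (fun x => by
      have e1 : ∀ i, inner ℝ ((X i + LinearMap.adjoint (X i)) (x i)) (x i) =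
          2 * inner ℝ (X i (x i)) (x i) := fun i => by
        rw [LinearMap.add_apply, inner_add_left, LinearMap.adjoint_inner_left,
          real_inner_comm (X i (x i))]
        ring
      have e2 : ∀ j, inner ℝ ((Y j + LinearMap.adjoint (Y j)) (D.Q x j)) (D.Q x j) =
          2 * inner ℝ (Y j (D.Q x j)) (D.Q x j) := fun j => by
        rw [LinearMap.add_apply, inner_add_left, LinearMap.adjoint_inner_left,
          real_inner_comm (Y j (D.Q x j))]
        ring
      simp only [e1, e2]
      have := hXY x
      simp only [mul_left_comm _ (2 : ℝ), ← Finset.mul_sum]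
      linarith)
  rw [logDetDeriv_apply] at h ⊢
  simp only [mul_add, map_add, trace_mul_adjoint_of_isSymmetric (hU _).inverse.1,
    trace_mul_adjoint_of_isSymmetric (hV _).inverse.1, Finset.sum_add_distrib] at h
  linarith

/-- Optimality among centred Gaussians implies the Karush-Kuhn-Tucker conditions. -/
theorem isCritical_of_logDet_le (hU : ∀ i, IsPosDef (U i)) (hV : ∀ j, IsPosDef (V j))
    (hdom : D.Dominates U V)
    (hopt : ∀ U' V', (∀ i, IsPosDef (U' i)) → (∀ j, IsPosDef (V' j)) → D.Dominates U' V' →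
      D.logDet U V ≤ D.logDet U' V') : D.IsCritical U V := by
  classical
  set T := D.constraintMap with hT
  set l := D.logDetDeriv U V with hl
  have hnonneg : ∀ p, T p ∈ nonnegFormCone (PiLp 2 E) → 0 ≤ l p := by
    rintro ⟨X, Y⟩ h
    refine logDetDeriv_nonneg hU hV hdom hopt fun x => ?_
    have := mem_nonnegFormCone.1 h x
    rw [hT, inner_constraintMap] at this
    linarith
  -- A direction in the kernel of the constraint map is feasible together with its negative, so the
  -- derivative vanishes there and factors through T.
  have hker : l ∈ (LinearMap.ker T).dualAnnihilator := by
    rw [Submodule.mem_dualAnnihilator]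
    intro p hp
    rw [LinearMap.mem_ker] at hp
    have h1 := hnonneg p (by rw [hp]; exact zero_mem _)
    have h2 := hnonneg (-p) (by rw [map_neg, hp, neg_zero]; exact zero_mem _)
    rw [map_neg] at h2
    linarith
  rw [← LinearMap.range_dualMap_eq_dualAnnihilator_ker] at hker
  obtain ⟨g₀, hg₀⟩ := hker
  have hg₀' : ∀ p, g₀ (T p) = l p := fun p => LinearMap.congr_fun hg₀ p
  -- Existence of the multiplier: the functional, non-negative on the part of the cone in the range
  -- of T, extends to one that is non-negative on the whole cone.
  obtain ⟨g, hgT, hg⟩ := riesz_extension (nonnegFormCone (PiLp 2 E))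
    ⟨LinearMap.range T, g₀.domRestrict (LinearMap.range T)⟩
    (by
      rintro ⟨_, p, rfl⟩ hx
      change 0 ≤ g₀ (T p)
      rw [hg₀']
      exact hnonneg p hx)
    (by
      intro M
      obtain ⟨r, hr, h⟩ := exists_forall_abs_inner_le M
      -- The extension theorem requires every M to enter the cone after adding an element of the
      -- range. This element is r times the identity, with r a bound for the quadratic form of M.
      refine ⟨⟨T (fun i => (r / D.c i) • LinearMap.id, 0), LinearMap.mem_range_self T _⟩, ?_⟩
      rw [mem_nonnegFormCone]
      intro x
      have h1 : ∀ i, D.c i * (r / D.c i * inner ℝ (x i) (x i)) = r * inner ℝ (x i) (x i) :=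
        fun i => by
          have := (D.c_pos i).ne'
          field_simp
      simp only [LinearMap.add_apply, inner_add_left, hT, inner_constraintMap,
        LinearMap.smul_apply, real_inner_smul_left, LinearMap.id_apply, h1, Pi.zero_apply,
        LinearMap.zero_apply, inner_zero_left, mul_zero, Finset.sum_const_zero, sub_zero]
      rw [← Finset.mul_sum, ← PiLp.inner_apply, real_inner_self_eq_norm_sq]
      linarith [(abs_le.1 (h x)).1])
  have hgl : ∀ p, g (T p) = l p := fun p =>
    (hgT ⟨T p, LinearMap.mem_range_self T p⟩).trans (hg₀' p)
  obtain ⟨S, hS, hSg⟩ := exists_isPositive_of_nonneg hg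
  refine ⟨hU, hV, hdom, S, hS, fun i u v => ?_, fun j u v => ?_⟩
  -- Perturbing a single block by a rank-one operator gives a rank-one constraint value. The
  -- multiplier evaluates it as an entry of S, the derivative as an entry of U_i⁻¹.
  · have key : T (Pi.single i ((D.c i)⁻¹ • rankOneMap u v), 0) =
        rankOneMap (emb E i u) (emb E i v) := by
      ext x k
      simp only [hT, constraintMap_apply, LinearMap.sub_apply, LinearMap.comp_apply,
        rankOneMap_apply, PiLp.sub_apply, blockMap_apply, LinearMap.smul_apply, PiLp.smul_apply,
        inner_emb_left]
      have h0 : blockMap (fun j => D.d j • (0 : ∀ j, F j →ₗ[ℝ] F j) j) (D.Q x) = 0 := by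
        ext; simp
      rw [h0, map_zero, PiLp.zero_apply, sub_zero]
      rcases eq_or_ne k i with rfl | hk
      · simp [smul_smul, (D.c_pos k).ne']
      · simp [hk, emb_apply_of_ne hk]
    rw [hSg, ← key, hgl, hl, logDetDeriv_apply, Finset.sum_eq_single i]
    · have := (D.c_pos i).ne'
      simp [trace_mul_rankOneMap, this]
      rw [(hU i).inverse.1, real_inner_comm]
    · intro k _ hk
      simp [hk]
    · simp
  -- The sign cancels the minus sign that the constraint map carries in front of the V-blocks;
  -- `logDetDeriv` carries the same sign.
  · have key : T (0, Pi.single j (-(D.d j)⁻¹ • rankOneMap u v)) =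
        rankOneMap (LinearMap.adjoint D.Q (emb F j u)) (LinearMap.adjoint D.Q (emb F j v)) := by
      refine LinearMap.ext fun x => ?_
      simp only [hT, constraintMap_apply, LinearMap.sub_apply, LinearMap.comp_apply,
        rankOneMap_apply]
      have h0 : blockMap (fun i => D.c i • (0 : ∀ i, E i →ₗ[ℝ] E i) i) x = 0 := by
        ext; simp
      have h1 : blockMap (fun k => D.d k •
          (Pi.single j (-(D.d j)⁻¹ • rankOneMap u v) : ∀ j, F j →ₗ[ℝ] F j) k) (D.Q x) =
          -(inner ℝ u (D.Q x j) • emb F j v) := by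
        ext k
        rcases eq_or_ne k j with rfl | hk
        · simp [smul_smul, (D.d_pos k).ne']
        · simp [hk, emb_apply_of_ne hk]
      rw [h0, h1, map_neg, map_smul, LinearMap.adjoint_inner_left, inner_emb_left]
      simp
    rw [hSg, ← key, hgl, hl, logDetDeriv_apply, Finset.sum_eq_single (s := Finset.univ) j]
    · have := (D.d_pos j).ne'
      simp [trace_mul_rankOneMap, this]
      rw [(hV j).inverse.1, real_inner_comm]
    · intro k _ hk
      simp [hk]
    · simp

end FirstOrder

end Datum

end FRBL

end

/-! ### Gaussian integrals, and from Gaussian extremizers to critical pairs. -/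

set_option linter.unusedSectionVars false

noncomputable section

namespace FRBL

section SingleSpace

variable {V : Type*} [NormedAddCommGroup V] [InnerProductSpace ℝ V] [FiniteDimensional ℝ V]

lemma IsPosDef.det_pos {A : V →ₗ[ℝ] V} (hA : IsPosDef A) : 0 < LinearMap.det A := by
  obtain ⟨C, -, hCC⟩ := hA.exists_sqrt
  have h : A = C.toLinearMap * C.toLinearMap := LinearMap.ext fun v => (hCC v).symm
  have h0 := hA.det_ne_zero
  rw [h, map_mul] at h0 ⊢
  exact lt_of_le_of_ne (mul_self_nonneg _) h0.symm

variable [MeasurableSpace V] [BorelSpace V]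

lemma integral_comp_linearEquiv {G : Type*} [NormedAddCommGroup G] [NormedSpace ℝ G]
    (C : V ≃ₗ[ℝ] V) (φ : V → G) :
    ∫ x, φ (C x) = |(LinearMap.det C.toLinearMap)⁻¹| • ∫ y, φ y := by
  have hdet : LinearMap.det C.toLinearMap ≠ 0 := C.isUnit_det'.ne_zero
  have h := Measure.map_linearMap_addHaar_eq_smul_addHaar (volume : Measure V) hdet
  have hemb : MeasurableEmbedding C :=
    C.toContinuousLinearEquiv.toHomeomorph.measurableEmbedding
  have h2 := hemb.integral_map (μ := (volume : Measure V)) φ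
  simp only [LinearEquiv.coe_coe] at h
  rw [← h2, h, integral_smul_measure, ENNReal.toReal_ofReal (abs_nonneg _)]

/-- `∫ exp (-⟨A x, x⟩) = π ^ (n / 2) / √(det A)`. -/
lemma IsPosDef.integral_gaussian {A : V →ₗ[ℝ] V} (hA : IsPosDef A) :
    ∫ x, Real.exp (-inner ℝ (A x) x) =
      Real.pi ^ ((Module.finrank ℝ V : ℝ) / 2) / Real.sqrt (LinearMap.det A) := by
  obtain ⟨C, hC, hCC⟩ := hA.exists_sqrt
  have h : A = C.toLinearMap * C.toLinearMap := LinearMap.ext fun v => (hCC v).symm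
  have h1 : ∀ x, inner ℝ (A x) x = ‖C x‖ ^ 2 := fun x => by
    rw [← hCC, hC, real_inner_self_eq_norm_sq]
  simp only [h1]
  rw [integral_comp_linearEquiv C (fun y => Real.exp (-‖y‖ ^ 2))]
  have h2 := GaussianFourier.integral_rexp_neg_mul_sq_norm (V := V) one_pos
  simp only [neg_mul, one_mul, div_one] at h2
  rw [h2, h, map_mul, Real.sqrt_mul_self_eq_abs, abs_inv, smul_eq_mul]
  ring

lemma IsPosDef.gaussianMass_pos {A : V →ₗ[ℝ] V} (hA : IsPosDef A) :
    0 < Real.pi ^ ((Module.finrank ℝ V : ℝ) / 2) / Real.sqrt (LinearMap.det A) := by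
  have := hA.det_pos
  positivity

/-- The Bochner integral of a non-integrable function is 0 by convention, whereas this one has just
been computed to be positive. -/
lemma IsPosDef.integrable_gaussian {A : V →ₗ[ℝ] V} (hA : IsPosDef A) :
    Integrable fun x => Real.exp (-inner ℝ (A x) x) := by
  by_contra h
  have h1 := integral_undef h
  rw [hA.integral_gaussian] at h1
  exact hA.gaussianMass_pos.ne' h1

lemma IsPosDef.lintegral_gaussian {A : V →ₗ[ℝ] V} (hA : IsPosDef A) :
    ∫⁻ x, ENNReal.ofReal (Real.exp (-inner ℝ (A x) x)) = ENNReal.ofReal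
      (Real.pi ^ ((Module.finrank ℝ V : ℝ) / 2) / Real.sqrt (LinearMap.det A)) := by
  rw [← hA.integral_gaussian, ofReal_integral_eq_lintegral_ofReal hA.integrable_gaussian
    (Filter.Eventually.of_forall fun x => (Real.exp_pos _).le)]

end SingleSpace

namespace Datum

variable {ι κ : Type*} [Fintype ι] [Fintype κ] {E : ι → Type*} {F : κ → Type*}
  [∀ i, NormedAddCommGroup (E i)] [∀ i, InnerProductSpace ℝ (E i)]
  [∀ j, NormedAddCommGroup (F j)] [∀ j, InnerProductSpace ℝ (F j)]

lemma relation_gaussian_iff (D : Datum E F) (U : ∀ i, E i →ₗ[ℝ] E i) (V : ∀ j, F j →ₗ[ℝ] F j) :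
    D.Relation (fun i x => Real.exp (-inner ℝ (U i x) x))
      (fun j y => Real.exp (-inner ℝ (V j y) y)) ↔ D.Dominates U V := by
  refine forall_congr' fun x => ?_
  simp only [← Real.exp_mul, ← Real.exp_sum, Real.exp_le_exp, proj_apply, mul_neg,
    Finset.sum_neg_distrib, neg_le_neg_iff, mul_comm _ (D.c _), mul_comm _ (D.d _)]

variable [∀ i, FiniteDimensional ℝ (E i)] [∀ j, FiniteDimensional ℝ (F j)]
  [∀ i, MeasurableSpace (E i)] [∀ i, BorelSpace (E i)]
  [∀ j, MeasurableSpace (F j)] [∀ j, BorelSpace (F j)]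

lemma admissible_gaussian {D : Datum E F} {U : ∀ i, E i →ₗ[ℝ] E i} {V : ∀ j, F j →ₗ[ℝ] F j}
    (hU : ∀ i, IsPosDef (U i)) (hV : ∀ j, IsPosDef (V j)) (h : D.Dominates U V) :
    D.Admissible (fun i x => Real.exp (-inner ℝ (U i x) x))
      (fun j y => Real.exp (-inner ℝ (V j y) y)) :=
  ⟨fun i => ⟨(hU i).integrable_gaussian.aemeasurable, fun _ => (Real.exp_pos _).le⟩,
    fun j => ⟨(hV j).integrable_gaussian.aemeasurable, fun _ => (Real.exp_pos _).le⟩,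
    (D.relation_gaussian_iff U V).2 h⟩

end Datum

section Mass

variable {ι : Type*} [Fintype ι] {E : ι → Type*}
  [∀ i, NormedAddCommGroup (E i)] [∀ i, InnerProductSpace ℝ (E i)]

/-- `∏ i, (∫ exp (-⟨U_i x, x⟩)) ^ c_i` in closed form. -/
def gaussianMass (c : ι → ℝ) (U : ∀ i, E i →ₗ[ℝ] E i) : ℝ :=
  ∏ i, (Real.pi ^ ((Module.finrank ℝ (E i) : ℝ) / 2) / Real.sqrt (LinearMap.det (U i))) ^ c i

variable [∀ i, FiniteDimensional ℝ (E i)] [∀ i, MeasurableSpace (E i)] [∀ i, BorelSpace (E i)]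

lemma gaussianMass_pos (c : ι → ℝ) {U : ∀ i, E i →ₗ[ℝ] E i} (hU : ∀ i, IsPosDef (U i)) :
    0 < gaussianMass c U :=
  Finset.prod_pos fun i _ => Real.rpow_pos_of_pos (hU i).gaussianMass_pos _

/-- The power of π involves only ∑ c_i dim E_i, not U, so comparisons of masses reduce to
log-determinants. -/
lemma log_gaussianMass (c : ι → ℝ) {U : ∀ i, E i →ₗ[ℝ] E i} (hU : ∀ i, IsPosDef (U i)) :
    Real.log (gaussianMass c U) =
      (∑ i, c i * (Module.finrank ℝ (E i) : ℝ)) / 2 * Real.log Real.pi -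
        (∑ i, c i * Real.log (LinearMap.det (U i))) / 2 := by
  rw [gaussianMass, Real.log_prod fun i _ => (Real.rpow_pos_of_pos (hU i).gaussianMass_pos _).ne',
    Finset.sum_div, Finset.sum_mul, Finset.sum_div, ← Finset.sum_sub_distrib]
  refine Finset.sum_congr rfl fun i _ => ?_
  have h1 := (hU i).det_pos
  rw [Real.log_rpow (hU i).gaussianMass_pos, Real.log_div (by positivity) (by positivity),
    Real.log_rpow Real.pi_pos, Real.log_sqrt h1.le]
  ring

lemma prod_lintegral_gaussian {c : ι → ℝ} (hc : ∀ i, 0 < c i) {U : ∀ i, E i →ₗ[ℝ] E i}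
    (hU : ∀ i, IsPosDef (U i)) :
    ∏ i, (∫⁻ x, ENNReal.ofReal (Real.exp (-inner ℝ (U i x) x))) ^ c i =
      ENNReal.ofReal (gaussianMass c U) := by
  rw [gaussianMass, ENNReal.ofReal_prod_of_nonneg fun i _ =>
    (Real.rpow_pos_of_pos (hU i).gaussianMass_pos _).le]
  refine Finset.prod_congr rfl fun i _ => ?_
  rw [(hU i).lintegral_gaussian, ENNReal.ofReal_rpow_of_nonneg (hU i).gaussianMass_pos.le (hc i).le]

end Mass

namespace Datum

variable {ι κ : Type*} [Fintype ι] [Fintype κ] {E : ι → Type*} {F : κ → Type*}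
  [∀ i, NormedAddCommGroup (E i)] [∀ i, InnerProductSpace ℝ (E i)]
  [∀ j, NormedAddCommGroup (F j)] [∀ j, InnerProductSpace ℝ (F j)]
  [∀ i, FiniteDimensional ℝ (E i)] [∀ j, FiniteDimensional ℝ (F j)]
  [∀ i, MeasurableSpace (E i)] [∀ i, BorelSpace (E i)]
  [∀ j, MeasurableSpace (F j)] [∀ j, BorelSpace (F j)]

/-- When the reverse product is non-zero and finite one may divide by it, and the quotient is then a
lower bound for every constant in the infimum. -/
lemma forwardProd_le_constant_mul {D : Datum E F} {f : ∀ i, E i → ℝ} {g : ∀ j, F j → ℝ}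
    (h : D.Admissible f g) (h0 : D.reverseProd g ≠ 0) (h1 : D.reverseProd g ≠ ∞) :
    D.forwardProd f ≤ D.constant * D.reverseProd g := by
  rw [← ENNReal.div_le_iff h0 h1]
  exact le_sInf fun C hC => (ENNReal.div_le_iff h0 h1).2 (hC f g h)

/-- Gaussian extremizers satisfy the Karush-Kuhn-Tucker conditions. -/
theorem exists_isCritical_of_gaussian_extremizer {D : Datum E F} {f : ∀ i, E i → ℝ}
    {g : ∀ j, F j → ℝ} (hf : ∀ i, IsCentredGaussian (f i)) (hg : ∀ j, IsCentredGaussian (g j))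
    (h : D.IsExtremizer f g) : ∃ U V, D.IsCritical U V := by
  choose U hU hfU using hf
  choose V hV hgV using hg
  obtain rfl : f = fun i x => Real.exp (-inner ℝ (U i x) x) := funext hfU
  obtain rfl : g = fun j y => Real.exp (-inner ℝ (V j y) y) := funext hgV
  obtain ⟨⟨-, -, hrel⟩, heq, -, hfin⟩ := h
  have hdom := (D.relation_gaussian_iff U V).1 hrel
  have hfwd : ∀ U' : ∀ i, E i →ₗ[ℝ] E i, (∀ i, IsPosDef (U' i)) →
      D.forwardProd (fun i x => Real.exp (-inner ℝ (U' i x) x)) =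
        ENNReal.ofReal (gaussianMass D.c U') := fun U' hU' =>
    prod_lintegral_gaussian D.c_pos hU'
  have hrev : ∀ V' : ∀ j, F j →ₗ[ℝ] F j, (∀ j, IsPosDef (V' j)) →
      D.reverseProd (fun j x => Real.exp (-inner ℝ (V' j x) x)) =
        ENNReal.ofReal (gaussianMass D.d V') := fun V' hV' =>
    prod_lintegral_gaussian D.d_pos hV'
  have hpos : ∀ V' : ∀ j, F j →ₗ[ℝ] F j, (∀ j, IsPosDef (V' j)) →
      ENNReal.ofReal (gaussianMass D.d V') ≠ 0 := fun V' hV' => by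
    simpa using gaussianMass_pos D.d hV'
  refine ⟨U, V, isCritical_of_logDet_le hU hV hdom fun U' V' hU' hV' hdom' => ?_⟩
  have hle := forwardProd_le_constant_mul (admissible_gaussian hU' hV' hdom')
    (by rw [hrev V' hV']; exact hpos V' hV') (by rw [hrev V' hV']; exact ENNReal.ofReal_ne_top)
  rw [hfwd U' hU', hrev V' hV'] at hle
  rw [hfwd U hU, hrev V hV] at heq
  -- Cross-multiplying with the equality for (U, V) eliminates the constant, so its value and
  -- finiteness are not needed.
  have hmul : gaussianMass D.c U' * gaussianMass D.d V ≤
      gaussianMass D.c U * gaussianMass D.d V' := by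
    have h1 := gaussianMass_pos D.c hU
    have h2 := gaussianMass_pos D.c hU'
    have h3 := gaussianMass_pos D.d hV
    have h4 := gaussianMass_pos D.d hV'
    rw [← ENNReal.ofReal_le_ofReal_iff (by positivity), ENNReal.ofReal_mul h2.le,
      ENNReal.ofReal_mul h1.le, heq]
    calc _ ≤ D.constant * ENNReal.ofReal (gaussianMass D.d V') *
          ENNReal.ofReal (gaussianMass D.d V) := by gcongr
      _ = _ := by ring
  have hlog := Real.log_le_log (mul_pos (gaussianMass_pos D.c hU') (gaussianMass_pos D.d hV)) hmul
  rw [Real.log_mul (gaussianMass_pos D.c hU').ne' (gaussianMass_pos D.d hV).ne',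
    Real.log_mul (gaussianMass_pos D.c hU).ne' (gaussianMass_pos D.d hV').ne',
    log_gaussianMass _ hU, log_gaussianMass _ hV, log_gaussianMass _ hU', log_gaussianMass _ hV']
    at hlog
  simp only [logDet]
  linarith

end Datum

end FRBL

end

/-! ### Long-time asymptotics of the heat flow and the sharp constant. -/

set_option linter.unusedSectionVars false

noncomputable section

namespace FRBL

section SingleSpace

variable {V : Type*} [NormedAddCommGroup V] [InnerProductSpace ℝ V] [FiniteDimensional ℝ V]

lemma continuous_inner_apply_self (A : V →ₗ[ℝ] V) : Continuous fun x => inner ℝ (A x) x :=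
  A.continuous_of_finiteDimensional.inner continuous_id

lemma IsPosDef.log_det_inverse {A : V →ₗ[ℝ] V} (hA : IsPosDef A) :
    Real.log (LinearMap.det (Ring.inverse A : V →ₗ[ℝ] V)) = -Real.log (LinearMap.det A) := by
  have h1 : LinearMap.det A * LinearMap.det (Ring.inverse A : V →ₗ[ℝ] V) = 1 := by
    rw [← map_mul, Ring.mul_inverse_cancel A hA.isUnit, map_one]
  rw [eq_inv_of_mul_eq_one_right h1, Real.log_inv]

lemma heatKernel_nonneg (A : V →ₗ[ℝ] V) {t : ℝ} (ht : 0 < t) (x : V) : 0 ≤ heatKernel A t x := by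
  have := Real.pi_pos
  unfold heatKernel
  positivity

variable [MeasurableSpace V] [BorelSpace V]

lemma heatSemigroup_nonneg (A : V →ₗ[ℝ] V) {t : ℝ} (ht : 0 < t) {f : V → ℝ} (hf : ∀ x, 0 ≤ f x)
    (x : V) : 0 ≤ heatSemigroup A t f x :=
  integral_nonneg fun y => mul_nonneg (hf y) (heatKernel_nonneg A ht _)

/-- Long-time asymptotics of the heat semigroup in the diffusive scaling. -/
lemma tendsto_heatSemigroup {A : V →ₗ[ℝ] V} (hA : IsPosDef A) {f : V → ℝ} (hf : Integrable f)
    (x : V) :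
    Filter.Tendsto (fun t : ℝ => (4 * Real.pi * t) ^ ((Module.finrank ℝ V : ℝ) / 2) *
      Real.sqrt (LinearMap.det A) * heatSemigroup A t f (Real.sqrt t • x)) Filter.atTop
      (nhds (Real.exp (-inner ℝ ((Ring.inverse A : V →ₗ[ℝ] V) x) x / 4) * ∫ y, f y)) := by
  set P : V →ₗ[ℝ] V := Ring.inverse A with hP
  have hPos : IsPosDef P := hA.inverse
  have hcont : Continuous fun z => Real.exp (-inner ℝ (P z) z / 4) :=
    Real.continuous_exp.comp ((continuous_inner_apply_self P).neg.div_const 4)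
  have h1 : ∀ᶠ t : ℝ in Filter.atTop, ∫ y, f y * Real.exp
      (-inner ℝ (P (x - (Real.sqrt t)⁻¹ • y)) (x - (Real.sqrt t)⁻¹ • y) / 4) =
      (4 * Real.pi * t) ^ ((Module.finrank ℝ V : ℝ) / 2) *
      Real.sqrt (LinearMap.det A) * heatSemigroup A t f (Real.sqrt t • x) := by
    filter_upwards [Filter.eventually_gt_atTop (0 : ℝ)] with t ht
    have hpi := Real.pi_pos
    have hdet := hA.det_pos
    have hs : 0 < Real.sqrt t := Real.sqrt_pos.2 ht
    set N := (4 * Real.pi * t) ^ ((Module.finrank ℝ V : ℝ) / 2) * Real.sqrt (LinearMap.det A)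
      with hN
    have hN0 : 0 < N := by positivity
    rw [heatSemigroup, ← integral_const_mul]
    refine integral_congr_ae (Filter.Eventually.of_forall fun y => ?_)
    simp only [heatKernel]
    rw [← hN, ← hP]
    have hz : Real.sqrt t • x - y = Real.sqrt t • (x - (Real.sqrt t)⁻¹ • y) := by
      rw [smul_sub, smul_smul, mul_inv_cancel₀ hs.ne', one_smul]
    rw [hz, map_smul, real_inner_smul_left, real_inner_smul_right,
      ← mul_assoc (Real.sqrt t), Real.mul_self_sqrt ht.le]
    have h4 : ∀ r : ℝ, -(t * r) / (4 * t) = -r / 4 := fun r => by field_simp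
    rw [h4]
    field_simp
  refine Filter.Tendsto.congr' h1 ?_
  rw [mul_comm, ← integral_mul_const]
  -- After rescaling, the Gaussian factor is at most 1, so |f| dominates for all t.
  refine tendsto_integral_filter_of_dominated_convergence (fun y => ‖f y‖) ?_ ?_ hf.norm ?_
  · refine Filter.Eventually.of_forall fun t => hf.aestronglyMeasurable.mul ?_
    have : Continuous fun y : V => x - (Real.sqrt t)⁻¹ • y := by fun_prop
    exact (hcont.comp this).aestronglyMeasurable
  · refine Filter.Eventually.of_forall fun t => Filter.Eventually.of_forall fun y => ?_
    rw [norm_mul, Real.norm_of_nonneg (Real.exp_pos _).le]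
    refine mul_le_of_le_one_right (norm_nonneg _) (Real.exp_le_one_iff.2 ?_)
    have := hPos.inner_nonneg (x - (Real.sqrt t)⁻¹ • y)
    linarith
  · refine Filter.Eventually.of_forall fun y => Filter.Tendsto.const_mul _ ?_
    have h2 : Filter.Tendsto (fun t : ℝ => x - (Real.sqrt t)⁻¹ • y) Filter.atTop (nhds x) := by
      have h3 : Filter.Tendsto (fun t : ℝ => (Real.sqrt t)⁻¹) Filter.atTop (nhds 0) :=
        Real.tendsto_sqrt_atTop.inv_tendsto_atTop
      simpa using tendsto_const_nhds.sub (h3.smul_const y)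
    exact (hcont.tendsto x).comp h2

/-- Truncation of a function in space and in height. -/
def trunc (n : ℕ) (f : V → ℝ) : V → ℝ :=
  (Metric.closedBall (0 : V) n).indicator fun x => min (f x) n

lemma trunc_nonneg (n : ℕ) {f : V → ℝ} (hf : ∀ x, 0 ≤ f x) (x : V) : 0 ≤ trunc n f x :=
  Set.indicator_nonneg (fun _ _ => le_min (hf _) n.cast_nonneg) x

lemma trunc_le (n : ℕ) {f : V → ℝ} (hf : ∀ x, 0 ≤ f x) (x : V) : trunc n f x ≤ f x :=
  Set.indicator_le' (fun _ _ => min_le_left _ _) (fun y _ => hf y) x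

lemma trunc_le_natCast (n : ℕ) (f : V → ℝ) (x : V) : trunc n f x ≤ n :=
  Set.indicator_le' (fun _ _ => min_le_right _ _) (fun _ _ => n.cast_nonneg) x

lemma trunc_of_norm_gt {n : ℕ} {f : V → ℝ} {x : V} (hx : (n : ℝ) < ‖x‖) : trunc n f x = 0 :=
  Set.indicator_of_notMem (by simpa using hx) _

lemma trunc_eq_self {n : ℕ} {f : V → ℝ} {x : V} (hx : ‖x‖ ≤ n) (hf : f x ≤ n) :
    trunc n f x = f x := by
  rw [trunc, Set.indicator_of_mem (by simpa using hx), min_eq_left hf]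

lemma trunc_mono {f : V → ℝ} (hf : ∀ x, 0 ≤ f x) (x : V) : Monotone fun n => trunc n f x := by
  intro m n hmn
  have hmn' : (m : ℝ) ≤ n := by exact_mod_cast hmn
  rcases le_or_gt ‖x‖ (m : ℝ) with h | h
  · simp only [trunc]
    rw [Set.indicator_of_mem (by simpa using h), Set.indicator_of_mem (by simpa using h.trans hmn')]
    exact min_le_min_left _ hmn'
  · change trunc m f x ≤ trunc n f x
    rw [trunc_of_norm_gt h]
    exact trunc_nonneg n hf x

lemma integrable_trunc (n : ℕ) {f : V → ℝ} (hf : ∀ x, 0 ≤ f x) (hm : AEMeasurable f) :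
    Integrable (trunc n f) := by
  have h1 : Integrable ((Metric.closedBall (0 : V) n).indicator fun _ => (n : ℝ)) :=
    (integrable_indicator_iff measurableSet_closedBall).2
      (integrableOn_const measure_closedBall_lt_top.ne)
  refine h1.mono' ((hm.min aemeasurable_const).indicator
    measurableSet_closedBall).aestronglyMeasurable (Filter.Eventually.of_forall fun x => ?_)
  rw [Real.norm_of_nonneg (trunc_nonneg n hf x)]
  exact Set.indicator_le_indicator (min_le_right _ _)

lemma lintegral_eq_iSup_trunc {f : V → ℝ} (hf : ∀ x, 0 ≤ f x) (hm : AEMeasurable f) :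
    ∫⁻ x, ENNReal.ofReal (f x) = ⨆ n, ∫⁻ x, ENNReal.ofReal (trunc n f x) := by
  rw [← lintegral_iSup' (fun n => (integrable_trunc n hf hm).aemeasurable.ennreal_ofReal)
    (Filter.Eventually.of_forall fun x m n h => ENNReal.ofReal_le_ofReal (trunc_mono hf x h))]
  refine lintegral_congr fun x => le_antisymm ?_ (iSup_le fun n =>
    ENNReal.ofReal_le_ofReal (trunc_le n hf x))
  obtain ⟨n, hn⟩ := exists_nat_ge (max ‖x‖ (f x))
  refine le_iSup_of_le n ?_
  rw [trunc_eq_self ((le_max_left _ _).trans hn) ((le_max_right _ _).trans hn)]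

lemma integrable_indicator_closedBall (R : ℝ) :
    Integrable ((Metric.closedBall (0 : V) R).indicator fun _ => (1 : ℝ)) :=
  (integrable_indicator_iff measurableSet_closedBall).2
    (integrableOn_const measure_closedBall_lt_top.ne)

lemma integral_indicator_closedBall_pos {R : ℝ} (hR : 0 < R) :
    0 < ∫ x, (Metric.closedBall (0 : V) R).indicator (fun _ => (1 : ℝ)) x := by
  rw [integral_indicator_const _ measurableSet_closedBall, smul_eq_mul, mul_one]
  exact ENNReal.toReal_pos (Metric.measure_closedBall_pos _ _ hR).ne' measure_closedBall_lt_top.ne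

end SingleSpace

lemma ENNReal_prod_iSup_of_monotone {ι : Type*} (s : Finset ι) {a : ι → ℕ → ℝ≥0∞}
    (ha : ∀ i, Monotone (a i)) : ∏ i ∈ s, ⨆ n, a i n = ⨆ n, ∏ i ∈ s, a i n := by
  classical
  induction s using Finset.induction_on with
  | empty => simp
  | insert i s hi ih =>
    simp only [Finset.prod_insert hi]
    rw [ih, ENNReal.iSup_mul]
    simp only [ENNReal.mul_iSup]
    refine le_antisymm (iSup_le fun m => iSup_le fun n => le_iSup_of_le (max m n) ?_)
      (iSup_le fun n => le_iSup_of_le n (le_iSup_of_le n le_rfl))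
    gcongr
    · exact ha i (le_max_left _ _)
    · exact ha _ (le_max_right _ _)

namespace Datum

variable {ι κ : Type*} [Fintype ι] [Fintype κ] {E : ι → Type*} {F : κ → Type*}
  [∀ i, NormedAddCommGroup (E i)] [∀ i, InnerProductSpace ℝ (E i)]
  [∀ j, NormedAddCommGroup (F j)] [∀ j, InnerProductSpace ℝ (F j)]
  [∀ i, FiniteDimensional ℝ (E i)] [∀ j, FiniteDimensional ℝ (F j)]

/-- Supplies admissible pairs of indicators: where all the x_i lie in the balls of radius r, all
components of Qx lie in balls of radius R. -/
lemma exists_bound_Q (D : Datum E F) (r : ℝ) :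
    ∃ R : ℝ, 0 < R ∧ ∀ x : PiLp 2 E, (∀ i, ‖x i‖ ≤ r) → ∀ j, ‖D.Q x j‖ ≤ R := by
  obtain ⟨M, hM, h⟩ := exists_forall_norm_apply_le D.Q
  refine ⟨M * (Real.sqrt (∑ _i : ι, r ^ 2)) + 1, by positivity, fun x hx j => ?_⟩
  have h1 : ‖x‖ ≤ Real.sqrt (∑ _i : ι, r ^ 2) := by
    rw [PiLp.norm_eq_of_L2]
    refine Real.sqrt_le_sqrt (Finset.sum_le_sum fun i _ => ?_)
    have := hx i
    gcongr
  calc ‖D.Q x j‖ ≤ ‖D.Q x‖ := PiLp.norm_apply_le _ _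
    _ ≤ M * ‖x‖ := h x
    _ ≤ _ := by nlinarith

variable [∀ i, MeasurableSpace (E i)] [∀ i, BorelSpace (E i)]
  [∀ j, MeasurableSpace (F j)] [∀ j, BorelSpace (F j)]

/-- The heat flows with matrices `A`, `B` preserve the pointwise relation. -/
def HeatFlowPreserves (D : Datum E F) (A : ∀ i, E i →ₗ[ℝ] E i) (B : ∀ j, F j →ₗ[ℝ] F j) : Prop :=
  ∀ (f : ∀ i, E i → ℝ) (g : ∀ j, F j → ℝ),
    (∀ i, (∀ x, 0 ≤ f i x) ∧ Integrable (f i)) → (∀ j, (∀ y, 0 ≤ g j y) ∧ Integrable (g j)) →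
    D.Relation f g → ∀ t : ℝ, 0 < t →
      D.Relation (fun i => heatSemigroup (A i) t (f i)) (fun j => heatSemigroup (B j) t (g j))

section LongTime

variable {D : Datum E F} {A : ∀ i, E i →ₗ[ℝ] E i} {B : ∀ j, F j →ₗ[ℝ] F j}

/-- The preserved relation is evaluated at √t x. Multiplying it by the normalising factors of both
sides makes each side converge, and the powers of 4πt agree because ∑ c_i dim E_i = ∑ d_j dim E^j.
-/
lemma HeatFlowPreserves.limit_inequality (hA : ∀ i, IsPosDef (A i)) (hB : ∀ j, IsPosDef (B j))
    (H : D.HeatFlowPreserves A B) {f : ∀ i, E i → ℝ} {g : ∀ j, F j → ℝ}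
    (hf : ∀ i, (∀ x, 0 ≤ f i x) ∧ Integrable (f i))
    (hg : ∀ j, (∀ y, 0 ≤ g j y) ∧ Integrable (g j)) (hrel : D.Relation f g) (x : PiLp 2 E) :
    (∏ i, (Real.exp (-inner ℝ ((Ring.inverse (A i) : E i →ₗ[ℝ] E i) (x i)) (x i) / 4) *
        ∫ y, f i y) ^ D.c i) * ∏ j, Real.sqrt (LinearMap.det (B j)) ^ D.d j ≤
    (∏ j, (Real.exp (-inner ℝ ((Ring.inverse (B j) : F j →ₗ[ℝ] F j) (D.Q x j)) (D.Q x j) / 4) *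
        ∫ y, g j y) ^ D.d j) * ∏ i, Real.sqrt (LinearMap.det (A i)) ^ D.c i := by
  have hl := (tendsto_finsetProd Finset.univ fun i _ =>
    (tendsto_heatSemigroup (hA i) (hf i).2 (x i)).rpow_const (p := D.c i)
      (Or.inr (D.c_pos i).le)).mul_const (∏ j, Real.sqrt (LinearMap.det (B j)) ^ D.d j)
  have hr := (tendsto_finsetProd Finset.univ fun j _ =>
    (tendsto_heatSemigroup (hB j) (hg j).2 (D.Q x j)).rpow_const (p := D.d j)
      (Or.inr (D.d_pos j).le)).mul_const (∏ i, Real.sqrt (LinearMap.det (A i)) ^ D.c i)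
  refine le_of_tendsto_of_tendsto hl hr ?_
  filter_upwards [Filter.eventually_gt_atTop (0 : ℝ)] with t ht
  have hpi := Real.pi_pos
  have hT : 0 < 4 * Real.pi * t := by positivity
  have hrel' := H f g hf hg hrel t ht (Real.sqrt t • x)
  simp only [map_smul, proj_apply] at hrel'
  have e1 : ∀ i, ((4 * Real.pi * t) ^ ((Module.finrank ℝ (E i) : ℝ) / 2) *
      Real.sqrt (LinearMap.det (A i)) * heatSemigroup (A i) t (f i) (Real.sqrt t • x i)) ^ D.c i =
      (4 * Real.pi * t) ^ (D.c i * (Module.finrank ℝ (E i) : ℝ) / 2) *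
      Real.sqrt (LinearMap.det (A i)) ^ D.c i *
        heatSemigroup (A i) t (f i) (Real.sqrt t • x i) ^ D.c i := fun i => by
    rw [Real.mul_rpow (by positivity) (heatSemigroup_nonneg _ ht (hf i).1 _),
      Real.mul_rpow (by positivity) (by positivity), ← Real.rpow_mul hT.le]
    congr 3
    ring
  have e2 : ∀ j, ((4 * Real.pi * t) ^ ((Module.finrank ℝ (F j) : ℝ) / 2) *
      Real.sqrt (LinearMap.det (B j)) *
        heatSemigroup (B j) t (g j) (Real.sqrt t • D.Q x j)) ^ D.d j =
      (4 * Real.pi * t) ^ (D.d j * (Module.finrank ℝ (F j) : ℝ) / 2) *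
      Real.sqrt (LinearMap.det (B j)) ^ D.d j *
        heatSemigroup (B j) t (g j) (Real.sqrt t • D.Q x j) ^ D.d j := fun j => by
    rw [Real.mul_rpow (by positivity) (heatSemigroup_nonneg _ ht (hg j).1 _),
      Real.mul_rpow (by positivity) (by positivity), ← Real.rpow_mul hT.le]
    congr 3
    ring
  simp only [e1, e2, Finset.prod_mul_distrib]
  rw [← Real.rpow_sum_of_pos hT, ← Real.rpow_sum_of_pos hT, ← Finset.sum_div, ← Finset.sum_div,
    D.scaling]
  have hP : 0 ≤ ∏ i, Real.sqrt (LinearMap.det (A i)) ^ D.c i :=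
    Finset.prod_nonneg fun i _ => by positivity
  have hP' : 0 ≤ ∏ j, Real.sqrt (LinearMap.det (B j)) ^ D.d j :=
    Finset.prod_nonneg fun i _ => by positivity
  calc _ = ((4 * Real.pi * t) ^ ((∑ j, D.d j * (Module.finrank ℝ (F j) : ℝ)) / 2) *
        (∏ i, Real.sqrt (LinearMap.det (A i)) ^ D.c i) *
        ∏ j, Real.sqrt (LinearMap.det (B j)) ^ D.d j) *
          ∏ i, heatSemigroup (A i) t (f i) (Real.sqrt t • x i) ^ D.c i := by ring
    _ ≤ ((4 * Real.pi * t) ^ ((∑ j, D.d j * (Module.finrank ℝ (F j) : ℝ)) / 2) *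
        (∏ i, Real.sqrt (LinearMap.det (A i)) ^ D.c i) *
        ∏ j, Real.sqrt (LinearMap.det (B j)) ^ D.d j) *
          ∏ j, heatSemigroup (B j) t (g j) (Real.sqrt t • D.Q x j) ^ D.d j := by
        refine mul_le_mul_of_nonneg_left ?_ (by positivity)
        simpa using hrel'
    _ = _ := by ring

/-- Indicators of balls have positive masses and satisfy (R). In the limit inequality at sx the
exponents grow like s² while the masses stay fixed, so the quadratic forms must be ordered. -/
lemma HeatFlowPreserves.dominates (hA : ∀ i, IsPosDef (A i)) (hB : ∀ j, IsPosDef (B j))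
    (H : D.HeatFlowPreserves A B) :
    D.Dominates (fun i => Ring.inverse (A i)) (fun j => Ring.inverse (B j)) := by
  intro x
  obtain ⟨R, hR, hQ⟩ := D.exists_bound_Q 1
  let f : ∀ i, E i → ℝ := fun i => (Metric.closedBall (0 : E i) 1).indicator fun _ => (1 : ℝ)
  let g : ∀ j, F j → ℝ := fun j => (Metric.closedBall (0 : F j) R).indicator fun _ => (1 : ℝ)
  have hf : ∀ i, (∀ x, 0 ≤ f i x) ∧ Integrable (f i) := fun i =>
    ⟨Set.indicator_nonneg fun _ _ => zero_le_one, integrable_indicator_closedBall 1⟩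
  have hg : ∀ j, (∀ x, 0 ≤ g j x) ∧ Integrable (g j) := fun j =>
    ⟨Set.indicator_nonneg fun _ _ => zero_le_one, integrable_indicator_closedBall R⟩
  have hrel : D.Relation f g := by
    intro z
    by_cases hz : ∀ i, ‖z i‖ ≤ 1
    · have h1 : ∀ j, g j (D.Q z j) = 1 := fun j =>
        Set.indicator_of_mem (by simpa using hQ z hz j) _
      have h2 : ∀ i, f i (z i) = 1 := fun i => Set.indicator_of_mem (by simpa using hz i) _
      simp [h1, h2]
    · push Not at hz
      obtain ⟨i, hi⟩ := hz
      have h2 : f i (z i) = 0 := Set.indicator_of_notMem (by simpa using hi) _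
      rw [Finset.prod_eq_zero (Finset.mem_univ i)]
      · exact Finset.prod_nonneg fun j _ => Real.rpow_nonneg ((hg j).1 _) _
      · rw [proj_apply, h2, Real.zero_rpow (D.c_pos i).ne']
  have hfpos : ∀ i, 0 < ∫ y, f i y := fun i => integral_indicator_closedBall_pos one_pos
  have hgpos : ∀ j, 0 < ∫ y, g j y := fun j => integral_indicator_closedBall_pos hR
  set α := ∑ i, D.c i * inner ℝ ((Ring.inverse (A i) : E i →ₗ[ℝ] E i) (x i)) (x i) with hα
  set β := ∑ j, D.d j * inner ℝ ((Ring.inverse (B j) : F j →ₗ[ℝ] F j) (D.Q x j)) (D.Q x j)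
    with hβ
  set p := (∏ i, (∫ y, f i y) ^ D.c i) * ∏ j, Real.sqrt (LinearMap.det (B j)) ^ D.d j with hp
  set q := (∏ j, (∫ y, g j y) ^ D.d j) * ∏ i, Real.sqrt (LinearMap.det (A i)) ^ D.c i with hq
  have hp0 : 0 < p := mul_pos (Finset.prod_pos fun i _ => Real.rpow_pos_of_pos (hfpos i) _)
    (Finset.prod_pos fun j _ => Real.rpow_pos_of_pos (Real.sqrt_pos.2 (hB j).det_pos) _)
  have hq0 : 0 < q := mul_pos (Finset.prod_pos fun i _ => Real.rpow_pos_of_pos (hgpos i) _)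
    (Finset.prod_pos fun j _ => Real.rpow_pos_of_pos (Real.sqrt_pos.2 (hA j).det_pos) _)
  have key : ∀ s : ℝ, Real.log p - s ^ 2 * α / 4 ≤ Real.log q - s ^ 2 * β / 4 := by
    intro s
    have h := H.limit_inequality hA hB hf hg hrel (s • x)
    have e1 : ∏ i, (Real.exp (-inner ℝ ((Ring.inverse (A i) : E i →ₗ[ℝ] E i) ((s • x) i))
        ((s • x) i) / 4) * ∫ y, f i y) ^ D.c i =
        Real.exp (-(s ^ 2 * α / 4)) * ∏ i, (∫ y, f i y) ^ D.c i := by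
      rw [hα, Finset.mul_sum, Finset.sum_div, ← Finset.sum_neg_distrib, Real.exp_sum,
        ← Finset.prod_mul_distrib]
      refine Finset.prod_congr rfl fun i _ => ?_
      rw [Real.mul_rpow (Real.exp_pos _).le (hfpos i).le, ← Real.exp_mul, PiLp.smul_apply,
        map_smul, real_inner_smul_left, real_inner_smul_right]
      congr 2
      ring
    have e2 : ∏ j, (Real.exp (-inner ℝ ((Ring.inverse (B j) : F j →ₗ[ℝ] F j)
        (D.Q (s • x) j)) (D.Q (s • x) j) / 4) * ∫ y, g j y) ^ D.d j =
        Real.exp (-(s ^ 2 * β / 4)) * ∏ j, (∫ y, g j y) ^ D.d j := by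
      rw [hβ, Finset.mul_sum, Finset.sum_div, ← Finset.sum_neg_distrib, Real.exp_sum,
        ← Finset.prod_mul_distrib]
      refine Finset.prod_congr rfl fun i _ => ?_
      rw [Real.mul_rpow (Real.exp_pos _).le (hgpos i).le, ← Real.exp_mul, map_smul,
        PiLp.smul_apply, map_smul, real_inner_smul_left, real_inner_smul_right]
      congr 2
      ring
    rw [e1, e2, mul_assoc, mul_assoc, ← hp, ← hq] at h
    have h' := Real.log_le_log (by positivity) h
    rw [Real.log_mul (Real.exp_pos _).ne' hp0.ne', Real.log_mul (Real.exp_pos _).ne' hq0.ne',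
      Real.log_exp, Real.log_exp] at h'
    linarith
  by_contra hlt
  push Not at hlt
  have hδ : 0 < β - α := by
    simpa [hα, hβ] using hlt
  -- Chosen so that s²(β - α)/4 = |log q - log p| + 1, which exceeds log q - log p.
  have h := key (Real.sqrt (4 * (|Real.log q - Real.log p| + 1) / (β - α)))
  rw [Real.sq_sqrt (by positivity)] at h
  have h1 := le_abs_self (Real.log q - Real.log p)
  have h2 : 4 * (|Real.log q - Real.log p| + 1) / (β - α) * (β - α) =
      4 * (|Real.log q - Real.log p| + 1) := by field_simp
  nlinarith

/-- The constant `∏ i, √(det A_i) ^ c_i / ∏ j, √(det B_j) ^ d_j`. -/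
def heatConstant (D : Datum E F) (A : ∀ i, E i →ₗ[ℝ] E i) (B : ∀ j, F j →ₗ[ℝ] F j) : ℝ :=
  (∏ i, Real.sqrt (LinearMap.det (A i)) ^ D.c i) / ∏ j, Real.sqrt (LinearMap.det (B j)) ^ D.d j

lemma heatConstant_pos (hA : ∀ i, IsPosDef (A i)) (hB : ∀ j, IsPosDef (B j)) :
    0 < D.heatConstant A B :=
  div_pos (Finset.prod_pos fun j _ => Real.rpow_pos_of_pos (Real.sqrt_pos.2 (hA j).det_pos) _)
    (Finset.prod_pos fun j _ => Real.rpow_pos_of_pos (Real.sqrt_pos.2 (hB j).det_pos) _)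

lemma HeatFlowPreserves.forwardProd_le_of_integrable (hA : ∀ i, IsPosDef (A i))
    (hB : ∀ j, IsPosDef (B j)) (H : D.HeatFlowPreserves A B) {f : ∀ i, E i → ℝ}
    {g : ∀ j, F j → ℝ} (hf : ∀ i, (∀ x, 0 ≤ f i x) ∧ Integrable (f i))
    (hg : ∀ j, (∀ y, 0 ≤ g j y) ∧ Integrable (g j)) (hrel : D.Relation f g) :
    D.forwardProd f ≤ ENNReal.ofReal (D.heatConstant A B) * D.reverseProd g := by
  have h := H.limit_inequality hA hB hf hg hrel 0
  simp only [PiLp.zero_apply, map_zero, inner_zero_left, neg_zero, zero_div, Real.exp_zero,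
    one_mul] at h
  have hfi : ∀ i, 0 ≤ ∫ y, f i y := fun i => integral_nonneg (hf i).1
  have hgj : ∀ j, 0 ≤ ∫ y, g j y := fun j => integral_nonneg (hg j).1
  have e1 : D.forwardProd f = ENNReal.ofReal (∏ i, (∫ y, f i y) ^ D.c i) := by
    rw [ENNReal.ofReal_prod_of_nonneg fun i _ => Real.rpow_nonneg (hfi i) _, forwardProd]
    refine Finset.prod_congr rfl fun i _ => ?_
    rw [← ofReal_integral_eq_lintegral_ofReal (hf i).2 (Filter.Eventually.of_forall (hf i).1),
      ENNReal.ofReal_rpow_of_nonneg (hfi i) (D.c_pos i).le]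
  have e2 : D.reverseProd g = ENNReal.ofReal (∏ j, (∫ y, g j y) ^ D.d j) := by
    rw [ENNReal.ofReal_prod_of_nonneg fun i _ => Real.rpow_nonneg (hgj i) _, reverseProd]
    refine Finset.prod_congr rfl fun i _ => ?_
    rw [← ofReal_integral_eq_lintegral_ofReal (hg i).2 (Filter.Eventually.of_forall (hg i).1),
      ENNReal.ofReal_rpow_of_nonneg (hgj i) (D.d_pos i).le]
  rw [e1, e2, ← ENNReal.ofReal_mul (heatConstant_pos hA hB).le]
  refine ENNReal.ofReal_le_ofReal ?_
  have hb : 0 < ∏ j, Real.sqrt (LinearMap.det (B j)) ^ D.d j :=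
    Finset.prod_pos fun j _ => Real.rpow_pos_of_pos (Real.sqrt_pos.2 (hB j).det_pos) _
  rw [heatConstant, div_mul_eq_mul_div, le_div_iff₀ hb]
  linarith

lemma forwardProd_eq_iSup_trunc {f : ∀ i, E i → ℝ}
    (hf : ∀ i, AEMeasurable (f i) volume ∧ ∀ x, 0 ≤ f i x) :
    D.forwardProd f = ⨆ n, D.forwardProd fun i => trunc n (f i) := by
  simp only [forwardProd]
  rw [← ENNReal_prod_iSup_of_monotone]
  · refine Finset.prod_congr rfl fun i _ => ?_
    rw [lintegral_eq_iSup_trunc (hf i).2 (hf i).1]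
    exact (ENNReal.orderIsoRpow (D.c i) (D.c_pos i)).map_iSup _
  · intro i m n hmn
    refine ENNReal.rpow_le_rpow (lintegral_mono fun x => ENNReal.ofReal_le_ofReal
      (trunc_mono (hf i).2 x hmn)) (D.c_pos i).le

lemma forwardProd_le_of_trunc_le {f : ∀ i, E i → ℝ}
    (hf : ∀ i, AEMeasurable (f i) volume ∧ ∀ x, 0 ≤ f i x) {K : ℝ≥0∞}
    (h : ∀ n, D.forwardProd (fun i => trunc n (f i)) ≤ K) : D.forwardProd f ≤ K := by
  rw [forwardProd_eq_iSup_trunc hf]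
  exact iSup_le h

lemma prod_trunc_le {f : ∀ i, E i → ℝ} (hf : ∀ i x, 0 ≤ f i x) (n : ℕ) (x : PiLp 2 E) :
    ∏ i, trunc n (f i) (x i) ^ D.c i ≤ ∏ i, f i (x i) ^ D.c i :=
  Finset.prod_le_prod (fun i _ => Real.rpow_nonneg (trunc_nonneg n (hf i) _) _) fun i _ =>
    Real.rpow_le_rpow (trunc_nonneg n (hf i) _) (trunc_le n (hf i) _) (D.c_pos i).le

/-- This settles the degenerate case in which one g_j has mass 0 while others may have mass ∞, so
that 0 · ∞ = 0 must be respected. That g_j is replaced by a constant on the null set where it is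
non-zero, and the other g_j by indicators of large balls. The relation persists for the truncated f,
and everything is now integrable with zero reverse product. -/
lemma HeatFlowPreserves.forwardProd_trunc_eq_zero (hA : ∀ i, IsPosDef (A i))
    (hB : ∀ j, IsPosDef (B j)) (H : D.HeatFlowPreserves A B) {f : ∀ i, E i → ℝ}
    {g : ∀ j, F j → ℝ} (h : D.Admissible f g) {j₀ : κ}
    (hj₀ : ∫⁻ y, ENNReal.ofReal (g j₀ y) = 0) (n : ℕ) :
    D.forwardProd (fun i => trunc n (f i)) = 0 := by
  classical
  obtain ⟨hf, hg, hrel⟩ := h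
  obtain ⟨R, hR, hQ⟩ := D.exists_bound_Q n
  set M : ℝ := max (n : ℝ) 1 with hM
  have hM1 : 1 ≤ M := le_max_right _ _
  -- With this N one has N^(d_j₀) = ∏ M^(c_i), a bound for the product of the truncated f_i.
  set N : ℝ := M ^ ((∑ i, D.c i) / D.d j₀) with hN
  have hN0 : 0 < N := by positivity
  let g' : ∀ j, F j → ℝ := fun j => if j = j₀ then fun y => if g j y = 0 then 0 else N
    else (Metric.closedBall (0 : F j) R).indicator fun _ => (1 : ℝ)
  have hzero : g' j₀ =ᵐ[volume] fun _ => (0 : ℝ) := by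
    have h1 := (lintegral_eq_zero_iff' ((hg j₀).1.ennreal_ofReal)).1 hj₀
    filter_upwards [h1] with y hy
    have h2 : g j₀ y = 0 := le_antisymm (ENNReal.ofReal_eq_zero.1 hy) ((hg j₀).2 y)
    simp [g', h2]
  have hg' : ∀ j, (∀ y, 0 ≤ g' j y) ∧ Integrable (g' j) := by
    intro j
    by_cases hj : j = j₀
    · subst hj
      refine ⟨fun y => ?_, (integrable_zero _ _ _).congr hzero.symm⟩
      simp only [g', if_true]
      split_ifs
      · exact le_rfl
      · exact hN0.le
    · simp only [g', hj, if_false]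
      exact ⟨Set.indicator_nonneg fun _ _ => zero_le_one, integrable_indicator_closedBall R⟩
  have hrel' : D.Relation (fun i => trunc n (f i)) g' := by
    intro x
    have hnn : 0 ≤ ∏ j, g' j (proj F j (D.Q x)) ^ D.d j :=
      Finset.prod_nonneg fun j _ => Real.rpow_nonneg ((hg' j).1 _) _
    by_cases hx : ∀ i, ‖x i‖ ≤ n
    · by_cases h0 : g j₀ (D.Q x j₀) = 0
      · refine le_trans ((prod_trunc_le (fun i => (hf i).2) n x).trans (hrel x)) ?_
        rw [Finset.prod_eq_zero (Finset.mem_univ j₀)]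
        · exact hnn
        · rw [proj_apply, h0, Real.zero_rpow (D.d_pos j₀).ne']
      · rw [Finset.prod_eq_single_of_mem j₀ (Finset.mem_univ _)]
        · simp only [g', proj_apply, if_true, h0, if_false]
          rw [hN, ← Real.rpow_mul (by positivity), div_mul_cancel₀ _ (D.d_pos j₀).ne',
            Real.rpow_sum_of_pos (by positivity)]
          exact Finset.prod_le_prod
            (fun i _ => Real.rpow_nonneg (trunc_nonneg n (hf i).2 _) _) fun i _ =>
            Real.rpow_le_rpow (trunc_nonneg n (hf i).2 _)
              ((trunc_le_natCast n _ _).trans (le_max_left _ _)) (D.c_pos i).le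
        · intro j _ hj
          simp only [g', hj, if_false, proj_apply]
          rw [Set.indicator_of_mem (by simpa using hQ x hx j), Real.one_rpow]
    · push Not at hx
      obtain ⟨i, hi⟩ := hx
      rw [Finset.prod_eq_zero (Finset.mem_univ i)]
      · exact hnn
      · simp only [proj_apply]
        rw [trunc_of_norm_gt hi, Real.zero_rpow (D.c_pos i).ne']
  have hle := H.forwardProd_le_of_integrable hA hB
    (fun i => ⟨trunc_nonneg n (hf i).2, integrable_trunc n (hf i).2 (hf i).1⟩) hg' hrel'
  have hrev : D.reverseProd g' = 0 := by
    rw [reverseProd, Finset.prod_eq_zero (Finset.mem_univ j₀)]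
    rw [lintegral_congr_ae (hzero.mono fun y hy => by rw [hy])]
    simp [D.d_pos j₀]
  rw [hrev, mul_zero] at hle
  exact le_antisymm hle zero_le

/-- By monotone convergence it suffices to treat truncations of f, which are integrable. If some
mass of g vanishes the previous lemma applies; if none vanishes and one is infinite, the right side
is ∞; otherwise g is integrable too. -/
lemma HeatFlowPreserves.forwardProd_le (hA : ∀ i, IsPosDef (A i))
    (hB : ∀ j, IsPosDef (B j)) (H : D.HeatFlowPreserves A B) {f : ∀ i, E i → ℝ}
    {g : ∀ j, F j → ℝ} (h : D.Admissible f g) :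
    D.forwardProd f ≤ ENNReal.ofReal (D.heatConstant A B) * D.reverseProd g := by
  classical
  obtain ⟨hf, hg, hrel⟩ := h
  refine forwardProd_le_of_trunc_le hf fun n => ?_
  by_cases h0 : ∃ j, ∫⁻ y, ENNReal.ofReal (g j y) = 0
  · obtain ⟨j, hj⟩ := h0
    rw [H.forwardProd_trunc_eq_zero hA hB ⟨hf, hg, hrel⟩ hj n]
    exact zero_le
  push Not at h0
  by_cases htop : ∃ j, ∫⁻ y, ENNReal.ofReal (g j y) = ∞
  · obtain ⟨j, hj⟩ := htop
    have : D.reverseProd g = ∞ := by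
      rw [reverseProd, ← Finset.mul_prod_erase _ _ (Finset.mem_univ j), hj,
        ENNReal.top_rpow_of_pos (D.d_pos j), ENNReal.top_mul]
      refine Finset.prod_ne_zero_iff.2 fun k _ => ?_
      simp only [ne_eq, ENNReal.rpow_eq_zero_iff, h0 k, false_and, false_or]
      intro hk
      linarith [hk.2, D.d_pos k]
    rw [this, ENNReal.mul_top (by simpa using heatConstant_pos hA hB)]
    exact le_top
  push Not at htop
  refine H.forwardProd_le_of_integrable hA hB
    (fun i => ⟨trunc_nonneg n (hf i).2, integrable_trunc n (hf i).2 (hf i).1⟩)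
    (fun j => ⟨(hg j).2, (hg j).1.aestronglyMeasurable, ?_⟩)
    (fun x => (prod_trunc_le (fun i => (hf i).2) n x).trans (hrel x))
  rw [hasFiniteIntegral_iff_ofReal (Filter.Eventually.of_forall (hg j).2)]
  exact (htop j).lt_top

/-- Inverting A turns the factor 1/√det into √det, and the powers of π cancel by the scaling
condition. These Gaussians therefore attain the bound. -/
lemma gaussianMass_inverse (hA : ∀ i, IsPosDef (A i)) (hB : ∀ j, IsPosDef (B j)) :
    gaussianMass D.c (fun i => Ring.inverse (A i)) =
      D.heatConstant A B * gaussianMass D.d (fun j => Ring.inverse (B j)) := by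
  have hA' := fun i => (hA i).inverse
  have hB' := fun j => (hB j).inverse
  have hK := heatConstant_pos (D := D) hA hB
  refine Real.log_injOn_pos (gaussianMass_pos D.c hA')
    (mul_pos hK (gaussianMass_pos D.d hB')) ?_
  rw [Real.log_mul hK.ne' (gaussianMass_pos D.d hB').ne', log_gaussianMass _ hA',
    log_gaussianMass _ hB', heatConstant, Real.log_div
      (Finset.prod_pos fun j _ => Real.rpow_pos_of_pos (Real.sqrt_pos.2 (hA j).det_pos) _).ne'
      (Finset.prod_pos fun j _ => Real.rpow_pos_of_pos (Real.sqrt_pos.2 (hB j).det_pos) _).ne',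
    Real.log_prod fun j _ => (Real.rpow_pos_of_pos (Real.sqrt_pos.2 (hA j).det_pos) _).ne',
    Real.log_prod fun j _ => (Real.rpow_pos_of_pos (Real.sqrt_pos.2 (hB j).det_pos) _).ne',
    D.scaling]
  have e1 : ∀ i, Real.log (Real.sqrt (LinearMap.det (A i)) ^ D.c i) =
      D.c i * Real.log (LinearMap.det (A i)) / 2 := fun i => by
    rw [Real.log_rpow (Real.sqrt_pos.2 (hA i).det_pos), Real.log_sqrt (hA i).det_pos.le]
    ring
  have e2 : ∀ j, Real.log (Real.sqrt (LinearMap.det (B j)) ^ D.d j) =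
      D.d j * Real.log (LinearMap.det (B j)) / 2 := fun i => by
    rw [Real.log_rpow (Real.sqrt_pos.2 (hB i).det_pos), Real.log_sqrt (hB i).det_pos.le]
    ring
  have e3 : ∀ i, Real.log (LinearMap.det (Ring.inverse (A i) : E i →ₗ[ℝ] E i)) =
    -Real.log (LinearMap.det (A i)) := fun i => (hA i).log_det_inverse
  have e4 : ∀ i, Real.log (LinearMap.det (Ring.inverse (B i) : F i →ₗ[ℝ] F i)) =
    -Real.log (LinearMap.det (B i)) := fun i => (hB i).log_det_inverse
  simp only [e1, e2, e3, e4, mul_neg, Finset.sum_neg_distrib, ← Finset.sum_div]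
  ring

/-- If some heat flows preserve the pointwise relation, then Gaussian extremizers exist. -/
theorem HeatFlowPreserves.exists_gaussian_extremizer (hA : ∀ i, IsPosDef (A i))
    (hB : ∀ j, IsPosDef (B j)) (H : D.HeatFlowPreserves A B) :
    ∃ (f : ∀ i, E i → ℝ) (g : ∀ j, F j → ℝ), (∀ i, IsCentredGaussian (f i)) ∧
      (∀ j, IsCentredGaussian (g j)) ∧ D.IsExtremizer f g := by
  have hA' := fun i => (hA i).inverse
  have hB' := fun j => (hB j).inverse
  have hadm := admissible_gaussian hA' hB' (H.dominates hA hB)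
  have hfwd := prod_lintegral_gaussian D.c_pos hA'
  have hrev := prod_lintegral_gaussian D.d_pos hB'
  rw [gaussianMass_inverse (D := D) hA hB, ENNReal.ofReal_mul (heatConstant_pos hA hB).le,
    ← hrev] at hfwd
  change D.forwardProd _ = _ * D.reverseProd _ at hfwd
  have hm := gaussianMass_pos D.d hB'
  have hrev0 : D.reverseProd (fun j y => Real.exp
      (-inner ℝ ((Ring.inverse (B j) : F j →ₗ[ℝ] F j) y) y)) ≠ 0 := by
    rw [reverseProd, hrev]
    simpa using hm
  have hrevt : D.reverseProd (fun j y => Real.exp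
      (-inner ℝ ((Ring.inverse (B j) : F j →ₗ[ℝ] F j) y) y)) ≠ ∞ := by
    rw [reverseProd, hrev]
    exact ENNReal.ofReal_ne_top
  refine ⟨_, _, fun i => ⟨_, hA' i, rfl⟩, fun j => ⟨_, hB' j, rfl⟩, hadm, ?_, ?_, ?_⟩
  · refine le_antisymm (forwardProd_le_constant_mul hadm hrev0 hrevt) ?_
    rw [hfwd]
    gcongr
    exact sInf_le fun f g h => H.forwardProd_le hA hB h
  · rw [hfwd]
    exact ENNReal.mul_pos (by simpa using heatConstant_pos hA hB) hrev0
  · rw [hfwd]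
    exact ENNReal.mul_lt_top ENNReal.ofReal_lt_top hrevt.lt_top

end LongTime

end Datum

end FRBL

end

/-! ### Heat semigroups as averages over Gaussian noise. -/

set_option linter.unusedSectionVars false

noncomputable section

namespace FRBL

open ProbabilityTheory

section Noise

variable {V : Type*} [NormedAddCommGroup V] [InnerProductSpace ℝ V] [FiniteDimensional ℝ V]
  [MeasurableSpace V] [BorelSpace V]
  {W : Type*} [NormedAddCommGroup W] [InnerProductSpace ℝ W] [FiniteDimensional ℝ W]
  [MeasurableSpace W] [BorelSpace W]

lemma measurable_linearMap (L : W →ₗ[ℝ] V) : Measurable L :=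
  L.continuous_of_finiteDimensional.measurable

/-- The law of `√(2 t) L ξ` for a standard Gaussian vector `ξ`. -/
def noise (L : W →ₗ[ℝ] V) (t : ℝ) : Measure V :=
  (stdGaussian W).map fun ξ => Real.sqrt (2 * t) • L ξ

lemma measurable_noise_map (L : W →ₗ[ℝ] V) (t : ℝ) :
    Measurable fun ξ : W => Real.sqrt (2 * t) • L ξ :=
  (measurable_linearMap L).const_smul _

instance isProbabilityMeasure_noise (L : W →ₗ[ℝ] V) (t : ℝ) : IsProbabilityMeasure (noise L t) :=
  Measure.isProbabilityMeasure_map (measurable_noise_map L t).aemeasurable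

lemma charFun_noise (L : W →ₗ[ℝ] V) {t : ℝ} (ht : 0 ≤ t) (s : V) :
    charFun (noise L t) s = Complex.exp (-((t * ‖LinearMap.adjoint L s‖ ^ 2 : ℝ) : ℂ)) := by
  have h1 : charFun (noise L t) s =
      charFun (stdGaussian W) (Real.sqrt (2 * t) • LinearMap.adjoint L s) := by
    rw [charFun_apply, charFun_apply, noise, integral_map (measurable_noise_map L t).aemeasurable]
    · refine integral_congr_ae (Filter.Eventually.of_forall fun ξ => ?_)
      simp only
      rw [real_inner_smul_left, real_inner_smul_right, LinearMap.adjoint_inner_right]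
    · exact (by fun_prop : Continuous fun x : V =>
        Complex.exp (inner ℝ x s * Complex.I)).aestronglyMeasurable
  rw [h1, charFun_stdGaussian, norm_smul, Real.norm_of_nonneg (Real.sqrt_nonneg _)]
  congr 1
  rw [← Complex.ofReal_pow, mul_pow, Real.sq_sqrt (by positivity)]
  push_cast
  ring

lemma noise_conv_noise (L : W →ₗ[ℝ] V) {s t : ℝ} (hs : 0 ≤ s) (ht : 0 ≤ t) :
    noise L s ∗ noise L t = noise L (s + t) := by
  refine Measure.ext_of_charFun (funext fun v => ?_)
  rw [charFun_conv, charFun_noise L hs, charFun_noise L ht, charFun_noise L (add_nonneg hs ht),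
    ← Complex.exp_add]
  congr 1
  push_cast
  ring

/-- The averaging operator `f ↦ E f (x + √(2 t) L ξ)` for a standard Gaussian vector `ξ`. -/
def flow (L : W →ₗ[ℝ] V) (t : ℝ) (f : V → ℝ) (x : V) : ℝ :=
  ∫ ξ, f (x + Real.sqrt (2 * t) • L ξ) ∂(stdGaussian W)

lemma flow_eq_integral_noise (L : W →ₗ[ℝ] V) (t : ℝ) {f : V → ℝ} (hf : Measurable f) (x : V) :
    flow L t f x = ∫ z, f (x + z) ∂(noise L t) := by
  have hfx : Measurable fun z => f (x + z) := hf.comp (measurable_const_add x)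
  rw [noise, integral_map (measurable_noise_map L t).aemeasurable hfx.aestronglyMeasurable]
  rfl

lemma measurable_flow (L : W →ₗ[ℝ] V) (t : ℝ) {f : V → ℝ} (hf : Measurable f) :
    Measurable (flow L t f) := by
  have h : Measurable fun p : V × W => f (p.1 + Real.sqrt (2 * t) • L p.2) :=
    hf.comp (measurable_fst.add ((measurable_noise_map L t).comp measurable_snd))
  exact (h.stronglyMeasurable.integral_prod_right (ν := stdGaussian W)).measurable

/-- The semigroup law is the convolution law of the noise, itself read off from characteristic
functions. It allows a time t to be cut into small steps. -/
lemma flow_flow (L : W →ₗ[ℝ] V) {s t : ℝ} (hs : 0 ≤ s) (ht : 0 ≤ t) {f : V → ℝ}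
    (hf : Measurable f) {M : ℝ} (hM : ∀ x, |f x| ≤ M) (x : V) :
    flow L s (flow L t f) x = flow L (s + t) f x := by
  have hfx : Measurable fun z => f (x + z) := hf.comp (measurable_const_add x)
  rw [flow_eq_integral_noise L s (measurable_flow L t hf), flow_eq_integral_noise L _ hf,
    ← noise_conv_noise L hs ht, integral_conv]
  · simp only [flow_eq_integral_noise L t hf, add_assoc]
  · exact Integrable.of_bound hfx.aestronglyMeasurable M
      (Filter.Eventually.of_forall fun z => hM _)

end Noise

section HeatMeasure

variable {V : Type*} [NormedAddCommGroup V] [InnerProductSpace ℝ V] [FiniteDimensional ℝ V]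

lemma heatKernel_eq (A : V →ₗ[ℝ] V) (t : ℝ) (x : V) : heatKernel A t x =
    1 / ((4 * Real.pi * t) ^ ((Module.finrank ℝ V : ℝ) / 2) * Real.sqrt (LinearMap.det A)) *
    Real.exp (-(inner ℝ ((Ring.inverse A : V →ₗ[ℝ] V) x) x) / (4 * t)) := rfl

lemma continuous_heatKernel (A : V →ₗ[ℝ] V) (t : ℝ) : Continuous (heatKernel A t) := by
  have := continuous_inner_apply_self (Ring.inverse A : V →ₗ[ℝ] V)
  exact continuous_const.mul (Real.continuous_exp.comp (this.neg.div_const _))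

lemma IsPosDef.smul {A : V →ₗ[ℝ] V} (hA : IsPosDef A) {r : ℝ} (hr : 0 < r) :
    IsPosDef (r • A) :=
  ⟨fun x y => by simp [real_inner_smul_left, real_inner_smul_right, hA.1 x y],
    fun v hv => by
      simpa [real_inner_smul_left] using mul_pos hr (hA.2 v hv)⟩

variable [MeasurableSpace V] [BorelSpace V]

lemma IsPosDef.integrable_heatKernel {A : V →ₗ[ℝ] V} (hA : IsPosDef A) {t : ℝ} (ht : 0 < t) :
    Integrable (heatKernel A t) := by
  have h := (hA.inverse.smul (by positivity : 0 < (4 * t)⁻¹)).integrable_gaussian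
  refine Integrable.const_mul (h.congr (Filter.Eventually.of_forall fun x => ?_)) _
  simp only [LinearMap.smul_apply, real_inner_smul_left]
  congr 1
  ring

/-- The probability measure with density `heatKernel A t (x - ·)`. -/
def heatMeasure (A : V →ₗ[ℝ] V) (t : ℝ) (x : V) : Measure V :=
  volume.withDensity fun y => ENNReal.ofReal (heatKernel A t (x - y))

lemma measurable_heatDensity (A : V →ₗ[ℝ] V) (t : ℝ) (x : V) :
    Measurable fun y => ENNReal.ofReal (heatKernel A t (x - y)) :=
  ((continuous_heatKernel A t).comp (continuous_const.sub continuous_id)).measurable.ennreal_ofReal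

lemma integral_heatMeasure {G : Type*} [NormedAddCommGroup G] [NormedSpace ℝ G]
    (A : V →ₗ[ℝ] V) {t : ℝ} (ht : 0 < t) (x : V) (f : V → G) :
    ∫ y, f y ∂(heatMeasure A t x) = ∫ y, heatKernel A t (x - y) • f y := by
  rw [heatMeasure, integral_withDensity_eq_integral_toReal_smul (measurable_heatDensity A t x)
    (Filter.Eventually.of_forall fun _ => ENNReal.ofReal_lt_top)]
  simp only [ENNReal.toReal_ofReal (heatKernel_nonneg A ht _)]

lemma integrable_heatMeasure_iff (A : V →ₗ[ℝ] V) {t : ℝ} (ht : 0 < t) (x : V) {f : V → ℝ} :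
    Integrable f (heatMeasure A t x) ↔ Integrable fun y => heatKernel A t (x - y) * f y := by
  rw [heatMeasure, integrable_withDensity_iff_integrable_smul' (measurable_heatDensity A t x)
    (Filter.Eventually.of_forall fun _ => ENNReal.ofReal_lt_top)]
  simp only [ENNReal.toReal_ofReal (heatKernel_nonneg A ht _), smul_eq_mul]

lemma heatSemigroup_eq_integral (A : V →ₗ[ℝ] V) {t : ℝ} (ht : 0 < t) (f : V → ℝ) (x : V) :
    heatSemigroup A t f x = ∫ y, f y ∂(heatMeasure A t x) := by
  rw [integral_heatMeasure A ht]
  simp only [heatSemigroup, smul_eq_mul, mul_comm]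

lemma IsPosDef.isFiniteMeasure_heatMeasure {A : V →ₗ[ℝ] V} (hA : IsPosDef A) {t : ℝ} (ht : 0 < t)
    (x : V) : IsFiniteMeasure (heatMeasure A t x) := by
  have h := (integrable_heatMeasure_iff A ht x (f := fun _ => (1 : ℝ))).2
    (by simpa using (hA.integrable_heatKernel ht).comp_sub_left x)
  rwa [integrable_const_iff_isFiniteMeasure one_ne_zero] at h

/-- The substitution z = Cw with C = √A makes the kernel isotropic and leaves a standard Gaussian
Fourier integral. -/
lemma IsPosDef.charFun_heatMeasure {A : V →ₗ[ℝ] V} (hA : IsPosDef A) {t : ℝ} (ht : 0 < t)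
    (x s : V) : charFun (heatMeasure A t x) s =
      Complex.exp (inner ℝ x s * Complex.I) * Complex.exp (-((t * inner ℝ (A s) s : ℝ) : ℂ)) := by
  obtain ⟨C, hC, hCC⟩ := hA.exists_sqrt
  have hAC : A = C.toLinearMap * C.toLinearMap := LinearMap.ext fun v => (hCC v).symm
  have hinv : ∀ w, inner ℝ ((Ring.inverse A : V →ₗ[ℝ] V) (C w)) (C w) = ‖w‖ ^ 2 := by
    intro w
    have h1 : (Ring.inverse A : V →ₗ[ℝ] V) (C w) = C.symm w := by
      have h2 := hCC (C.symm w)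
      rw [LinearEquiv.apply_symm_apply] at h2
      rw [h2, hA.inverse_apply_self]
    rw [h1, ← hC, LinearEquiv.apply_symm_apply, real_inner_self_eq_norm_sq]
  have hpi := Real.pi_pos
  set N := (4 * Real.pi * t) ^ ((Module.finrank ℝ V : ℝ) / 2) with hN
  have hN0 : 0 < N := by positivity
  have hdetC : LinearMap.det C.toLinearMap ≠ 0 := C.isUnit_det'.ne_zero
  have hdet : Real.sqrt (LinearMap.det A) = |LinearMap.det C.toLinearMap| := by
    rw [hAC, map_mul, Real.sqrt_mul_self_eq_abs]
  have hs2 : inner ℝ (A s) s = ‖C s‖ ^ 2 := by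
    rw [← hCC, hC, real_inner_self_eq_norm_sq]
  have step : ∫ z, heatKernel A t z • Complex.exp (inner ℝ (x - z) s * Complex.I) =
      |LinearMap.det C.toLinearMap| • ∫ w, heatKernel A t (C w) •
        Complex.exp (inner ℝ (x - C w) s * Complex.I) := by
    rw [integral_comp_linearEquiv C (fun z => heatKernel A t z •
        Complex.exp (inner ℝ (x - z) s * Complex.I)), smul_smul, ← abs_mul,
        mul_inv_cancel₀ hdetC, abs_one, one_smul]
  rw [charFun_apply, integral_heatMeasure A ht]
  have h0 := integral_sub_left_eq_self
    (fun z => heatKernel A t z • Complex.exp (inner ℝ (x - z) s * Complex.I)) volume x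
  simp only [sub_sub_cancel] at h0
  rw [h0, step]
  have hb : 0 < (((4 * t)⁻¹ : ℝ) : ℂ).re := by
    rw [Complex.ofReal_re]; positivity
  have hG := GaussianFourier.integral_cexp_neg_mul_sq_norm_add (V := V) hb (-Complex.I) (C s)
  have e1 : ∀ w, heatKernel A t (C w) • Complex.exp (inner ℝ (x - C w) s * Complex.I) =
      (((N * |LinearMap.det C.toLinearMap|)⁻¹ : ℝ) : ℂ) *
        Complex.exp (inner ℝ x s * Complex.I) *
        Complex.exp (-(((4 * t)⁻¹ : ℝ) : ℂ) * (‖w‖ : ℂ) ^ 2 +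
          -Complex.I * (inner ℝ (C s) w : ℝ)) := by
    intro w
    rw [heatKernel_eq, hinv, hdet, ← hN, Complex.real_smul, Complex.ofReal_mul, one_div,
      Complex.ofReal_exp, mul_assoc, mul_assoc, ← Complex.exp_add, ← Complex.exp_add,
      inner_sub_left, hC, real_inner_comm w (C s)]
    congr 2
    push_cast
    field_simp
    ring
  simp only [e1]
  rw [integral_const_mul, hG, hs2]
  have e2 : ((Real.pi : ℂ) / (((4 * t)⁻¹ : ℝ) : ℂ)) ^ ((Module.finrank ℝ V : ℂ) / 2) =
      ((N : ℝ) : ℂ) := by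
    rw [hN, Complex.ofReal_cpow (by positivity)]
    push_cast
    congr 1
    field_simp
  rw [e2]
  have e3 : (-Complex.I) ^ 2 * (‖C s‖ : ℂ) ^ 2 / (4 * (((4 * t)⁻¹ : ℝ) : ℂ)) =
      -((t * ‖C s‖ ^ 2 : ℝ) : ℂ) := by
    have : (t : ℂ) ≠ 0 := by exact_mod_cast ht.ne'
    rw [neg_sq, Complex.I_sq]
    push_cast
    field_simp
  rw [e3, Complex.real_smul]
  have hd : ((|LinearMap.det C.toLinearMap| : ℝ) : ℂ) ≠ 0 := by
    exact_mod_cast abs_ne_zero.2 hdetC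
  have hNc : ((N : ℝ) : ℂ) ≠ 0 := by exact_mod_cast hN0.ne'
  push_cast
  field_simp

variable {W : Type*} [NormedAddCommGroup W] [InnerProductSpace ℝ W] [FiniteDimensional ℝ W]
  [MeasurableSpace W] [BorelSpace W]

/-- Only LL^* = A matters, not L or the space W carrying the noise. All the heat flows can thus be
driven by one Gaussian vector. -/
lemma IsPosDef.heatMeasure_eq {A : V →ₗ[ℝ] V} (hA : IsPosDef A) {L : W →ₗ[ℝ] V}
    (hL : ∀ s, ‖LinearMap.adjoint L s‖ ^ 2 = inner ℝ (A s) s) {t : ℝ} (ht : 0 < t) (x : V) :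
    heatMeasure A t x =
      (stdGaussian W).map fun ξ => x + Real.sqrt (2 * t) • L ξ := by
  have hfin := hA.isFiniteMeasure_heatMeasure ht x
  have hmap : ((stdGaussian W).map fun ξ => x + Real.sqrt (2 * t) • L ξ) =
      (noise L t).map fun z => x + z := by
    rw [noise, Measure.map_map (measurable_const_add x) (measurable_noise_map L t)]
    rfl
  have hfin2 : IsFiniteMeasure ((noise L t).map fun z => x + z) := inferInstance
  rw [hmap]
  refine Measure.ext_of_charFun (funext fun s => ?_)
  rw [hA.charFun_heatMeasure ht, charFun_map_const_add, charFun_noise L ht.le, hL, mul_comm]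

lemma IsPosDef.integral_heatMeasure_eq {A : V →ₗ[ℝ] V} (hA : IsPosDef A) {L : W →ₗ[ℝ] V}
    (hL : ∀ s, ‖LinearMap.adjoint L s‖ ^ 2 = inner ℝ (A s) s) {t : ℝ} (ht : 0 < t) (x : V)
    {f : V → ℝ} (hf : Measurable f) :
    ∫ y, f y ∂(heatMeasure A t x) = ∫ ξ, f (x + Real.sqrt (2 * t) • L ξ) ∂(stdGaussian W) := by
  rw [hA.heatMeasure_eq hL ht, integral_map
    ((measurable_noise_map L t).const_add x).aemeasurable hf.aestronglyMeasurable]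

lemma IsPosDef.heatSemigroup_eq_flow {A : V →ₗ[ℝ] V} (hA : IsPosDef A) {L : W →ₗ[ℝ] V}
    (hL : ∀ s, ‖LinearMap.adjoint L s‖ ^ 2 = inner ℝ (A s) s) {t : ℝ} (ht : 0 < t)
    {f : V → ℝ} (hf : Measurable f) (x : V) : heatSemigroup A t f x = flow L t f x := by
  rw [heatSemigroup_eq_integral A ht, hA.integral_heatMeasure_eq hL ht x hf, flow]

lemma IsPosDef.isProbabilityMeasure_heatMeasure {A : V →ₗ[ℝ] V} (hA : IsPosDef A) {t : ℝ}
    (ht : 0 < t) (x : V) : IsProbabilityMeasure (heatMeasure A t x) := by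
  obtain ⟨C, hC, hCC⟩ := hA.exists_sqrt
  have hadj : LinearMap.adjoint C.toLinearMap = C.toLinearMap := by
    symm
    rw [LinearMap.eq_adjoint_iff]
    exact hC
  rw [hA.heatMeasure_eq (L := C.toLinearMap) (fun s => by
    rw [hadj, ← hCC, hC, real_inner_self_eq_norm_sq]; rfl) ht]
  exact Measure.isProbabilityMeasure_map
    ((measurable_noise_map C.toLinearMap t).const_add x).aemeasurable

lemma integral_inner_stdGaussian (p : W) : ∫ ξ, inner ℝ p ξ ∂(stdGaussian W) = 0 :=
  integral_strongDual_stdGaussian (innerSL ℝ p)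

lemma integrable_inner_stdGaussian (p : W) : Integrable (fun ξ => inner ℝ p ξ) (stdGaussian W) :=
  (innerSL ℝ p).integrable_comp IsGaussian.integrable_id

/-- The heat kernel shifted by `2 h w` is the heat kernel tilted by an exponential. -/
lemma IsPosDef.heatKernel_sub {B : V →ₗ[ℝ] V} (hB : IsPosDef B) {h : ℝ} (hh : 0 < h) (u w : V) :
    heatKernel B h (u - (2 * h) • w) = heatKernel B h u *
      Real.exp (inner ℝ ((Ring.inverse B : V →ₗ[ℝ] V) w) u -
        h * inner ℝ ((Ring.inverse B : V →ₗ[ℝ] V) w) w) := by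
  rw [heatKernel_eq, heatKernel_eq, mul_assoc (1 / _), ← Real.exp_add]
  congr 2
  simp only [map_sub, map_smul, inner_sub_left, inner_sub_right, real_inner_smul_left,
    real_inner_smul_right]
  rw [hB.inverse.1 u w, real_inner_comm _ u]
  field_simp
  ring

/-- Jensen's inequality after a translation of Gaussian noise. -/
lemma IsPosDef.integral_log_shift_le {B : V →ₗ[ℝ] V} (hB : IsPosDef B) {T : W →ₗ[ℝ] V}
    (hT : ∀ s, ‖LinearMap.adjoint T s‖ ^ 2 = inner ℝ (B s) s) {h : ℝ} (hh : 0 < h)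
    {g : V → ℝ} (hg : Measurable g) {a b : ℝ} (ha : 0 < a) (hga : ∀ y, a ≤ g y)
    (hgb : ∀ y, g y ≤ b) (y w : V) :
    ∫ ξ, Real.log (g (y + Real.sqrt (2 * h) • T ξ + (2 * h) • w)) ∂(stdGaussian W) -
      h * inner ℝ ((Ring.inverse B : V →ₗ[ℝ] V) w) w ≤ Real.log (flow T h g y) := by
  have hprob := hB.isProbabilityMeasure_heatMeasure hh y
  set P : V →ₗ[ℝ] V := Ring.inverse B with hP
  set μ := heatMeasure B h y with hμ
  set σ := inner ℝ (P w) w with hσ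
  have hlogb : ∀ z, ‖Real.log (g z)‖ ≤ |Real.log a| + |Real.log b| := fun z => by
    rw [Real.norm_eq_abs, abs_le]
    have h1 := Real.log_le_log ha (hga z)
    have h2 := Real.log_le_log (ha.trans_le (hga z)) (hgb z)
    constructor
    · linarith [neg_abs_le (Real.log a), abs_nonneg (Real.log b)]
    · linarith [le_abs_self (Real.log b), abs_nonneg (Real.log a)]
  have hshift : Measurable fun z : V => z + (2 * h) • w := measurable_add_const _
  have hlogm : Measurable fun z => Real.log (g (z + (2 * h) • w)) :=
    Real.measurable_log.comp (hg.comp hshift)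
  let φ : V → ℝ := fun z => Real.log (g (z + (2 * h) • w)) + inner ℝ (P w) (y - z)
  have hlinm : Measurable fun z : V => inner ℝ (P w) (y - z) :=
    (by fun_prop : Continuous fun z : V => inner ℝ (P w) (y - z)).measurable
  have hlog_int : Integrable (fun z => Real.log (g (z + (2 * h) • w))) μ :=
    Integrable.of_bound hlogm.aestronglyMeasurable _ (Filter.Eventually.of_forall fun z => hlogb _)
  have hlin_eq : ∀ ξ, inner ℝ (P w) (y - (y + Real.sqrt (2 * h) • T ξ)) =
      inner ℝ (-(Real.sqrt (2 * h)) • LinearMap.adjoint T (P w)) ξ := fun ξ => by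
    rw [real_inner_smul_left, LinearMap.adjoint_inner_left, sub_add_cancel_left, inner_neg_right,
      real_inner_smul_right]
    ring
  have hlin_int : Integrable (fun z => inner ℝ (P w) (y - z)) μ := by
    rw [hμ, hB.heatMeasure_eq hT hh, integrable_map_measure hlinm.aestronglyMeasurable
      ((measurable_noise_map T h).const_add y).aemeasurable]
    refine (integrable_inner_stdGaussian (-(Real.sqrt (2 * h)) •
      LinearMap.adjoint T (P w))).congr (Filter.Eventually.of_forall fun ξ => ?_)
    exact (hlin_eq ξ).symm
  have hlin_zero : ∫ z, inner ℝ (P w) (y - z) ∂μ = 0 := by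
    rw [hμ, hB.integral_heatMeasure_eq hT hh y hlinm]
    simp only [hlin_eq]
    exact integral_inner_stdGaussian _
  -- Cameron–Martin: translating by 2hw tilts the kernel by exp(⟨Pw, y - z⟩ - hσ). By translation
  -- invariance of Lebesgue measure, the integral of exp(φ - hσ) is therefore the flow itself.
  have hpt : ∀ z, heatKernel B h (y - z) * Real.exp (φ z - h * σ) =
      heatKernel B h (y - (z + (2 * h) • w)) * g (z + (2 * h) • w) := fun z => by
    rw [← sub_sub, hB.heatKernel_sub hh, ← hP, ← hσ]
    simp only [φ]
    rw [add_sub_assoc, Real.exp_add, Real.exp_log (ha.trans_le (hga _))]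
    ring
  have hgk : Integrable fun z => heatKernel B h (y - z) * g z := by
    refine ((hB.integrable_heatKernel hh).comp_sub_left y).mul_bdd (c := b)
      hg.aestronglyMeasurable (Filter.Eventually.of_forall fun z => ?_)
    rw [Real.norm_of_nonneg (ha.le.trans (hga z))]
    exact hgb z
  have hexp_int : Integrable (fun z => Real.exp (φ z - h * σ)) μ := by
    rw [hμ, integrable_heatMeasure_iff B hh]
    simp only [hpt]
    exact hgk.comp_add_right ((2 * h) • w)
  have hflow : flow T h g y = ∫ z, Real.exp (φ z - h * σ) ∂μ := by
    rw [← hB.heatSemigroup_eq_flow hT hh hg, hμ, integral_heatMeasure B hh, heatSemigroup]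
    simp only [smul_eq_mul, hpt]
    rw [integral_add_right_eq_self (fun z => heatKernel B h (y - z) * g z)]
    simp only [mul_comm]
  have hφ : Integrable φ μ := hlog_int.add hlin_int
  have hφ_int : Integrable (fun z => φ z - h * σ) μ := hφ.sub (integrable_const _)
  -- Jensen's inequality for exp. The linear part of φ has mean zero, so only the average of log g
  -- and the cost hσ remain.
  have hJ := convexOn_exp.map_integral_le (μ := μ) Real.continuous_exp.continuousOn isClosed_univ
    (Filter.Eventually.of_forall fun _ => Set.mem_univ _) hφ_int hexp_int
  have hval : ∫ z, (φ z - h * σ) ∂μ =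
      ∫ ξ, Real.log (g (y + Real.sqrt (2 * h) • T ξ + (2 * h) • w)) ∂(stdGaussian W) - h * σ := by
    rw [integral_sub hφ (integrable_const _), integral_const]
    simp only [φ]
    rw [integral_add hlog_int hlin_int, hlin_zero, add_zero, hμ,
      hB.integral_heatMeasure_eq hT hh y hlogm]
    simp
  rw [hflow, ← hval]
  have hpos : 0 < ∫ z, Real.exp (φ z - h * σ) ∂μ := (Real.exp_pos _).trans_le hJ
  exact (Real.le_log_iff_exp_le hpos).2 hJ

end HeatMeasure

end FRBL

end

/-! ### Smooth functions and a second-order expansion of the logarithm. -/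

set_option linter.unusedSectionVars false

noncomputable section

namespace FRBL

open ProbabilityTheory

/-- For u ≥ 0 the bound log(1 + u) ≥ 2u/(u + 2) is already stronger. For u < 0 the tail of the
Taylor series is at most |u|³/(1 - |u|), and 1 - |u| = 1 + u ≥ ρ. -/
lemma sub_sub_le_log_one_add {u ρ : ℝ} (hρ : 0 < ρ) (hu : ρ ≤ 1 + u) :
    u - u ^ 2 / 2 - |u| ^ 3 / ρ ≤ Real.log (1 + u) := by
  rcases le_or_gt 0 u with h0 | h0
  · have h1 := Real.le_log_one_add_of_nonneg h0
    have h2 : u - u ^ 2 / 2 ≤ 2 * u / (u + 2) := by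
      rw [le_div_iff₀ (by positivity)]
      nlinarith [pow_nonneg h0 3]
    have h3 : 0 ≤ |u| ^ 3 / ρ := by positivity
    linarith
  · have habs : |(-u)| < 1 := by rw [abs_neg, abs_of_neg h0]; linarith
    have h1 := Real.abs_log_sub_add_sum_range_le habs 2
    simp only [Finset.sum_range_succ, Finset.sum_range_zero, zero_add, abs_neg, sub_neg_eq_add]
      at h1
    have h2 : |u| ^ (2 + 1) / (1 - |u|) ≤ |u| ^ 3 / ρ := by
      rw [abs_of_neg h0]
      gcongr
      · exact pow_nonneg (by linarith) 3
      · linarith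
    have h3 := (abs_le.1 (h1.trans h2)).1
    norm_num at h3
    linarith

section Smooth

variable {V : Type*} [NormedAddCommGroup V] [InnerProductSpace ℝ V]

/-- `f` is bounded with bounded Lipschitz gradient `q`, all with constant `K`. -/
structure IsSmooth (K : ℝ) (f : V → ℝ) (q : V → V) : Prop where
  abs_apply_le : ∀ x, |f x| ≤ K
  norm_grad_le : ∀ x, ‖q x‖ ≤ K
  lipschitz : ∀ x y, ‖q x - q y‖ ≤ K * ‖x - y‖
  taylor : ∀ x a, |f (x + a) - f x - inner ℝ (q x) a| ≤ K * ‖a‖ ^ 2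

namespace IsSmooth

variable {K : ℝ} {f : V → ℝ} {q : V → V}

lemma nonneg (h : IsSmooth K f q) : 0 ≤ K := (abs_nonneg _).trans (h.abs_apply_le 0)

lemma continuous_grad (h : IsSmooth K f q) : Continuous q :=
  (LipschitzWith.of_dist_le_mul (K := ⟨K, h.nonneg⟩) fun x y => by
    rw [dist_eq_norm, dist_eq_norm]
    exact h.lipschitz x y).continuous

lemma continuous (h : IsSmooth K f q) : Continuous f := by
  rw [continuous_iff_continuousAt]
  intro x
  rw [ContinuousAt, tendsto_iff_norm_sub_tendsto_zero]
  have hlim : Filter.Tendsto (fun y : V => K * ‖y - x‖ + K * ‖y - x‖ ^ 2) (nhds x) (nhds 0) := by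
    have : Continuous fun y : V => K * ‖y - x‖ + K * ‖y - x‖ ^ 2 := by fun_prop
    simpa using this.tendsto x
  refine squeeze_zero (fun _ => norm_nonneg _) (fun y => ?_) hlim
  have h1 := h.taylor x (y - x)
  rw [add_sub_cancel] at h1
  have h2 : |inner ℝ (q x) (y - x)| ≤ K * ‖y - x‖ :=
    (abs_real_inner_le_norm _ _).trans (by gcongr; exact h.norm_grad_le x)
  rw [Real.norm_eq_abs]
  calc |f y - f x| = |(f y - f x - inner ℝ (q x) (y - x)) + inner ℝ (q x) (y - x)| := by ring_nf
    _ ≤ _ := (abs_add_le _ _).trans (by linarith)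

lemma add_const (h : IsSmooth K f q) {η : ℝ} (hη : 0 ≤ η) :
    IsSmooth (K + η) (fun x => f x + η) q where
  abs_apply_le x := (abs_add_le _ _).trans (add_le_add (h.abs_apply_le x) (abs_of_nonneg hη).le)
  norm_grad_le x := (h.norm_grad_le x).trans (by linarith)
  lipschitz x y := (h.lipschitz x y).trans (by nlinarith [norm_nonneg (x - y)])
  taylor x a := by
    have := h.taylor x a
    rw [show f (x + a) + η - (f x + η) - inner ℝ (q x) a = f (x + a) - f x - inner ℝ (q x) a by
      ring]
    nlinarith [sq_nonneg ‖a‖]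

lemma mono (h : IsSmooth K f q) {K' : ℝ} (hK : K ≤ K') : IsSmooth K' f q where
  abs_apply_le x := (h.abs_apply_le x).trans hK
  norm_grad_le x := (h.norm_grad_le x).trans hK
  lipschitz x y := (h.lipschitz x y).trans (by gcongr)
  taylor x a := (h.taylor x a).trans (by gcongr)

/-- Every condition is translation invariant and linear in (f, q). It serves twice: with a Gaussian
law it shows that the flow keeps the same K, and with the measure f dx it shows that mollifications
are smooth. -/
lemma average [FiniteDimensional ℝ V] [MeasurableSpace V] [BorelSpace V] (h : IsSmooth K f q)
    {Y : Type*} [MeasurableSpace Y] (ν : Measure Y) [IsFiniteMeasure ν] {τ : Y → V}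
    (hτ : Measurable τ) :
    IsSmooth (K * ν.real Set.univ) (fun x => ∫ y, f (x + τ y) ∂ν)
      (fun x => ∫ y, q (x + τ y) ∂ν) := by
  have hfi : ∀ x, Integrable (fun y => f (x + τ y)) ν := fun x =>
    Integrable.of_bound (h.continuous.measurable.comp (hτ.const_add x)).aestronglyMeasurable K
      (Filter.Eventually.of_forall fun y => h.abs_apply_le _)
  have hqi : ∀ x, Integrable (fun y => q (x + τ y)) ν := fun x =>
    Integrable.of_bound (h.continuous_grad.measurable.comp
      (hτ.const_add x)).aestronglyMeasurable K
      (Filter.Eventually.of_forall fun y => h.norm_grad_le _)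
  refine ⟨fun x => ?_, fun x => ?_, fun x y => ?_, fun x a => ?_⟩
  · exact norm_integral_le_of_norm_le_const (f := fun y => f (x + τ y))
      (Filter.Eventually.of_forall fun y => h.abs_apply_le _)
  · exact norm_integral_le_of_norm_le_const (Filter.Eventually.of_forall fun y =>
      h.norm_grad_le _)
  · rw [← integral_sub (hqi x) (hqi y)]
    refine (norm_integral_le_of_norm_le_const (C := K * ‖x - y‖)
      (Filter.Eventually.of_forall fun z => ?_)).trans (le_of_eq (by ring))
    simpa using h.lipschitz (x + τ z) (y + τ z)
  · have h1 : inner ℝ (∫ y, q (x + τ y) ∂ν) a = ∫ y, inner ℝ (q (x + τ y)) a ∂ν := by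
      rw [real_inner_comm, ← integral_inner (hqi x)]
      simp only [real_inner_comm a]
    have h2 : Integrable (fun y => f (x + a + τ y) - f (x + τ y)) ν := (hfi _).sub (hfi _)
    rw [h1, ← integral_sub (hfi _) (hfi _), ← integral_sub h2 ((hqi x).inner_const a),
      ← Real.norm_eq_abs]
    refine (norm_integral_le_of_norm_le_const (C := K * ‖a‖ ^ 2)
      (Filter.Eventually.of_forall fun z => ?_)).trans (le_of_eq (by ring))
    have := h.taylor (x + τ z) a
    rwa [add_right_comm] at this

end IsSmooth

/-- A scalar second-order expansion. -/
lemma scalar_expansion {κ ℓ β ρ₀ s r p u w₁ m : ℝ} (hκ : 0 ≤ κ) (hℓ : 0 ≤ ℓ) (hβ : 0 ≤ β)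
    (hρ₀ : 0 < ρ₀) (hs : 0 ≤ s) (hs2 : s ≤ 2) (hr : 0 ≤ r)
    (hp : |p| ≤ κ * ℓ * r) (hu : ρ₀ ≤ 1 + u)
    (h1 : w₁ + s ^ 2 * m - κ * s ^ 3 * (2 * β ^ 2 + ℓ * β * r) ≤ u)
    (h2 : |u - s * p| ≤ s ^ 2 * (κ * ((ℓ + 2 * β) ^ 2 + β) * (1 + r) ^ 2)) :
    w₁ + s ^ 2 * m - s ^ 2 / 2 * p ^ 2 -
      (κ * (2 * β ^ 2 + ℓ * β) + κ * ℓ * (κ * ((ℓ + 2 * β) ^ 2 + β)) +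
        (κ * ((ℓ + 2 * β) ^ 2 + β)) ^ 2 +
        (κ * ℓ + 2 * (κ * ((ℓ + 2 * β) ^ 2 + β))) ^ 3 / ρ₀) * s ^ 3 * (1 + r) ^ 6 ≤
      Real.log (1 + u) := by
  set C₂ := κ * ((ℓ + 2 * β) ^ 2 + β) with hC₂
  have hC₂0 : 0 ≤ C₂ := by positivity
  set ρ := 1 + r with hρ
  have hρ1 : 1 ≤ ρ := by linarith
  have hρ0 : 0 ≤ ρ := by linarith
  have hlog := sub_sub_le_log_one_add hρ₀ hu
  -- Since u = sp + e with e = O(s²), the square u² differs from s²p² by terms of order s³, and |u|³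
  -- is also O(s³). All powers of 1 + r are absorbed in the sixth.
  set e := u - s * p with he
  have hue : u = s * p + e := by rw [he]; ring
  have hρ6 : ∀ k : ℕ, k ≤ 6 → ρ ^ k ≤ ρ ^ 6 := fun k hk => pow_le_pow_right₀ hρ1 hk
  have hp' : |p| ≤ κ * ℓ * ρ := hp.trans (by gcongr; linarith)
  have hs3 : 0 ≤ s ^ 3 := by positivity
  have hsp : |s * p| ≤ s * (κ * ℓ * ρ) := by
    rw [abs_mul, abs_of_nonneg hs]; gcongr
  have hcross : s * p * e ≤ s ^ 3 * (κ * ℓ * C₂) * ρ ^ 6 := by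
    calc s * p * e ≤ |s * p * e| := le_abs_self _
      _ = |s * p| * |e| := abs_mul _ _
      _ ≤ (s * (κ * ℓ * ρ)) * (s ^ 2 * (C₂ * ρ ^ 2)) := by gcongr
      _ = s ^ 3 * (κ * ℓ * C₂) * ρ ^ 3 := by ring
      _ ≤ _ := by gcongr ?_ * ?_; exact hρ6 3 (by norm_num)
  have hsq : e ^ 2 / 2 ≤ s ^ 3 * C₂ ^ 2 * ρ ^ 6 := by
    calc e ^ 2 / 2 = |e| ^ 2 / 2 := by rw [sq_abs]
      _ ≤ (s ^ 2 * (C₂ * ρ ^ 2)) ^ 2 / 2 := by gcongr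
      _ = s ^ 3 * C₂ ^ 2 * ρ ^ 4 * (s / 2) := by ring
      _ ≤ s ^ 3 * C₂ ^ 2 * ρ ^ 4 * 1 := by gcongr; linarith
      _ = s ^ 3 * C₂ ^ 2 * ρ ^ 4 := mul_one _
      _ ≤ _ := by gcongr ?_ * ?_; exact hρ6 4 (by norm_num)
  have hcube : |u| ^ 3 / ρ₀ ≤ (κ * ℓ + 2 * C₂) ^ 3 / ρ₀ * s ^ 3 * ρ ^ 6 := by
    have hu1 : |u| ≤ s * (κ * ℓ + 2 * C₂) * ρ ^ 2 := by
      calc |u| = |s * p + e| := by rw [hue]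
        _ ≤ |s * p| + |e| := abs_add_le _ _
        _ ≤ s * (κ * ℓ * ρ) + s ^ 2 * (C₂ * ρ ^ 2) := by gcongr
        _ ≤ s * (κ * ℓ * ρ ^ 2) + s * 2 * (C₂ * ρ ^ 2) := by
          have hρ2 : ρ ≤ ρ ^ 2 := by nlinarith only [hρ1]
          have hss : s ^ 2 ≤ s * 2 := by nlinarith only [hs, hs2]
          gcongr
        _ = _ := by ring
    calc |u| ^ 3 / ρ₀ ≤ (s * (κ * ℓ + 2 * C₂) * ρ ^ 2) ^ 3 / ρ₀ := by gcongr
      _ = _ := by ring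
  have hlin : κ * s ^ 3 * (2 * β ^ 2 + ℓ * β * r) ≤
      κ * (2 * β ^ 2 + ℓ * β) * s ^ 3 * ρ ^ 6 := by
    have h6 : ρ ≤ ρ ^ 6 := by simpa using hρ6 1 (by norm_num)
    calc κ * s ^ 3 * (2 * β ^ 2 + ℓ * β * r) ≤ κ * s ^ 3 * (2 * β ^ 2 * ρ + ℓ * β * ρ) := by
          have hβ2 : 2 * β ^ 2 ≤ 2 * β ^ 2 * ρ := le_mul_of_one_le_right (by positivity) hρ1
          have hrρ : r ≤ ρ := by linarith
          gcongr
      _ = κ * (2 * β ^ 2 + ℓ * β) * s ^ 3 * ρ := by ring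
      _ ≤ _ := by gcongr
  have hu2 : u ^ 2 / 2 = s ^ 2 / 2 * p ^ 2 + s * p * e + e ^ 2 / 2 := by rw [hue]; ring
  rw [hu2] at hlog
  linarith

/-- Here z plays the noise and v the drift. The increment f(x + sz) - f(x) is left unexpanded, so
that its Gaussian average is exactly the increment of the flow and no Hessian appears. The constant
depends only on K, η, ℓ and β, which is what iteration requires. -/
lemma IsSmooth.log_expansion {K η : ℝ} (hη : 0 < η) {ℓ β : ℝ} (hℓ : 0 ≤ ℓ) (hβ : 0 ≤ β) :
    ∃ C : ℝ, 0 ≤ C ∧ ∀ (f : V → ℝ) (q : V → V), IsSmooth K f q → (∀ x, η ≤ f x) →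
      ∀ (s r : ℝ) (x z v : V), 0 ≤ s → s ≤ 2 → 0 ≤ r → ‖z‖ ≤ ℓ * r → ‖v‖ ≤ β →
      Real.log (f x) + (f (x + s • z) - f x) / f x + s ^ 2 * inner ℝ ((f x)⁻¹ • q x) v -
        s ^ 2 / 2 * (inner ℝ ((f x)⁻¹ • q x) z) ^ 2 - C * s ^ 3 * (1 + r) ^ 6 ≤
      Real.log (f (x + s • z + s ^ 2 • v)) := by
  rcases le_or_gt K 0 with hK | hK
  -- No such f exists for K ≤ 0, as η ≤ f(0) ≤ K.
  · refine ⟨0, le_rfl, fun f q hf hηf => ?_⟩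
    have := (hf.abs_apply_le 0)
    have h2 := hηf 0
    have h3 := le_abs_self (f 0)
    linarith
  set κ := K / η with hκ
  have hκ0 : 0 ≤ κ := by positivity
  refine ⟨κ * (2 * β ^ 2 + ℓ * β) + κ * ℓ * (κ * ((ℓ + 2 * β) ^ 2 + β)) +
        (κ * ((ℓ + 2 * β) ^ 2 + β)) ^ 2 +
        (κ * ℓ + 2 * (κ * ((ℓ + 2 * β) ^ 2 + β))) ^ 3 / (η / K), by positivity,
    fun f q hf hηf s r x z v hs hs2 hr hz hv => ?_⟩
  have hφ : 0 < f x := hη.trans_le (hηf x)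
  have hinv : (f x)⁻¹ ≤ η⁻¹ := inv_anti₀ hη (hηf x)
  have hscale : ∀ {y c : ℝ}, |y| ≤ K * c → |y / f x| ≤ κ * c := fun {y c} hy => by
    rw [abs_div, abs_of_pos hφ, hκ, div_mul_eq_mul_div]
    have : 0 ≤ K * c := (abs_nonneg _).trans hy
    gcongr
    exact hηf x
  have hq : ‖(f x)⁻¹ • q x‖ ≤ κ := by
    rw [norm_smul, Real.norm_of_nonneg (inv_nonneg.2 hφ.le), hκ, div_eq_inv_mul]
    gcongr
    exact hf.norm_grad_le x
  have hzs : ‖s • z‖ ≤ s * (ℓ * r) := by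
    rw [norm_smul, Real.norm_of_nonneg hs]; gcongr
  have hvs : ‖s ^ 2 • v‖ ≤ s ^ 2 * β := by
    rw [norm_smul, Real.norm_of_nonneg (sq_nonneg s)]; gcongr
  have key := scalar_expansion (κ := κ) (ℓ := ℓ) (β := β) (ρ₀ := η / K) (s := s) (r := r)
    (p := inner ℝ ((f x)⁻¹ • q x) z) (u := (f (x + s • z + s ^ 2 • v) - f x) / f x)
    (w₁ := (f (x + s • z) - f x) / f x) (m := inner ℝ ((f x)⁻¹ • q x) v)
    hκ0 hℓ hβ (by positivity) hs hs2 hr ?_ ?_ ?_ ?_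
  · have e : 1 + (f (x + s • z + s ^ 2 • v) - f x) / f x = f (x + s • z + s ^ 2 • v) / f x := by
      field_simp
      ring
    rw [e, Real.log_div (hη.trans_le (hηf _)).ne' hφ.ne'] at key
    linarith
  · calc _ ≤ ‖(f x)⁻¹ • q x‖ * ‖z‖ := abs_real_inner_le_norm _ _
      _ ≤ κ * (ℓ * r) := by gcongr
      _ = _ := by ring
  · have e : 1 + (f (x + s • z + s ^ 2 • v) - f x) / f x = f (x + s • z + s ^ 2 • v) / f x := by
      field_simp
      ring
    rw [e]
    exact div_le_div₀ (hη.le.trans (hηf _)) (hηf _) hφ ((le_abs_self _).trans (hf.abs_apply_le x))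
  -- Taylor expansion in the drift, started at x + sz. Moving the gradient back to x costs
  -- K‖sz‖‖s²v‖ = O(s³) by the Lipschitz bound.
  · have h1 := (_root_.abs_le.1 (hf.taylor (x + s • z) (s ^ 2 • v))).1
    have h2 : -(K * (s * (ℓ * r)) * (s ^ 2 * β)) ≤
        inner ℝ (q (x + s • z) - q x) (s ^ 2 • v) := by
      refine (neg_le_neg ?_).trans (neg_abs_le _)
      calc _ ≤ ‖q (x + s • z) - q x‖ * ‖s ^ 2 • v‖ := abs_real_inner_le_norm _ _
        _ ≤ (K * (s * (ℓ * r))) * (s ^ 2 * β) := by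
          gcongr
          refine (hf.lipschitz _ _).trans ?_
          rw [add_sub_cancel_left]
          gcongr
    rw [inner_sub_left, real_inner_smul_right (q x)] at h2
    have h3 : K * ‖s ^ 2 • v‖ ^ 2 ≤ K * (s ^ 3 * (2 * β ^ 2)) := by
      gcongr
      calc ‖s ^ 2 • v‖ ^ 2 ≤ (s ^ 2 * β) ^ 2 := by gcongr
        _ = s ^ 3 * (s * β ^ 2) := by ring
        _ ≤ s ^ 3 * (2 * β ^ 2) := by gcongr
    have h4 : f (x + s • z) - f x + s ^ 2 * inner ℝ (q x) v -
        K * (s ^ 3 * (2 * β ^ 2 + ℓ * β * r)) ≤ f (x + s • z + s ^ 2 • v) - f x := by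
      nlinarith
    have h5 : κ * s ^ 3 * (2 * β ^ 2 + ℓ * β * r) ≥
        K * (s ^ 3 * (2 * β ^ 2 + ℓ * β * r)) / f x := by
      rw [hκ, div_mul_eq_mul_div, div_mul_eq_mul_div, mul_assoc]
      gcongr
      exact hηf x
    have h6 := div_le_div_of_nonneg_right h4 hφ.le
    rw [real_inner_smul_left]
    have e : (f (x + s • z) - f x + s ^ 2 * inner ℝ (q x) v -
        K * (s ^ 3 * (2 * β ^ 2 + ℓ * β * r))) / f x =
        (f (x + s • z) - f x) / f x + s ^ 2 * ((f x)⁻¹ * inner ℝ (q x) v) -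
        K * (s ^ 3 * (2 * β ^ 2 + ℓ * β * r)) / f x := by
      field_simp
    rw [e] at h6
    linarith
  · have h1 := hscale (hf.taylor x (s • z + s ^ 2 • v))
    have h2 : ‖s • z + s ^ 2 • v‖ ^ 2 ≤ s ^ 2 * ((ℓ + 2 * β) ^ 2 * (1 + r) ^ 2) := by
      have : ‖s • z + s ^ 2 • v‖ ≤ s * ((ℓ + 2 * β) * (1 + r)) := by
        calc _ ≤ s * (ℓ * r) + s ^ 2 * β := (norm_add_le _ _).trans (add_le_add hzs hvs)
          _ ≤ s * (ℓ * (1 + r)) + s * 2 * (β * (1 + r)) := by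
            have hr1 : r ≤ 1 + r := by linarith
            have hss : s ^ 2 ≤ s * 2 := by nlinarith only [hs, hs2]
            have hβr : β ≤ β * (1 + r) := le_mul_of_one_le_right hβ (by linarith)
            gcongr
          _ = _ := by ring
      calc _ ≤ (s * ((ℓ + 2 * β) * (1 + r))) ^ 2 := by gcongr
        _ = _ := by ring
    have h3 : |s ^ 2 * inner ℝ ((f x)⁻¹ • q x) v| ≤ s ^ 2 * (κ * β * (1 + r) ^ 2) := by
      rw [abs_mul, abs_of_nonneg (sq_nonneg s)]
      gcongr
      calc _ ≤ ‖(f x)⁻¹ • q x‖ * ‖v‖ := abs_real_inner_le_norm _ _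
        _ ≤ κ * β := by gcongr
        _ ≤ κ * β * (1 + r) ^ 2 := le_mul_of_one_le_right (by positivity)
          (one_le_pow₀ (by linarith))
    have e : (f (x + s • z + s ^ 2 • v) - f x) / f x - s * inner ℝ ((f x)⁻¹ • q x) z =
        (f (x + (s • z + s ^ 2 • v)) - f x - inner ℝ (q x) (s • z + s ^ 2 • v)) / f x +
          s ^ 2 * inner ℝ ((f x)⁻¹ • q x) v := by
      rw [← add_assoc x]
      simp only [inner_add_right, real_inner_smul_right, real_inner_smul_left]
      field_simp
      ring
    rw [e]
    calc _ ≤ κ * ‖s • z + s ^ 2 • v‖ ^ 2 + s ^ 2 * (κ * β * (1 + r) ^ 2) :=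
          (abs_add_le _ _).trans (add_le_add h1 h3)
      _ ≤ κ * (s ^ 2 * ((ℓ + 2 * β) ^ 2 * (1 + r) ^ 2)) + s ^ 2 * (κ * β * (1 + r) ^ 2) := by
          gcongr
      _ = _ := by ring

end Smooth

end FRBL

end

/-! ### One small time step and its iteration. -/

set_option linter.unusedSectionVars false

noncomputable section

namespace FRBL

open ProbabilityTheory

section OneStep

variable {V : Type*} [NormedAddCommGroup V] [InnerProductSpace ℝ V] [FiniteDimensional ℝ V]
  [MeasurableSpace V] [BorelSpace V]
  {W : Type*} [NormedAddCommGroup W] [InnerProductSpace ℝ W] [FiniteDimensional ℝ W]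
  [MeasurableSpace W] [BorelSpace W]

lemma integral_inner_sq_stdGaussian (p : W) :
    ∫ ξ, inner ℝ p ξ ^ 2 ∂(stdGaussian W) = ‖p‖ ^ 2 := by
  have h := covarianceBilin_apply (μ := stdGaussian W) (IsGaussian.memLp_id _ 2 (by simp)) p p
  rw [covarianceBilin_stdGaussian] at h
  simp only [id, integral_id_stdGaussian, sub_zero, innerSL_apply_apply ℝ,
    real_inner_self_eq_norm_sq] at h
  rw [h]
  simp only [sq]

lemma integrable_inner_sq_stdGaussian (p : W) :
    Integrable (fun ξ => inner ℝ p ξ ^ 2) (stdGaussian W) :=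
  ((innerSL ℝ p).comp_memLp' (IsGaussian.memLp_id (stdGaussian W) 2 (by simp))).integrable_sq

lemma integrable_one_add_norm_pow_stdGaussian {n : ℕ} (hn : n ≠ 0) :
    Integrable (fun ξ : W => (1 + ‖ξ‖) ^ n) (stdGaussian W) := by
  have h1 : Integrable (fun ξ : W => ‖ξ‖ ^ n) (stdGaussian W) := by
    have h2 : MemLp (id : W → W) n (stdGaussian W) :=
      IsGaussian.memLp_id (stdGaussian W) n (ENNReal.natCast_ne_top n)
    exact h2.integrable_norm_pow hn
  refine (((integrable_const 1).add h1).const_mul ((2 : ℝ) ^ (n - 1))).mono'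
    (by fun_prop) (Filter.Eventually.of_forall fun ξ => ?_)
  rw [Real.norm_of_nonneg (by positivity)]
  have := add_pow_le zero_le_one (norm_nonneg ξ) n
  rwa [one_pow] at this

section Flow

variable (L : W →ₗ[ℝ] V) (t : ℝ)

lemma integrable_flow {f : V → ℝ} (hf : Measurable f) {M : ℝ} (hM : ∀ x, |f x| ≤ M) (x : V) :
    Integrable (fun ξ => f (x + Real.sqrt (2 * t) • L ξ)) (stdGaussian W) :=
  Integrable.of_bound (hf.comp ((measurable_noise_map L t).const_add x)).aestronglyMeasurable M
    (Filter.Eventually.of_forall fun _ => hM _)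

lemma le_flow {f : V → ℝ} (hf : Measurable f) {M : ℝ} (hM : ∀ x, |f x| ≤ M) {a : ℝ}
    (ha : ∀ x, a ≤ f x) (x : V) : a ≤ flow L t f x := by
  have := integral_mono (integrable_const a) (integrable_flow L t hf hM x) fun ξ => ha _
  simpa [flow] using this

lemma flow_le {f : V → ℝ} (hf : Measurable f) {M : ℝ} (hM : ∀ x, |f x| ≤ M) {b : ℝ}
    (hb : ∀ x, f x ≤ b) (x : V) : flow L t f x ≤ b := by
  have := integral_mono (integrable_flow L t hf hM x) (integrable_const b) fun ξ => hb _
  simpa [flow] using this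

lemma IsSmooth.flow {K : ℝ} {f : V → ℝ} {q : V → V} (h : IsSmooth K f q) :
    ∃ q', IsSmooth K (flow L t f) q' := by
  have := h.average (stdGaussian W) (measurable_noise_map L t)
  simp only [probReal_univ, mul_one] at this
  exact ⟨_, this⟩

lemma flow_zero (f : V → ℝ) : flow L 0 f = f := by
  funext x
  simp [flow]

end Flow

lemma integrable_log {Y : Type*} [MeasurableSpace Y] (ν : Measure Y) [IsFiniteMeasure ν]
    {g : V → ℝ} (hg : Measurable g) {a b : ℝ} (ha : 0 < a) (hga : ∀ y, a ≤ g y)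
    (hgb : ∀ y, g y ≤ b) {τ : Y → V} (hτ : Measurable τ) :
    Integrable (fun y => Real.log (g (τ y))) ν := by
  refine Integrable.of_bound (Real.measurable_log.comp (hg.comp hτ)).aestronglyMeasurable
    (|Real.log a| + |Real.log b|) (Filter.Eventually.of_forall fun y => ?_)
  have h1 := Real.log_le_log ha (hga (τ y))
  have h2 := Real.log_le_log (ha.trans_le (hga (τ y))) (hgb (τ y))
  rw [Real.norm_eq_abs, abs_le]
  constructor
  · linarith [neg_abs_le (Real.log a), abs_nonneg (Real.log b)]
  · linarith [le_abs_self (Real.log b), abs_nonneg (Real.log a)]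

/-- The drift `A ∇ log f` is optimal up to a third-order error in the variational formula for
`log (flow L h f)`. -/
lemma exists_log_flow_le {A : V →ₗ[ℝ] V} {L : W →ₗ[ℝ] V}
    (hL : ∀ s, ‖LinearMap.adjoint L s‖ ^ 2 = inner ℝ (A s) s) {K η : ℝ} (hη : 0 < η) :
    ∃ C : ℝ, 0 ≤ C ∧ ∀ (f : V → ℝ) (q : V → V), IsSmooth K f q → (∀ x, η ≤ f x) →
      ∀ (h : ℝ) (x : V), 0 < h → h ≤ 1 →
      Real.log (flow L h f x) + h * inner ℝ (A ((f x)⁻¹ • q x)) ((f x)⁻¹ • q x) -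
        C * Real.sqrt (2 * h) ^ 3 ≤
      ∫ ξ, Real.log (f (x + Real.sqrt (2 * h) • L ξ + (2 * h) • A ((f x)⁻¹ • q x)))
        ∂(stdGaussian W) := by
  rcases le_or_gt K 0 with hK | hK
  · refine ⟨0, le_rfl, fun f q hf hηf => ?_⟩
    have := (hf.abs_apply_le 0)
    have h2 := hηf 0
    have h3 := le_abs_self (f 0)
    linarith
  obtain ⟨ℓ, hℓ, hLb⟩ := exists_forall_norm_apply_le L
  obtain ⟨α, hα, hAb⟩ := exists_forall_norm_apply_le A
  obtain ⟨C, hC, hexp⟩ := IsSmooth.log_expansion (V := V) (K := K) hη hℓ.le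
    (by positivity : 0 ≤ α * (η⁻¹ * K))
  set m := ∫ ξ : W, (1 + ‖ξ‖) ^ 6 ∂(stdGaussian W) with hm
  have hm0 : 0 ≤ m := integral_nonneg fun ξ => by positivity
  refine ⟨C * m, by positivity, fun f q hf hηf h x hh hh1 => ?_⟩
  have hφ : 0 < f x := hη.trans_le (hηf x)
  set p := (f x)⁻¹ • q x with hp
  set s := Real.sqrt (2 * h) with hs
  have hs0 : 0 ≤ s := Real.sqrt_nonneg _
  have hs2 : s ^ 2 = 2 * h := Real.sq_sqrt (by positivity)
  have hs_le : s ≤ 2 := by nlinarith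
  have hpn : ‖A p‖ ≤ α * (η⁻¹ * K) := by
    refine (hAb p).trans ?_
    gcongr
    rw [hp, norm_smul, Real.norm_of_nonneg (inv_nonneg.2 hφ.le)]
    gcongr
    · exact hηf x
    · exact hf.norm_grad_le x
  have hmeas : Measurable f := hf.continuous.measurable
  have hpt : ∀ ξ : W, Real.log (f x) + (f (x + s • L ξ) - f x) / f x + s ^ 2 * inner ℝ p (A p) -
      s ^ 2 / 2 * (inner ℝ (LinearMap.adjoint L p) ξ) ^ 2 - C * s ^ 3 * (1 + ‖ξ‖) ^ 6 ≤
      Real.log (f (x + s • L ξ + (2 * h) • A p)) := fun ξ => by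
    have := hexp f q hf hηf s ‖ξ‖ x (L ξ) (A p) hs0 hs_le (norm_nonneg _) (hLb ξ) hpn
    rw [LinearMap.adjoint_inner_left, ← hs2]
    exact this
  have i1 : Integrable (fun ξ => f (x + s • L ξ)) (stdGaussian W) :=
    integrable_flow L h hmeas hf.abs_apply_le x
  have i2 : Integrable (fun ξ => (f (x + s • L ξ) - f x) / f x) (stdGaussian W) :=
    (i1.sub (integrable_const _)).div_const _
  have i3 : Integrable (fun ξ => Real.log (f x) + (f (x + s • L ξ) - f x) / f x)
      (stdGaussian W) := (integrable_const _).add i2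
  have i4 : Integrable (fun ξ => Real.log (f x) + (f (x + s • L ξ) - f x) / f x +
      s ^ 2 * inner ℝ p (A p)) (stdGaussian W) := i3.add (integrable_const _)
  have i5 := (integrable_inner_sq_stdGaussian (LinearMap.adjoint L p)).const_mul (s ^ 2 / 2)
  have i6 : Integrable (fun ξ => Real.log (f x) + (f (x + s • L ξ) - f x) / f x +
      s ^ 2 * inner ℝ p (A p) - s ^ 2 / 2 * (inner ℝ (LinearMap.adjoint L p) ξ) ^ 2)
      (stdGaussian W) := i4.sub i5
  have i7 := (integrable_one_add_norm_pow_stdGaussian (W := W) (n := 6) (by norm_num)).const_mul (C * s ^ 3)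
  have hlogi : Integrable (fun ξ => Real.log (f (x + s • L ξ + (2 * h) • A p))) (stdGaussian W) :=
    integrable_log _ hmeas hη hηf (fun y => (le_abs_self _).trans (hf.abs_apply_le y))
      (((measurable_noise_map L h).const_add x).add_const _)
  have hint := integral_mono (i6.sub i7) hlogi hpt
  refine le_trans ?_ hint
  -- With s² = 2h the drift term contributes 2h⟨Ap, p⟩ and the averaged square removes h⟨Ap, p⟩; the
  -- remaining h⟨Ap, p⟩ is the cost of this drift.
  have hval : ∫ ξ, (Real.log (f x) + (f (x + s • L ξ) - f x) / f x + s ^ 2 * inner ℝ p (A p) -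
      s ^ 2 / 2 * (inner ℝ (LinearMap.adjoint L p) ξ) ^ 2 - C * s ^ 3 * (1 + ‖ξ‖) ^ 6)
      ∂(stdGaussian W) = Real.log (f x) + (flow L h f x - f x) / f x + s ^ 2 * inner ℝ p (A p) -
      s ^ 2 / 2 * inner ℝ (A p) p - C * s ^ 3 * m := by
    rw [integral_sub i6 i7, integral_sub i4 i5, integral_add i3 (integrable_const _),
      integral_add (integrable_const _) i2, integral_div, integral_sub i1 (integrable_const _),
      integral_const_mul (s ^ 2 / 2), integral_const_mul (C * s ^ 3),
      integral_inner_sq_stdGaussian, hL]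
    simp only [integral_const, probReal_univ, one_smul]
    rfl
  change _ ≤ ∫ ξ, (Real.log (f x) + (f (x + s • L ξ) - f x) / f x + s ^ 2 * inner ℝ p (A p) -
      s ^ 2 / 2 * (inner ℝ (LinearMap.adjoint L p) ξ) ^ 2 - C * s ^ 3 * (1 + ‖ξ‖) ^ 6)
      ∂(stdGaussian W)
  rw [hval]
  have hflow : 0 < flow L h f x := hη.trans_le (le_flow L h hmeas hf.abs_apply_le hηf x)
  -- Concavity of the logarithm: the averaged increment dominates the increment of the logarithm,
  -- with no error term.
  have hlog : Real.log (flow L h f x) ≤ Real.log (f x) + (flow L h f x - f x) / f x := by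
    have h1 := Real.log_le_sub_one_of_pos (div_pos hflow hφ)
    rw [Real.log_div hflow.ne' hφ.ne'] at h1
    have h2 : (flow L h f x - f x) / f x = flow L h f x / f x - 1 := by field_simp
    linarith
  rw [real_inner_comm p (A p), hs2] at *
  linarith

end OneStep

namespace Datum

variable {ι κ : Type*} [Fintype ι] [Fintype κ] {E : ι → Type*} {F : κ → Type*}
  [∀ i, NormedAddCommGroup (E i)] [∀ i, InnerProductSpace ℝ (E i)]
  [∀ j, NormedAddCommGroup (F j)] [∀ j, InnerProductSpace ℝ (F j)]
  [∀ i, FiniteDimensional ℝ (E i)] [∀ j, FiniteDimensional ℝ (F j)]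
  [∀ i, MeasurableSpace (E i)] [∀ i, BorelSpace (E i)]
  [∀ j, MeasurableSpace (F j)] [∀ j, BorelSpace (F j)]

/-- The logarithmic form of the pointwise relation, with an additive constant `θ`. -/
def LogRelation (D : Datum E F) (θ : ℝ) (f : ∀ i, E i → ℝ) (g : ∀ j, F j → ℝ) : Prop :=
  ∀ x : PiLp 2 E, ∑ i, D.c i * Real.log (f i (x i)) ≤ θ + ∑ j, D.d j * Real.log (g j (D.Q x j))

section Flow

variable {D : Datum E F} {U : ∀ i, E i →ₗ[ℝ] E i} {V : ∀ j, F j →ₗ[ℝ] F j}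
  {W : Type*} [NormedAddCommGroup W] [InnerProductSpace ℝ W] [FiniteDimensional ℝ W]
  [MeasurableSpace W] [BorelSpace W] {R : W →ₗ[ℝ] PiLp 2 E}

/-- A single small step of the heat flow preserves the relation up to a third-order error. -/
lemma IsCritical.exists_logRelation_flow (hD : D.IsCritical U V)
    (hL : ∀ i s, ‖LinearMap.adjoint (proj E i ∘ₗ R) s‖ ^ 2 =
      inner ℝ ((Ring.inverse (U i) : E i →ₗ[ℝ] E i) s) s)
    (hT : ∀ j s, ‖LinearMap.adjoint (proj F j ∘ₗ D.Q ∘ₗ R) s‖ ^ 2 =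
      inner ℝ ((Ring.inverse (V j) : F j →ₗ[ℝ] F j) s) s)
    (K : ℝ) {η a : ℝ} (hη : 0 < η) (ha : 0 < a) (b : ℝ) :
    ∃ C : ℝ, 0 ≤ C ∧ ∀ (f : ∀ i, E i → ℝ) (g : ∀ j, F j → ℝ) (θ h : ℝ),
      (∀ i, ∃ q, IsSmooth K (f i) q) → (∀ i x, η ≤ f i x) → (∀ j, Measurable (g j)) →
      (∀ j y, a ≤ g j y) → (∀ j y, g j y ≤ b) → 0 < h → h ≤ 1 → D.LogRelation θ f g →
      D.LogRelation (θ + C * Real.sqrt (2 * h) ^ 3) (fun i => flow (proj E i ∘ₗ R) h (f i))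
        (fun j => flow (proj F j ∘ₗ D.Q ∘ₗ R) h (g j)) := by
  choose C hC hstep using fun i => exists_log_flow_le (hL i) (K := K) hη
  refine ⟨∑ i, D.c i * C i, Finset.sum_nonneg fun i _ => mul_nonneg (D.c_pos i).le (hC i),
    fun f g θ h hf hηf hg hga hgb hh hh1 hrel x => ?_⟩
  choose q hq using hf
  set p : ∀ i, E i := fun i => (f i (x i))⁻¹ • q i (x i) with hp
  -- The drift U_i⁻¹∇ log f_i is nearly optimal for every f_i at once, while the g_j accept any
  -- drift and receive Qv.
  set v : PiLp 2 E := WithLp.toLp 2 fun i => (Ring.inverse (U i) : E i →ₗ[ℝ] E i) (p i) with hv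
  have hvi : ∀ i, v i = (Ring.inverse (U i) : E i →ₗ[ℝ] E i) (p i) := fun i => rfl
  set s := Real.sqrt (2 * h) with hs
  have hF : ∀ i, D.c i * (Real.log (flow (proj E i ∘ₗ R) h (f i) (x i)) +
      h * inner ℝ (U i (v i)) (v i) - C i * s ^ 3) ≤
      D.c i * ∫ ξ, Real.log (f i ((x + s • R ξ + (2 * h) • v) i)) ∂(stdGaussian W) := fun i => by
    refine mul_le_mul_of_nonneg_left ?_ (D.c_pos i).le
    have := hstep i (f i) (q i) (hq i) (hηf i) h (x i) hh hh1
    rw [hvi, (hD.posDef_left i).self_apply_inverse, real_inner_comm]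
    exact this
  have hG : ∀ j, D.d j * ∫ ξ, Real.log (g j (D.Q (x + s • R ξ + (2 * h) • v) j))
      ∂(stdGaussian W) ≤ D.d j * (Real.log (flow (proj F j ∘ₗ D.Q ∘ₗ R) h (g j) (D.Q x j)) +
        h * inner ℝ (V j (D.Q v j)) (D.Q v j)) := fun j => by
    refine mul_le_mul_of_nonneg_left ?_ (D.d_pos j).le
    have := (hD.posDef_right j).inverse.integral_log_shift_le (hT j) hh (hg j) ha (hga j) (hgb j)
      (D.Q x j) (D.Q v j)
    rw [(hD.posDef_right j).inverse_inverse] at this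
    have e : ∀ ξ, D.Q (x + s • R ξ + (2 * h) • v) j =
        D.Q x j + s • (proj F j ∘ₗ D.Q ∘ₗ R) ξ + (2 * h) • D.Q v j := fun ξ => by
      simp
    simp only [e]
    linarith
  have hRm : Measurable fun ξ : W => x + s • R ξ + (2 * h) • v :=
    ((measurable_noise_map R h).const_add x).add_const _
  have hprojE : ∀ i, Measurable fun z : PiLp 2 E => z i := fun i =>
    measurable_linearMap (proj E i)
  have hprojF : ∀ j, Measurable fun z : PiLp 2 E => D.Q z j := fun j =>
    measurable_linearMap (proj F j ∘ₗ D.Q)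
  have hif : ∀ i, Integrable (fun ξ => Real.log (f i ((x + s • R ξ + (2 * h) • v) i)))
      (stdGaussian W) := fun i =>
    integrable_log _ (hq i).continuous.measurable hη (hηf i)
      (fun y => (le_abs_self _).trans ((hq i).abs_apply_le y)) ((hprojE i).comp hRm)
  have hig : ∀ j, Integrable (fun ξ => Real.log (g j (D.Q (x + s • R ξ + (2 * h) • v) j)))
      (stdGaussian W) := fun j =>
    integrable_log _ (hg j) ha (hga j) (hgb j) ((hprojF j).comp hRm)
  -- The relation holds at each random point x + sRξ + 2hv and is averaged. The common noise is
  -- essential here.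
  have hmid : ∑ i, D.c i * ∫ ξ, Real.log (f i ((x + s • R ξ + (2 * h) • v) i))
      ∂(stdGaussian W) ≤ θ + ∑ j, D.d j *
        ∫ ξ, Real.log (g j (D.Q (x + s • R ξ + (2 * h) • v) j)) ∂(stdGaussian W) := by
    have hi1 : Integrable (fun ξ => ∑ i, D.c i *
        Real.log (f i ((x + s • R ξ + (2 * h) • v) i))) (stdGaussian W) :=
      integrable_finsetSum _ fun i _ => (hif i).const_mul _
    have hi2 : Integrable (fun ξ => ∑ j, D.d j *
        Real.log (g j (D.Q (x + s • R ξ + (2 * h) • v) j))) (stdGaussian W) :=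
      integrable_finsetSum _ fun i _ => (hig i).const_mul _
    have h1 := integral_mono hi1 ((integrable_const θ).add hi2) fun ξ =>
      hrel (x + s • R ξ + (2 * h) • v)
    rw [integral_add' (integrable_const θ) hi2, integral_finsetSum _ fun i _ => (hif i).const_mul _,
      integral_finsetSum _ fun i _ => (hig i).const_mul _] at h1
    simpa only [integral_const_mul, integral_const, probReal_univ, one_smul] using h1
  -- The cost paid by the g_j is covered by the cost gained from the f_i.
  have hdom := mul_le_mul_of_nonneg_left (hD.dominates v) hh.le
  have h1 := Finset.sum_le_sum fun i (_ : i ∈ Finset.univ) => hF i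
  have h2 := Finset.sum_le_sum fun j (_ : j ∈ Finset.univ) => hG j
  simp only [mul_add, mul_sub, Finset.sum_add_distrib, Finset.sum_sub_distrib] at h1 h2
  have e1 : ∑ i, D.c i * (h * inner ℝ (U i (v i)) (v i)) =
      h * ∑ i, D.c i * inner ℝ (U i (v i)) (v i) := by
    rw [Finset.mul_sum]; exact Finset.sum_congr rfl fun i _ => by ring
  have e2 : ∑ j, D.d j * (h * inner ℝ (V j (D.Q v j)) (D.Q v j)) =
      h * ∑ j, D.d j * inner ℝ (V j (D.Q v j)) (D.Q v j) := by
    rw [Finset.mul_sum]; exact Finset.sum_congr rfl fun i _ => by ring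
  have e3 : ∑ i, D.c i * (C i * s ^ 3) = (∑ i, D.c i * C i) * s ^ 3 := by
    rw [Finset.sum_mul]; exact Finset.sum_congr rfl fun i _ => by ring
  rw [e1, e3] at h1
  rw [e2] at h2
  linarith

/-- The flows preserve K, η, a and b, so one C serves all n steps of length t/n. The total loss n ·
C(2t/n)^(3/2) tends to 0. -/
lemma IsCritical.logRelation_flow (hD : D.IsCritical U V)
    (hL : ∀ i s, ‖LinearMap.adjoint (proj E i ∘ₗ R) s‖ ^ 2 =
      inner ℝ ((Ring.inverse (U i) : E i →ₗ[ℝ] E i) s) s)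
    (hT : ∀ j s, ‖LinearMap.adjoint (proj F j ∘ₗ D.Q ∘ₗ R) s‖ ^ 2 =
      inner ℝ ((Ring.inverse (V j) : F j →ₗ[ℝ] F j) s) s)
    {K η a b : ℝ} (hη : 0 < η) (ha : 0 < a) {f : ∀ i, E i → ℝ} {g : ∀ j, F j → ℝ} {θ t : ℝ}
    (hf : ∀ i, ∃ q, IsSmooth K (f i) q) (hηf : ∀ i x, η ≤ f i x) (hg : ∀ j, Measurable (g j))
    (hga : ∀ j y, a ≤ g j y) (hgb : ∀ j y, g j y ≤ b) (ht : 0 < t) (hrel : D.LogRelation θ f g) :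
    D.LogRelation θ (fun i => flow (proj E i ∘ₗ R) t (f i))
      (fun j => flow (proj F j ∘ₗ D.Q ∘ₗ R) t (g j)) := by
  obtain ⟨C, hC, hstep⟩ := hD.exists_logRelation_flow hL hT K hη ha b
  have hfm : ∀ i, Measurable (f i) := fun i => (hf i).choose_spec.continuous.measurable
  have hfb : ∀ i x, |f i x| ≤ K := fun i => (hf i).choose_spec.abs_apply_le
  have hgabs : ∀ j y, |g j y| ≤ b := fun j y => by
    rw [abs_of_pos (ha.trans_le (hga j y))]
    exact hgb j y
  have hiter : ∀ (n : ℕ) (h : ℝ), 0 < h → h ≤ 1 →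
      D.LogRelation (θ + n * (C * Real.sqrt (2 * h) ^ 3))
        (fun i => flow (proj E i ∘ₗ R) (n * h) (f i))
        (fun j => flow (proj F j ∘ₗ D.Q ∘ₗ R) (n * h) (g j)) := by
    intro n h hh hh1
    induction n with
    | zero => simpa [flow_zero] using hrel
    | succ n ih =>
      have hnh : (0 : ℝ) ≤ n * h := by positivity
      have h1 := hstep _ _ _ h (fun i => (hf i).choose_spec.flow _ _)
        (fun i => le_flow _ _ (hfm i) (hfb i) (hηf i)) (fun j => measurable_flow _ _ (hg j))
        (fun j => le_flow _ _ (hg j) (hgabs j) (hga j))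
        (fun j => flow_le _ _ (hg j) (hgabs j) (hgb j)) hh hh1 ih
      have e1 : ∀ i, flow (proj E i ∘ₗ R) h (flow (proj E i ∘ₗ R) (n * h) (f i)) =
          flow (proj E i ∘ₗ R) ((n + 1 : ℕ) * h) (f i) := fun i => by
        funext x
        rw [flow_flow _ hh.le hnh (hfm i) (hfb i)]
        congr 1
        push_cast
        ring
      have e2 : ∀ j, flow (proj F j ∘ₗ D.Q ∘ₗ R) h (flow (proj F j ∘ₗ D.Q ∘ₗ R) (n * h) (g j)) =
          flow (proj F j ∘ₗ D.Q ∘ₗ R) ((n + 1 : ℕ) * h) (g j) := fun j => by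
        funext x
        rw [flow_flow _ hh.le hnh (hg j) (hgabs j)]
        congr 1
        push_cast
        ring
      simp only [e1, e2] at h1
      convert h1 using 1
      push_cast
      ring
  intro x
  have hlim : Filter.Tendsto (fun n : ℕ => θ + (n : ℝ) * (C * Real.sqrt (2 * (t / n)) ^ 3) +
      ∑ j, D.d j * Real.log (flow (proj F j ∘ₗ D.Q ∘ₗ R) t (g j) (D.Q x j))) Filter.atTop
      (nhds (θ + ∑ j, D.d j * Real.log (flow (proj F j ∘ₗ D.Q ∘ₗ R) t (g j) (D.Q x j)))) := by
    have h1 : Filter.Tendsto (fun n : ℕ => C * (2 * t) * Real.sqrt (2 * (t / n))) Filter.atTop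
        (nhds 0) := by
      have h2 : Filter.Tendsto (fun n : ℕ => 2 * (t / (n : ℝ))) Filter.atTop (nhds 0) := by
        simpa using (tendsto_const_div_atTop_nhds_zero_nat t).const_mul 2
      simpa using ((Real.continuous_sqrt.tendsto _).comp h2).const_mul (C * (2 * t))
    have h3 : Filter.Tendsto (fun n : ℕ => (n : ℝ) * (C * Real.sqrt (2 * (t / n)) ^ 3))
        Filter.atTop (nhds 0) := by
      refine h1.congr' ?_
      filter_upwards [Filter.eventually_gt_atTop 0] with n hn
      have hn' : (0 : ℝ) < n := by exact_mod_cast hn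
      have hsq : Real.sqrt (2 * (t / n)) ^ 2 = 2 * (t / n) := Real.sq_sqrt (by positivity)
      rw [pow_succ, hsq]
      field_simp
    simpa using (h3.const_add θ).add_const
      (∑ j, D.d j * Real.log (flow (proj F j ∘ₗ D.Q ∘ₗ R) t (g j) (D.Q x j)))
  refine ge_of_tendsto hlim ?_
  filter_upwards [Filter.eventually_gt_atTop 0, Filter.eventually_ge_atTop ⌈t⌉₊] with n hn hnt
  have hn' : (0 : ℝ) < n := by exact_mod_cast hn
  have hnt' : t ≤ n := (Nat.le_ceil t).trans (by exact_mod_cast hnt)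
  have h1 := hiter n (t / n) (by positivity) ((div_le_one hn').2 hnt') x
  have e : (n : ℝ) * (t / n) = t := by field_simp
  rwa [e] at h1

end Flow

end Datum

end FRBL

end

/-! ### Mollification and semicontinuous approximation. -/

set_option linter.unusedSectionVars false

noncomputable section

namespace FRBL

open ProbabilityTheory

section Mollification

variable {V : Type*} [NormedAddCommGroup V] [InnerProductSpace ℝ V] [FiniteDimensional ℝ V]
  [MeasurableSpace V] [BorelSpace V]
  {W : Type*} [NormedAddCommGroup W] [InnerProductSpace ℝ W] [FiniteDimensional ℝ W]
  [MeasurableSpace W] [BorelSpace W]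

lemma exists_isSmooth_of_contDiff {φ : V → ℝ} (hφ : ContDiff ℝ 2 φ) (hc : HasCompactSupport φ) :
    ∃ K q, IsSmooth K φ q := by
  have hd : ContDiff ℝ 1 (fderiv ℝ φ) := hφ.fderiv_right (by norm_num)
  obtain ⟨K₀, hK₀⟩ := hc.exists_bound_of_continuous hφ.continuous
  obtain ⟨K₁, hK₁⟩ := (hc.fderiv ℝ).exists_bound_of_continuous hd.continuous
  obtain ⟨K₂, hK₂⟩ := hd.lipschitzWith_of_hasCompactSupport (hc.fderiv ℝ) one_ne_zero
  set K := max K₀ (max K₁ K₂) with hK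
  have h0 : K₀ ≤ K := le_max_left _ _
  have h1 : K₁ ≤ K := (le_max_left _ _).trans (le_max_right _ _)
  have h2 : (K₂ : ℝ) ≤ K := (le_max_right _ _).trans (le_max_right _ _)
  have hlip : ∀ x y, ‖fderiv ℝ φ x - fderiv ℝ φ y‖ ≤ K * ‖x - y‖ := fun x y => by
    have := hK₂.dist_le_mul x y
    rw [dist_eq_norm, dist_eq_norm] at this
    exact this.trans (by gcongr)
  refine ⟨K, fun x => (InnerProductSpace.toDual ℝ V).symm (fderiv ℝ φ x),
    fun x => (hK₀ x).trans h0, fun x => ?_, fun x y => ?_, fun x a => ?_⟩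
  · rw [LinearIsometryEquiv.norm_map]
    exact (hK₁ x).trans h1
  · rw [← map_sub, LinearIsometryEquiv.norm_map]
    exact hlip x y
  · rw [InnerProductSpace.toDual_symm_apply]
    have hKnn : 0 ≤ K := K₂.coe_nonneg.trans h2
    have := (convex_closedBall x ‖a‖).norm_image_sub_le_of_norm_fderiv_le' (𝕜 := ℝ) (f := φ)
      (φ := fderiv ℝ φ x) (C := K * ‖a‖) (x := x) (y := x + a)
      (fun z _ => (hφ.differentiable (by norm_num)) z) (fun z hz => (hlip z x).trans (by
        gcongr
        simpa [dist_eq_norm] using hz)) (by simp) (by simp)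
    rw [add_sub_cancel_left, Real.norm_eq_abs] at this
    exact this.trans (le_of_eq (by ring))

/-- Mollification at scale `r` of a bounded integrable function. -/
lemma exists_mollification {f : V → ℝ} (hf : Measurable f) (hf0 : ∀ x, 0 ≤ f x) {M : ℝ}
    (hM : ∀ x, f x ≤ M) (hfi : Integrable f) {r : ℝ} (hr : 0 < r) :
    ∃ (F : V → ℝ) (K : ℝ), (∃ q, IsSmooth K F q) ∧ (∀ x, 0 ≤ F x) ∧
      (∀ x, ∃ y, ‖y - x‖ ≤ r ∧ F x ≤ f y) ∧
      ∀ (L : W →ₗ[ℝ] V) (t : ℝ) (x : V) (a : ℝ), (∀ y, ‖y - x‖ ≤ r → a ≤ flow L t f y) →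
        a ≤ flow L t F x := by
  let b : ContDiffBump (0 : V) := ⟨r / 2, r, by positivity, by linarith⟩
  set φ : V → ℝ := b.normed volume with hφ
  have hφ0 : ∀ x, 0 ≤ φ x := fun x => b.nonneg_normed x
  have hφm : Measurable fun z => ENNReal.ofReal (φ z) := b.continuous_normed.measurable.ennreal_ofReal
  obtain ⟨K, q, hK⟩ := exists_isSmooth_of_contDiff (φ := φ) (b.contDiff_normed (n := 2))
    b.hasCompactSupport_normed
  set ν : Measure V := volume.withDensity fun y => ENNReal.ofReal (f y) with hν
  have : IsFiniteMeasure ν := isFiniteMeasure_withDensity_ofReal hfi.2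
  set γ : Measure V := volume.withDensity fun y => ENNReal.ofReal (φ y) with hγ
  have hγp : IsProbabilityMeasure γ := ⟨by
    rw [hγ, withDensity_apply _ MeasurableSet.univ, Measure.restrict_univ,
      ← ofReal_integral_eq_lintegral_ofReal b.integrable_normed
        (Filter.Eventually.of_forall hφ0), b.integral_normed, ENNReal.ofReal_one]⟩
  have hγN : γ {z | ¬ ‖z‖ ≤ r} = 0 := by
    have hms : MeasurableSet {z : V | ¬ ‖z‖ ≤ r} :=
      (measurableSet_le measurable_norm measurable_const).compl
    rw [hγ, withDensity_apply _ hms]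
    refine setLIntegral_eq_zero hms ?_
    intro z hz
    have hz' : r < ‖z‖ := not_le.1 hz
    have : z ∉ Function.support φ := by
      rw [hφ, b.support_normed_eq]
      simpa using hz'.le
    simp [Function.notMem_support.1 this]
  set F : V → ℝ := fun x => ∫ y, φ (x + -y) ∂ν with hF
  -- Two readings of one convolution: as an average of the bump over f dx it is smooth; as an
  -- average of f over γ, which lives on the ball of radius r, it compares with nearby values of f
  -- and commutes with the flow.
  have hFγ : ∀ x, F x = ∫ z, f (x - z) ∂γ := fun x => by
    change ∫ y, φ (x + -y) ∂ν = _
    rw [hγ, hν, integral_withDensity_eq_integral_toReal_smul hf.ennreal_ofReal (by simp),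
      integral_withDensity_eq_integral_toReal_smul hφm (by simp)]
    refine (integral_sub_left_eq_self (fun y => (ENNReal.ofReal (f y)).toReal • φ (x + -y))
      volume x).symm.trans ?_
    refine integral_congr_ae (Filter.Eventually.of_forall fun y => ?_)
    simp only [ENNReal.toReal_ofReal (hf0 _), ENNReal.toReal_ofReal (hφ0 _), smul_eq_mul]
    rw [mul_comm]
    congr 2
    abel
  have habs : ∀ x, |f x| ≤ M := fun x => by rw [abs_of_nonneg (hf0 x)]; exact hM x
  refine ⟨F, _, ⟨_, hK.average ν measurable_neg⟩, fun x => integral_nonneg fun y => hφ0 _,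
    fun x => ?_, fun L t x a ha => ?_⟩
  · have hi : Integrable (fun z => f (x - z)) γ :=
      Integrable.of_bound (hf.comp (measurable_const.sub measurable_id)).aestronglyMeasurable M
        (Filter.Eventually.of_forall fun z => habs _)
    -- First-moment argument: some point of the ball has a value of f at least the average.
    obtain ⟨z, hz, hle⟩ := exists_notMem_null_integral_le hi hγN
    refine ⟨x - z, ?_, ?_⟩
    · simpa using hz
    · rw [hFγ]
      exact hle
  · have hswap : flow L t F x = ∫ z, flow L t f (x - z) ∂γ := by
      simp only [flow, hFγ]
      rw [integral_integral_swap]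
      · refine integral_congr_ae (Filter.Eventually.of_forall fun z => ?_)
        refine integral_congr_ae (Filter.Eventually.of_forall fun ξ => ?_)
        simp only
        congr 1
        abel
      · refine Integrable.of_bound (Measurable.aestronglyMeasurable ?_) M
          (Filter.Eventually.of_forall fun z => habs _)
        exact hf.comp (((measurable_noise_map L t).comp measurable_fst).const_add x
          |>.sub measurable_snd)
    rw [hswap]
    have hfl : ∀ y, |flow L t f y| ≤ M := fun y => by
      rw [abs_of_nonneg (le_flow L t hf habs hf0 y)]
      exact flow_le L t hf habs hM y
    have hi : Integrable (fun z => flow L t f (x - z)) γ :=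
      Integrable.of_bound ((measurable_flow L t hf).comp
        (measurable_const.sub measurable_id)).aestronglyMeasurable M
        (Filter.Eventually.of_forall fun z => hfl _)
    have h1 : a = ∫ _, a ∂γ := by simp
    rw [h1]
    refine integral_mono_ae (integrable_const a) hi ?_
    have : ∀ᵐ z ∂γ, ‖z‖ ≤ r := hγN
    filter_upwards [this] with z hz
    exact ha _ (by simpa using hz)

end Mollification

section Regularization

variable {V : Type*} [NormedAddCommGroup V] [InnerProductSpace ℝ V] [FiniteDimensional ℝ V]
  [MeasurableSpace V] [BorelSpace V]

lemma IsPosDef.heatKernel_le {A : V →ₗ[ℝ] V} (hA : IsPosDef A) {t : ℝ} (ht : 0 < t) (x : V) :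
    heatKernel A t x ≤ heatKernel A t 0 := by
  unfold heatKernel
  gcongr
  simpa using hA.inverse.inner_nonneg x

lemma IsPosDef.integrable_heatMeasure {A : V →ₗ[ℝ] V} (hA : IsPosDef A) {t : ℝ} (ht : 0 < t)
    (x : V) {f : V → ℝ} (hf : Integrable f) : Integrable f (heatMeasure A t x) := by
  rw [integrable_heatMeasure_iff A ht]
  refine hf.bdd_mul (c := heatKernel A t 0) ((continuous_heatKernel A t).comp
    (continuous_const.sub continuous_id)).aestronglyMeasurable
    (Filter.Eventually.of_forall fun y => ?_)
  rw [Real.norm_of_nonneg (heatKernel_nonneg A ht _)]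
  exact hA.heatKernel_le ht _

lemma IsPosDef.continuous_heatSemigroup {A : V →ₗ[ℝ] V} (hA : IsPosDef A) {t : ℝ} (ht : 0 < t)
    {f : V → ℝ} (hf : Integrable f) : Continuous (heatSemigroup A t f) := by
  refine continuous_of_dominated (bound := fun y => ‖f y‖ * heatKernel A t 0) (fun x => ?_)
    (fun x => Filter.Eventually.of_forall fun y => ?_) (hf.norm.mul_const _)
    (Filter.Eventually.of_forall fun y => ?_)
  · exact hf.1.mul ((continuous_heatKernel A t).comp
      (continuous_const.sub continuous_id)).aestronglyMeasurable
  · rw [norm_mul, Real.norm_of_nonneg (heatKernel_nonneg A ht _)]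
    gcongr
    exact hA.heatKernel_le ht _
  · exact continuous_const.mul ((continuous_heatKernel A t).comp
      (continuous_id.sub continuous_const))

/-- Approximation from below by bounded upper semicontinuous functions of bounded support. -/
lemma exists_upperSemicontinuous_trunc {μ : Measure V} [IsFiniteMeasure μ] {f : V → ℝ}
    (hf0 : ∀ x, 0 ≤ f x) (hf : Integrable f μ) {δ : ℝ} (hδ : 0 < δ) :
    ∃ N : ℕ, ∀ n ≥ N, ∃ u : V → ℝ, UpperSemicontinuous u ∧ (∀ x, 0 ≤ u x) ∧
      (∀ x, u x ≤ trunc n f x) ∧ ∫ x, f x ∂μ - δ ≤ ∫ x, u x ∂μ := by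
  have hti : ∀ n, AEStronglyMeasurable (trunc n f) μ := fun n =>
    (hf.1.inf aestronglyMeasurable_const).indicator Metric.isClosed_closedBall.measurableSet
  have htb : ∀ n x, ‖trunc n f x‖ ≤ f x := fun n x => by
    rw [Real.norm_of_nonneg (trunc_nonneg n hf0 x)]
    exact trunc_le n hf0 x
  have hlim : Filter.Tendsto (fun n => ∫ x, trunc n f x ∂μ) Filter.atTop (nhds (∫ x, f x ∂μ)) := by
    refine tendsto_integral_of_dominated_convergence f hti hf
      (fun n => Filter.Eventually.of_forall (htb n)) (Filter.Eventually.of_forall fun x => ?_)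
    refine tendsto_const_nhds.congr' ?_
    filter_upwards [Filter.eventually_ge_atTop ⌈max ‖x‖ (f x)⌉₊] with n hn
    have : max ‖x‖ (f x) ≤ n := (Nat.le_ceil _).trans (by exact_mod_cast hn)
    exact (trunc_eq_self ((le_max_left _ _).trans this) ((le_max_right _ _).trans this)).symm
  obtain ⟨N, hN⟩ := Filter.eventually_atTop.1
    (hlim.eventually (lt_mem_nhds (sub_lt_self _ (half_pos hδ))))
  refine ⟨N, fun n hn => ?_⟩
  have hint : Integrable (trunc n f) μ :=
    hf.mono' (hti n) (Filter.Eventually.of_forall (htb n))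
  -- Vitali–Carathéodory; half of δ is spent here, the other half on the truncation.
  obtain ⟨u, hu, husc, -, hui⟩ := exists_upperSemicontinuous_le_integral_le (μ := μ)
    (fun x => (⟨trunc n f x, trunc_nonneg n hf0 x⟩ : NNReal)) hint (half_pos hδ)
  refine ⟨fun x => u x, NNReal.continuous_coe.comp_upperSemicontinuous husc NNReal.coe_mono,
    fun x => (u x).2, fun x => hu x, ?_⟩
  have h1 := hN n hn
  have h2 : ∫ x, trunc n f x ∂μ - δ / 2 ≤ ∫ x, (u x : ℝ) ∂μ := hui
  linarith

/-- Approximation from above by bounded lower semicontinuous functions. -/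
lemma exists_lowerSemicontinuous_clamp {μ : Measure V} [IsProbabilityMeasure μ] {g : V → ℝ}
    (hg0 : ∀ x, 0 ≤ g x) (hg : Integrable g μ) {ε M : ℝ} (hε : 0 < ε) (hM : ε ≤ M) :
    ∃ v : V → ℝ, LowerSemicontinuous v ∧ (∀ x, ε ≤ v x) ∧ (∀ x, v x ≤ M) ∧
      (∀ x, min (g x) M ≤ v x) ∧ ∫ x, v x ∂μ ≤ ∫ x, g x ∂μ + 2 * ε := by
  have hM0 : 0 ≤ M := hε.le.trans hM
  obtain ⟨h, hgh, hlsc, hhi⟩ := exists_lt_lowerSemicontinuous_lintegral_ge_of_aemeasurable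
    (μ := μ) (fun x => (g x).toNNReal) hg.1.aemeasurable.real_toNNReal
    (ε := ENNReal.ofReal ε) (by simpa using hε)
  -- The majorant may take the value ∞. Capping at M and flooring at ε are continuous and monotone,
  -- so they keep lower semicontinuity. One ε pays for the majorant, the other for the floor.
  set T : ℝ≥0∞ → ℝ := ENNReal.truncateToReal (ENNReal.ofReal M) with hT
  have hTc : Continuous T := ENNReal.continuous_truncateToReal ENNReal.ofReal_ne_top
  have hTm : Monotone T := ENNReal.monotone_truncateToReal ENNReal.ofReal_ne_top
  have hTM : ∀ z, T z ≤ M := fun z =>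
    (ENNReal.truncateToReal_le ENNReal.ofReal_ne_top).trans (ENNReal.toReal_ofReal hM0).le
  have hT0 : ∀ z, 0 ≤ T z := fun z => ENNReal.truncateToReal_nonneg
  have hlsc' : LowerSemicontinuous fun x => max ε (T (h x)) :=
    (continuous_const.max hTc).comp_lowerSemicontinuous hlsc
      (monotone_const.max hTm)
  have hTh : Measurable fun x => T (h x) := hTc.measurable.comp hlsc.measurable
  refine ⟨fun x => max ε (T (h x)), hlsc', fun x => le_max_left _ _,
    fun x => max_le hM (hTM _), fun x => ?_, ?_⟩
  · refine le_trans ?_ (le_max_right _ _)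
    have h1 : T (ENNReal.ofReal (g x)) ≤ T (h x) := hTm (hgh x).le
    refine le_trans (le_of_eq ?_) h1
    rw [hT, ENNReal.truncateToReal, ← ENNReal.ofReal_min,
      ENNReal.toReal_ofReal (le_min hM0 (hg0 x)), min_comm]
  · have hTi : Integrable (fun x => T (h x)) μ :=
      Integrable.of_bound hTh.aestronglyMeasurable M (Filter.Eventually.of_forall fun x => by
        rw [Real.norm_of_nonneg (hT0 _)]; exact hTM _)
    have hvi : Integrable (fun x => max ε (T (h x))) μ := (integrable_const ε).sup hTi
    have h1 : ∫ x, max ε (T (h x)) ∂μ ≤ ε + ∫ x, T (h x) ∂μ := by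
      have := integral_mono hvi ((integrable_const ε).add hTi) fun x =>
        max_le (le_add_of_nonneg_right (hT0 (h x))) (le_add_of_nonneg_left hε.le)
      rw [integral_add' (integrable_const ε) hTi] at this
      simpa using this
    have h2 : ∫ x, T (h x) ∂μ ≤ ∫ x, g x ∂μ + ε := by
      rw [integral_eq_lintegral_of_nonneg_ae (Filter.Eventually.of_forall fun x => hT0 _)
        hTh.aestronglyMeasurable]
      refine ENNReal.toReal_le_of_le_ofReal
        (add_nonneg (integral_nonneg hg0) hε.le) ?_
      rw [ENNReal.ofReal_add (integral_nonneg hg0) hε.le,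
        ofReal_integral_eq_lintegral_ofReal hg (Filter.Eventually.of_forall hg0)]
      refine le_trans (lintegral_mono fun x => ?_) hhi
      rw [hT, ENNReal.truncateToReal, ENNReal.ofReal_toReal (by simp)]
      exact min_le_right _ _
    linarith

end Regularization

end FRBL

end

/-! ### Stability of the relation under regularization, and preservation by the heat flow. -/

set_option linter.unusedSectionVars false

noncomputable section

namespace FRBL

open ProbabilityTheory

lemma flow_le_flow_add_const {V W : Type*} [NormedAddCommGroup V] [InnerProductSpace ℝ V]
    [FiniteDimensional ℝ V] [MeasurableSpace V] [BorelSpace V] [NormedAddCommGroup W]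
    [InnerProductSpace ℝ W] [FiniteDimensional ℝ W] [MeasurableSpace W] [BorelSpace W]
    (L : W →ₗ[ℝ] V) (t : ℝ) {f : V → ℝ} (hf : Measurable f) {M η : ℝ} (hM : ∀ x, |f x| ≤ M)
    (hη : 0 ≤ η) (x : V) : flow L t f x ≤ flow L t (fun y => f y + η) x :=
  integral_mono (integrable_flow L t hf hM x)
    ((integrable_flow L t hf hM x).add (integrable_const η)) fun _ => le_add_of_nonneg_right hη

namespace Datum

variable {ι κ : Type*} [Fintype ι] [Fintype κ] {E : ι → Type*} {F : κ → Type*}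
  [∀ i, NormedAddCommGroup (E i)] [∀ i, InnerProductSpace ℝ (E i)]
  [∀ j, NormedAddCommGroup (F j)] [∀ j, InnerProductSpace ℝ (F j)]
  [∀ i, FiniteDimensional ℝ (E i)] [∀ j, FiniteDimensional ℝ (F j)]
  [∀ i, MeasurableSpace (E i)] [∀ i, BorelSpace (E i)]
  [∀ j, MeasurableSpace (F j)] [∀ j, BorelSpace (F j)]

section Regularization

variable (D : Datum E F)

lemma sum_log_le_iff {a : ι → ℝ} {b : κ → ℝ} (ha : ∀ i, 0 < a i) (hb : ∀ j, 0 < b j) (θ : ℝ) :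
    ∑ i, D.c i * Real.log (a i) ≤ θ + ∑ j, D.d j * Real.log (b j) ↔
      ∏ i, a i ^ D.c i ≤ Real.exp θ * ∏ j, b j ^ D.d j := by
  have h1 : ∏ i, a i ^ D.c i = Real.exp (∑ i, D.c i * Real.log (a i)) := by
    rw [Real.exp_sum]
    exact Finset.prod_congr rfl fun i _ => by rw [Real.rpow_def_of_pos (ha i), mul_comm]
  have h2 : ∏ j, b j ^ D.d j = Real.exp (∑ j, D.d j * Real.log (b j)) := by
    rw [Real.exp_sum]
    exact Finset.prod_congr rfl fun i _ => by rw [Real.rpow_def_of_pos (hb i), mul_comm]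
  rw [h1, h2, ← Real.exp_add, Real.exp_le_exp]

/-- After truncating `f`, the functions `g` may be clamped from below and above. -/
lemma exists_clamp_bound {f : ∀ i, E i → ℝ} {g : ∀ j, F j → ℝ} (hf : ∀ i x, 0 ≤ f i x)
    (hg : ∀ j y, 0 ≤ g j y) (hrel : D.Relation f g) (n : ℕ) {ε : ℝ} (hε : 0 < ε) (hε1 : ε ≤ 1) :
    ∃ M : ℝ, ε ≤ M ∧ ∀ v : ∀ j, F j → ℝ, (∀ j y, ε ≤ v j y) →
      (∀ j y, min (g j y) M ≤ v j y) →
      ∀ x : PiLp 2 E, ∏ i, trunc n (f i) (x i) ^ D.c i ≤ ∏ j, v j (D.Q x j) ^ D.d j := by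
  classical
  set N : ℝ := ∏ i, (max (n : ℝ) 1) ^ D.c i with hN
  have hN0 : 0 < N := Finset.prod_pos fun i _ =>
    Real.rpow_pos_of_pos (one_pos.trans_le (le_max_right _ _)) _
  set e : ℝ := ∏ j, ε ^ D.d j with he
  have he0 : 0 < e := Finset.prod_pos fun j _ => Real.rpow_pos_of_pos hε _
  -- If some g_j exceeds M then v_j^(d_j) ≥ P, since M was built to dominate every P^(1/d_j). The
  -- other factors are at least ε^(d_j), so the right side is at least eP = N, which bounds the
  -- truncated product.
  set P : ℝ := N / e with hP
  have hP0 : 0 < P := div_pos hN0 he0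
  have hsum : 0 ≤ ∑ j, P ^ (D.d j)⁻¹ := Finset.sum_nonneg fun j _ => (Real.rpow_pos_of_pos hP0 _).le
  refine ⟨1 + ∑ j, P ^ (D.d j)⁻¹, by linarith, fun v hv hvg x => ?_⟩
  set M : ℝ := 1 + ∑ j, P ^ (D.d j)⁻¹ with hM
  by_cases hx : ∀ j, g j (D.Q x j) ≤ M
  · refine (prod_trunc_le hf n x).trans ((hrel x).trans ?_)
    refine Finset.prod_le_prod (fun j _ => Real.rpow_nonneg (hg j _) _) fun j _ =>
      Real.rpow_le_rpow (hg j _) ?_ (D.d_pos j).le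
    have := hvg j (D.Q x j)
    rwa [min_eq_left (hx j)] at this
  · push Not at hx
    obtain ⟨j₀, hj₀⟩ := hx
    have hvM : M ≤ v j₀ (D.Q x j₀) := by
      have := hvg j₀ (D.Q x j₀)
      rwa [min_eq_right hj₀.le] at this
    have h1 : ∏ i, trunc n (f i) (x i) ^ D.c i ≤ N :=
      Finset.prod_le_prod (fun i _ => Real.rpow_nonneg (trunc_nonneg n (hf i) _) _) fun i _ =>
        Real.rpow_le_rpow (trunc_nonneg n (hf i) _)
          ((trunc_le_natCast n _ _).trans (le_max_left _ _)) (D.c_pos i).le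
    have h2 : ∏ j, (ε ^ D.d j * if j = j₀ then P else 1) = N := by
      rw [Finset.prod_mul_distrib, Finset.prod_ite_eq' Finset.univ j₀, if_pos (Finset.mem_univ _),
        ← he, hP]
      field_simp
    refine h1.trans (h2.symm.le.trans ?_)
    refine Finset.prod_le_prod (fun j _ => ?_) fun j _ => ?_
    · have := (Real.rpow_pos_of_pos hε (D.d j)).le
      split_ifs
      · exact mul_nonneg this hP0.le
      · simpa using this
    · split_ifs with hj
      · subst hj
        have h3 : P ^ (D.d j)⁻¹ ≤ M := by
          have := Finset.single_le_sum (f := fun j => P ^ (D.d j)⁻¹)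
            (fun j _ => (Real.rpow_pos_of_pos hP0 _).le) (Finset.mem_univ j)
          linarith
        calc ε ^ D.d j * P ≤ 1 * P :=
              mul_le_mul_of_nonneg_right (Real.rpow_le_one hε.le hε1 (D.d_pos j).le) hP0.le
          _ = (P ^ (D.d j)⁻¹) ^ D.d j := by
              rw [one_mul, Real.rpow_inv_rpow hP0.le (D.d_pos j).ne']
          _ ≤ v j (D.Q x j) ^ D.d j := Real.rpow_le_rpow (Real.rpow_pos_of_pos hP0 _).le
              (h3.trans hvM) (D.d_pos j).le
      · rw [mul_one]
        exact Real.rpow_le_rpow hε.le (hv j _) (D.d_pos j).le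

/-- The arguments of u and v are decoupled so that the arguments of u can later be moved alone. A
strict inequality survives raising u and lowering v by a small s, and semicontinuity keeps nearby
values within s. -/
lemma isOpen_relation {u : ∀ i, E i → ℝ} {v : ∀ j, F j → ℝ} (hu : ∀ i, UpperSemicontinuous (u i))
    (hu0 : ∀ i x, 0 ≤ u i x) (hv : ∀ j, LowerSemicontinuous (v j)) {ε : ℝ} (hε : 0 < ε)
    (hvε : ∀ j y, ε ≤ v j y) (a : ℝ) (ha : 0 ≤ a) :
    IsOpen {p : (∀ i, E i) × (∀ i, E i) | ∏ i, u i (p.2 i) ^ D.c i <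
      a * ∏ j, v j (D.Q (WithLp.toLp 2 p.1) j) ^ D.d j} := by
  rw [isOpen_iff_eventually]
  intro p hp
  have hl : Filter.Tendsto (fun s : ℝ => ∏ i, (u i (p.2 i) + s) ^ D.c i) (nhdsWithin 0 (Set.Ioi 0))
      (nhds (∏ i, (u i (p.2 i) + 0) ^ D.c i)) :=
    tendsto_nhdsWithin_of_tendsto_nhds <| tendsto_finsetProd _ fun i _ =>
      (tendsto_const_nhds.add Filter.tendsto_id).rpow_const (Or.inr (D.c_pos i).le)
  have hr : Filter.Tendsto (fun s : ℝ => a * ∏ j, (v j (D.Q (WithLp.toLp 2 p.1) j) - s) ^ D.d j)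
      (nhdsWithin 0 (Set.Ioi 0))
      (nhds (a * ∏ j, (v j (D.Q (WithLp.toLp 2 p.1) j) - 0) ^ D.d j)) :=
    tendsto_nhdsWithin_of_tendsto_nhds <| (tendsto_finsetProd _ fun i _ =>
      (tendsto_const_nhds.sub Filter.tendsto_id).rpow_const (Or.inr (D.d_pos i).le)).const_mul a
  simp only [add_zero] at hl
  simp only [sub_zero] at hr
  obtain ⟨s, hs, hs0, hsε⟩ := ((hl.eventually_lt hr hp).and
    (Ioo_mem_nhdsGT hε : ∀ᶠ s in nhdsWithin 0 (Set.Ioi 0), s ∈ Set.Ioo 0 ε)).exists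
  have h1 : ∀ᶠ z in nhds p, ∀ i, u i (z.2 i) < u i (p.2 i) + s := Filter.eventually_all.2 fun i =>
    (((continuous_apply i).comp continuous_snd).tendsto p).eventually
      (hu i (p.2 i) _ (lt_add_of_pos_right _ hs0))
  have h2 : ∀ᶠ z in nhds p, ∀ j, v j (D.Q (WithLp.toLp 2 p.1) j) - s <
      v j (D.Q (WithLp.toLp 2 z.1) j) := Filter.eventually_all.2 fun j => by
    have hc : Continuous fun z : (∀ i, E i) × (∀ i, E i) => D.Q (WithLp.toLp 2 z.1) j :=
      ((proj F j ∘ₗ D.Q).continuous_of_finiteDimensional).comp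
        ((PiLp.continuous_toLp 2 E).comp continuous_fst)
    exact (hc.tendsto p).eventually (hv j _ _ (sub_lt_self _ hs0))
  filter_upwards [h1, h2] with z hz1 hz2
  refine lt_of_le_of_lt ?_ (hs.trans_le ?_)
  · exact Finset.prod_le_prod (fun i _ => Real.rpow_nonneg (hu0 i _) _) fun i _ =>
      Real.rpow_le_rpow (hu0 i _) (hz1 i).le (D.c_pos i).le
  · have hnn : ∀ j, 0 ≤ v j (D.Q (WithLp.toLp 2 p.1) j) - s := fun j => by
      linarith [hvε j (D.Q (WithLp.toLp 2 p.1) j)]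
    exact mul_le_mul_of_nonneg_left (Finset.prod_le_prod
      (fun j _ => Real.rpow_nonneg (hnn j) _) fun j _ =>
      Real.rpow_le_rpow (hnn j) (hz2 j).le (D.d_pos j).le) ha

/-- On the compact diagonal over a ball, the open condition with factor e^δ holds in a whole
thickening; outside the ball some u_i vanishes. The numbers α_i will be values of mollifications,
each bounded by a value of u_i within distance r. -/
lemma exists_uniform_relation {u : ∀ i, E i → ℝ} {v : ∀ j, F j → ℝ}
    (hu : ∀ i, UpperSemicontinuous (u i)) (hu0 : ∀ i x, 0 ≤ u i x) {n : ℕ}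
    (hun : ∀ i x, (n : ℝ) < ‖x‖ → u i x = 0)
    (hv : ∀ j, LowerSemicontinuous (v j)) {ε : ℝ} (hε : 0 < ε) (hvε : ∀ j y, ε ≤ v j y)
    (hrel : ∀ x : PiLp 2 E, ∏ i, u i (x i) ^ D.c i ≤ ∏ j, v j (D.Q x j) ^ D.d j)
    {δ : ℝ} (hδ : 0 < δ) :
    ∃ r : ℝ, 0 < r ∧ ∀ (x : PiLp 2 E) (α : ι → ℝ), (∀ i, 0 ≤ α i) →
      (∀ i, ∃ y, ‖y - x i‖ ≤ r ∧ α i ≤ u i y) →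
      ∏ i, α i ^ D.c i ≤ Real.exp δ * ∏ j, v j (D.Q x j) ^ D.d j := by
  have hvpos : ∀ x : PiLp 2 E, 0 < ∏ j, v j (D.Q x j) ^ D.d j := fun x =>
    Finset.prod_pos fun j _ => Real.rpow_pos_of_pos (hε.trans_le (hvε j _)) _
  have hcomp : IsCompact (Set.image (fun y : ∀ i, E i => (y, y)) (Metric.closedBall 0 n)) :=
    (isCompact_closedBall _ _).image (continuous_id.prodMk continuous_id)
  obtain ⟨r, hr, hsub⟩ := hcomp.exists_thickening_subset_open
    (D.isOpen_relation hu hu0 hv hε hvε (Real.exp δ) (Real.exp_pos δ).le) (by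
      rintro _ ⟨y, -, rfl⟩
      refine lt_of_le_of_lt (hrel (WithLp.toLp 2 y)) ?_
      exact lt_mul_of_one_lt_left (hvpos _) (Real.one_lt_exp_iff.2 hδ))
  refine ⟨r / 2, half_pos hr, fun x α hα h => ?_⟩
  choose y hy hαy using h
  by_cases hyn : ∀ i, ‖y i‖ ≤ n
  · have hmem : (WithLp.ofLp x, y) ∈ Metric.thickening r
        (Set.image (fun y : ∀ i, E i => (y, y)) (Metric.closedBall 0 n)) := by
      refine Metric.mem_thickening_iff.2 ⟨(y, y), ⟨y, ?_, rfl⟩, ?_⟩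
      · rw [mem_closedBall_zero_iff]
        exact (pi_norm_le_iff_of_nonneg (Nat.cast_nonneg n)).2 hyn
      · rw [Prod.dist_eq]
        simp only [dist_self]
        refine max_lt ?_ hr
        refine lt_of_le_of_lt ?_ (half_lt_self hr)
        refine (dist_pi_le_iff (half_pos hr).le).2 fun i => ?_
        rw [dist_comm, dist_eq_norm]
        exact hy i
    refine le_trans ?_ (hsub hmem).le
    exact Finset.prod_le_prod (fun i _ => Real.rpow_nonneg (hα i) _) fun i _ =>
      Real.rpow_le_rpow (hα i) (hαy i) (D.c_pos i).le
  · push Not at hyn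
    obtain ⟨i, hi⟩ := hyn
    have h0 : α i = 0 := le_antisymm ((hαy i).trans (hun i _ hi).le) (hα i)
    rw [Finset.prod_eq_zero (Finset.mem_univ i) (by rw [h0, Real.zero_rpow (D.c_pos i).ne'])]
    exact mul_nonneg (Real.exp_pos _).le (hvpos x).le

/-- Uniform continuity of the product on the cube [0, M + 1]^ι. It permits adding a constant to the
mollified f to keep it away from 0. -/
lemma exists_prod_add_le (M : ℝ) {κ₀ : ℝ} (hκ : 0 < κ₀) :
    ∃ η : ℝ, 0 < η ∧ ∀ α : ι → ℝ, (∀ i, 0 ≤ α i) → (∀ i, α i ≤ M) →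
      ∏ i, (α i + η) ^ D.c i ≤ ∏ i, α i ^ D.c i + κ₀ := by
  have hc : Continuous fun α : ι → ℝ => ∏ i, α i ^ D.c i :=
    continuous_finsetProd _ fun i _ => (continuous_apply i).rpow_const
      fun _ => Or.inr (D.c_pos i).le
  have huc := (isCompact_univ_pi fun _ : ι => isCompact_Icc (a := (0 : ℝ)) (b := M + 1)
    ).uniformContinuousOn_of_continuous hc.continuousOn
  obtain ⟨s, hs, H⟩ := Metric.uniformContinuousOn_iff.1 huc κ₀ hκ
  have hm0 : 0 < min (s / 2) 1 := lt_min (half_pos hs) one_pos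
  refine ⟨min (s / 2) 1, hm0, fun α hα0 hαM => ?_⟩
  have hd : dist (fun i => α i + min (s / 2) 1) α < s := by
    refine lt_of_le_of_lt ?_ (half_lt_self hs)
    refine (dist_pi_le_iff (half_pos hs).le).2 fun i => ?_
    rw [Real.dist_eq, add_sub_cancel_left, abs_of_pos hm0]
    exact min_le_left _ _
  have := H (fun i => α i + min (s / 2) 1) (fun i _ => ⟨by linarith [hα0 i], by
    linarith [hαM i, min_le_right (s / 2) (1 : ℝ)]⟩) α
    (fun i _ => ⟨hα0 i, by linarith [hαM i]⟩) hd
  rw [Real.dist_eq] at this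
  linarith [(abs_lt.1 this).2]

end Regularization

section Main

variable {D : Datum E F} {U : ∀ i, E i →ₗ[ℝ] E i} {V : ∀ j, F j →ₗ[ℝ] F j}

/-- R = √Σ: the vector Rξ has covariance Σ, whose block conditions are exactly the required
covariances. -/
lemma IsCritical.exists_noise_map (hD : D.IsCritical U V) :
    ∃ R : PiLp 2 E →ₗ[ℝ] PiLp 2 E,
      (∀ i s, ‖LinearMap.adjoint (proj E i ∘ₗ R) s‖ ^ 2 =
        inner ℝ ((Ring.inverse (U i) : E i →ₗ[ℝ] E i) s) s) ∧
      ∀ j s, ‖LinearMap.adjoint (proj F j ∘ₗ D.Q ∘ₗ R) s‖ ^ 2 =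
        inner ℝ ((Ring.inverse (V j) : F j →ₗ[ℝ] F j) s) s := by
  obtain ⟨S, hS, hSU, hSV⟩ := hD.exists_coupling
  obtain ⟨R, hR, hRS⟩ := exists_symmetric_sqrt hS
  have hadj : LinearMap.adjoint R = R := (LinearMap.isSymmetric_iff_isSelfAdjoint R).1 hR
  have hsq : ∀ v, ‖R v‖ ^ 2 = inner ℝ (S v) v := fun v => by
    rw [← real_inner_self_eq_norm_sq, ← hRS, hR, real_inner_comm]
  refine ⟨R, fun i s => ?_, fun j s => ?_⟩
  · rw [LinearMap.adjoint_comp, hadj, LinearMap.comp_apply, hsq]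
    exact hSU i s s
  · rw [LinearMap.adjoint_comp, LinearMap.adjoint_comp, hadj, LinearMap.comp_apply,
      LinearMap.comp_apply, hsq]
    exact hSV j s s

/-- The heat flow preserves the relation up to an arbitrarily small loss. -/
lemma IsCritical.prod_heatSemigroup_le (hD : D.IsCritical U V) {f : ∀ i, E i → ℝ}
    {g : ∀ j, F j → ℝ} (hf : ∀ i, (∀ x, 0 ≤ f i x) ∧ Integrable (f i))
    (hg : ∀ j, (∀ y, 0 ≤ g j y) ∧ Integrable (g j)) (hrel : D.Relation f g) {t : ℝ} (ht : 0 < t)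
    (x : PiLp 2 E) {δ : ℝ} (hδ : 0 < δ) (hδ1 : δ ≤ 1) :
    ∏ i, max 0 (heatSemigroup (Ring.inverse (U i)) t (f i) (x i) - δ) ^ D.c i ≤
      Real.exp (2 * δ) *
        ∏ j, (heatSemigroup (Ring.inverse (V j)) t (g j) (D.Q x j) + 2 * δ) ^ D.d j := by
  obtain ⟨R, hL, hT⟩ := hD.exists_noise_map
  have hA : ∀ i, IsPosDef (Ring.inverse (U i) : E i →ₗ[ℝ] E i) := fun i =>
    (hD.posDef_left i).inverse
  have hB : ∀ j, IsPosDef (Ring.inverse (V j) : F j →ₗ[ℝ] F j) := fun j =>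
    (hD.posDef_right j).inverse
  have hf0 := fun i => (hf i).1
  have hg0 := fun j => (hg j).1
  have hμ := fun i => (hA i).isFiniteMeasure_heatMeasure ht (x i)
  have hν := fun j => (hB j).isProbabilityMeasure_heatMeasure ht (D.Q x j)
  choose N hN using fun i => exists_upperSemicontinuous_trunc (hf0 i)
    ((hA i).integrable_heatMeasure ht (x i) (hf i).2) (half_pos hδ)
  set n := Finset.univ.sup N with hn
  choose u husc hu0 hut hui using fun i => hN i n (Finset.le_sup (Finset.mem_univ i))
  obtain ⟨M, hM, hclamp⟩ := D.exists_clamp_bound hf0 hg0 hrel n hδ hδ1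
  choose v hvlsc hvδ hvM hvg hvi using fun j => exists_lowerSemicontinuous_clamp (hg0 j)
    ((hB j).integrable_heatMeasure ht (D.Q x j) (hg j).2) hδ hM
  have hrel' : ∀ z : PiLp 2 E, ∏ i, u i (z i) ^ D.c i ≤ ∏ j, v j (D.Q z j) ^ D.d j := fun z =>
    (Finset.prod_le_prod (fun i _ => Real.rpow_nonneg (hu0 i _) _) fun i _ =>
      Real.rpow_le_rpow (hu0 i _) (hut i _) (D.c_pos i).le).trans (hclamp v hvδ hvg z)
  obtain ⟨r₀, hr₀, hunif⟩ := D.exists_uniform_relation husc hu0 (n := n)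
    (fun i z hz => le_antisymm ((hut i z).trans (trunc_of_norm_gt hz).le) (hu0 i z))
    hvlsc hδ hvδ hrel' hδ
  have hum : ∀ i, Measurable (u i) := fun i => (husc i).measurable
  have hun : ∀ i z, u i z ≤ n := fun i z => (hut i z).trans (trunc_le_natCast n _ _)
  have huint : ∀ i, Integrable (u i) := fun i =>
    (integrable_trunc n (hf0 i) (hf i).2.1.aemeasurable).mono' (hum i).aestronglyMeasurable
      (Filter.Eventually.of_forall fun z => by
        rw [Real.norm_of_nonneg (hu0 i z)]
        exact hut i z)
  -- Continuity of the evolved u_i gives a lower bound on a neighbourhood of x_i, which passes to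
  -- the mollification at smaller scale.
  have hnear : ∀ i, ∃ ρ > 0, ∀ y, ‖y - x i‖ ≤ ρ →
      heatSemigroup (Ring.inverse (U i)) t (f i) (x i) - δ ≤ flow (proj E i ∘ₗ R) t (u i) y := by
    intro i
    have hc := ((hA i).continuous_heatSemigroup ht (huint i)).tendsto (x i)
    obtain ⟨ρ, hρ, H⟩ := Metric.eventually_nhds_iff.1
      (hc.eventually (lt_mem_nhds (sub_lt_self _ (half_pos hδ))))
    refine ⟨ρ / 2, half_pos hρ, fun y hy => ?_⟩
    have h1 := H (y := y) (by rw [dist_eq_norm]; linarith)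
    have h2 := hui i
    rw [← heatSemigroup_eq_integral _ ht, ← heatSemigroup_eq_integral _ ht] at h2
    rw [← (hA i).heatSemigroup_eq_flow (hL i) ht (hum i)]
    linarith
  choose ρ hρ hnear using hnear
  choose G K hG hG0 hGle hGflow using fun i => exists_mollification (W := PiLp 2 E) (hum i) (hu0 i)
    (hun i) (huint i) (lt_min hr₀ (hρ i))
  set e : ℝ := ∏ j, δ ^ D.d j with he
  have he0 : 0 < e := Finset.prod_pos fun j _ => Real.rpow_pos_of_pos hδ _
  have hexp : 1 < Real.exp δ := Real.one_lt_exp_iff.2 hδ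
  -- The tolerance is e^δ(e^δ - 1) times the lower bound ∏ δ^(d_j) of ∏ v_j^(d_j), so that adding it
  -- to e^δ ∏ v_j^(d_j) stays below e^(2δ) ∏ v_j^(d_j).
  obtain ⟨η, hη, hprod⟩ := D.exists_prod_add_le n
    (mul_pos (mul_pos (Real.exp_pos δ) (sub_pos.2 hexp)) he0)
  have hvpos : ∀ j y, 0 < v j y := fun j y => hδ.trans_le (hvδ j y)
  have hlog : D.LogRelation (2 * δ) (fun i z => G i z + η) v := by
    intro z
    refine (D.sum_log_le_iff (a := fun i => G i (z i) + η)
      (fun i => add_pos_of_nonneg_of_pos (hG0 i _) hη)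
      (fun j => hvpos j (D.Q z j)) (2 * δ)).2 ?_
    have h1 := hunif z (fun i => G i (z i)) (fun i => hG0 i _) fun i => by
      obtain ⟨y, hy, hle⟩ := hGle i (z i)
      exact ⟨y, hy.trans (min_le_left _ _), hle⟩
    have h2 := hprod (fun i => G i (z i)) (fun i => hG0 i _) fun i => by
      obtain ⟨y, -, hle⟩ := hGle i (z i)
      exact hle.trans (hun i y)
    have h3 : e ≤ ∏ j, v j (D.Q z j) ^ D.d j :=
      Finset.prod_le_prod (fun j _ => (Real.rpow_pos_of_pos hδ _).le) fun j _ =>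
        Real.rpow_le_rpow hδ.le (hvδ j _) (D.d_pos j).le
    have h4 := mul_le_mul_of_nonneg_left h3
      (mul_pos (Real.exp_pos δ) (sub_pos.2 hexp)).le
    rw [two_mul, Real.exp_add]
    linarith
  have hKle : ∀ i, K i + η ≤ ∑ i, K i + η := fun i => by
    have := Finset.single_le_sum (f := K) (fun i _ => (hG i).choose_spec.nonneg)
      (Finset.mem_univ i)
    linarith
  have hflow := hD.logRelation_flow hL hT (K := ∑ i, K i + η) (b := M) hη hδ
    (fun i => ⟨_, ((hG i).choose_spec.add_const hη.le).mono (hKle i)⟩)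
    (fun i z => le_add_of_nonneg_left (hG0 i z)) (fun j => (hvlsc j).measurable) hvδ hvM ht hlog x
  have hGm : ∀ i, Measurable (G i) := fun i => (hG i).choose_spec.continuous.measurable
  have hGb : ∀ i z, |G i z| ≤ K i := fun i => (hG i).choose_spec.abs_apply_le
  have hGη : ∀ i, flow (proj E i ∘ₗ R) t (G i) (x i) ≤
      flow (proj E i ∘ₗ R) t (fun z => G i z + η) (x i) := fun i =>
    flow_le_flow_add_const _ t (hGm i) (hGb i) hη.le _
  have hposG : ∀ i, η ≤ flow (proj E i ∘ₗ R) t (fun z => G i z + η) (x i) := fun i =>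
    le_flow _ t ((hGm i).add_const η)
      ((hG i).choose_spec.add_const hη.le).abs_apply_le
      (fun z => le_add_of_nonneg_left (hG0 i z)) _
  have hvabs : ∀ j y, |v j y| ≤ M := fun j y => by
    rw [abs_of_pos (hvpos j y)]
    exact hvM j y
  have hposv : ∀ j, δ ≤ flow (proj F j ∘ₗ D.Q ∘ₗ R) t (v j) (D.Q x j) := fun j =>
    le_flow _ t (hvlsc j).measurable (hvabs j) (hvδ j) _
  have hfin := (D.sum_log_le_iff (fun i => hη.trans_le (hposG i))
    (fun j => hδ.trans_le (hposv j)) (2 * δ)).1 hflow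
  refine le_trans ?_ (hfin.trans ?_)
  · refine Finset.prod_le_prod (fun i _ => Real.rpow_nonneg (le_max_left _ _) _) fun i _ =>
      Real.rpow_le_rpow (le_max_left _ _) (max_le (hη.le.trans (hposG i)) ?_) (D.c_pos i).le
    exact (hGflow i _ t (x i) _ fun y hy => hnear i y (hy.trans (min_le_right _ _))).trans (hGη i)
  · refine mul_le_mul_of_nonneg_left ?_ (Real.exp_pos _).le
    refine Finset.prod_le_prod (fun j _ => Real.rpow_nonneg (hδ.le.trans (hposv j)) _) fun j _ =>
      Real.rpow_le_rpow (hδ.le.trans (hposv j)) ?_ (D.d_pos j).le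
    rw [← (hB j).heatSemigroup_eq_flow (hT j) ht (hvlsc j).measurable,
      heatSemigroup_eq_integral _ ht, heatSemigroup_eq_integral _ ht]
    exact hvi j

/-- All losses in the regularised inequality vanish as δ → 0, and positive exponents make both
products continuous in δ. -/
theorem IsCritical.heatFlowPreserves (hD : D.IsCritical U V) :
    D.HeatFlowPreserves (fun i => Ring.inverse (U i)) (fun j => Ring.inverse (V j)) := by
  intro f g hf hg hrel t ht x
  simp only [proj_apply]
  have hl : Filter.Tendsto (fun δ : ℝ =>
      ∏ i, max 0 (heatSemigroup (Ring.inverse (U i)) t (f i) (x i) - δ) ^ D.c i)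
      (nhdsWithin 0 (Set.Ioi 0))
      (nhds (∏ i, max 0 (heatSemigroup (Ring.inverse (U i)) t (f i) (x i) - 0) ^ D.c i)) :=
    tendsto_nhdsWithin_of_tendsto_nhds <| tendsto_finsetProd _ fun i _ =>
      (tendsto_const_nhds.max (tendsto_const_nhds.sub Filter.tendsto_id)).rpow_const
        (Or.inr (D.c_pos i).le)
  have hr : Filter.Tendsto (fun δ : ℝ => Real.exp (2 * δ) *
      ∏ j, (heatSemigroup (Ring.inverse (V j)) t (g j) (D.Q x j) + 2 * δ) ^ D.d j)
      (nhdsWithin 0 (Set.Ioi 0)) (nhds (Real.exp (2 * 0) *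
      ∏ j, (heatSemigroup (Ring.inverse (V j)) t (g j) (D.Q x j) + 2 * 0) ^ D.d j)) := by
    have h2 : Filter.Tendsto (fun δ : ℝ => 2 * δ) (nhds 0) (nhds (2 * 0)) :=
      Filter.tendsto_id.const_mul 2
    exact tendsto_nhdsWithin_of_tendsto_nhds <| ((Real.continuous_exp.tendsto _).comp h2).mul <|
      tendsto_finsetProd _ fun j _ =>
        (tendsto_const_nhds.add h2).rpow_const (Or.inr (D.d_pos j).le)
  have hnn : ∀ i, 0 ≤ heatSemigroup (Ring.inverse (U i)) t (f i) (x i) := fun i =>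
    heatSemigroup_nonneg _ ht (hf i).1 _
  simp only [sub_zero, max_eq_right (hnn _)] at hl
  simp only [mul_zero, Real.exp_zero, one_mul, add_zero] at hr
  refine le_of_tendsto_of_tendsto hl hr ?_
  filter_upwards [Ioo_mem_nhdsGT one_pos] with δ hδ
  exact hD.prod_heatSemigroup_le hf hg hrel ht x hδ.1 hδ.2.le

end Main

end Datum

end FRBL

end

theorem theorem1p3 {ι κ : Type*} [Fintype ι] [Fintype κ] {E : ι → Type*} {F : κ → Type*}
    [∀ i, NormedAddCommGroup (E i)] [∀ i, InnerProductSpace ℝ (E i)]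
    [∀ i, FiniteDimensional ℝ (E i)] [∀ i, MeasurableSpace (E i)] [∀ i, BorelSpace (E i)]
    [∀ j, NormedAddCommGroup (F j)] [∀ j, InnerProductSpace ℝ (F j)]
    [∀ j, FiniteDimensional ℝ (F j)] [∀ j, MeasurableSpace (F j)] [∀ j, BorelSpace (F j)]
    (D : FRBL.Datum E F) :
    List.TFAE [
      ∃ D' : FRBL.Datum E F, D.Equivalent D' ∧ D'.IsGeometric,
      ∃ (A : ∀ i, E i →ₗ[ℝ] E i) (B : ∀ j, F j →ₗ[ℝ] F j),
        (∀ i, FRBL.IsPosDef (A i)) ∧ (∀ j, FRBL.IsPosDef (B j)) ∧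
        ∀ (f : ∀ i, E i → ℝ) (g : ∀ j, F j → ℝ),
          (∀ i, (∀ x, 0 ≤ f i x) ∧ MeasureTheory.Integrable (f i)) →
          (∀ j, (∀ y, 0 ≤ g j y) ∧ MeasureTheory.Integrable (g j)) →
          D.Relation f g →
          ∀ t : ℝ, 0 < t →
            D.Relation (fun i => FRBL.heatSemigroup (A i) t (f i))
              (fun j => FRBL.heatSemigroup (B j) t (g j)),
      ∃ (f : ∀ i, E i → ℝ) (g : ∀ j, F j → ℝ),
        (∀ i, FRBL.IsCentredGaussian (f i)) ∧ (∀ j, FRBL.IsCentredGaussian (g j)) ∧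
        D.IsExtremizer f g] := by
  tfae_have 1 → 2 := by
    intro h
    obtain ⟨U, V, hD⟩ := (FRBL.Datum.exists_equivalent_isGeometric_iff D).1 h
    exact ⟨_, _, fun i => (hD.posDef_left i).inverse, fun j => (hD.posDef_right j).inverse,
      hD.heatFlowPreserves⟩
  tfae_have 2 → 3 := by
    rintro ⟨A, B, hA, hB, H⟩
    exact FRBL.Datum.HeatFlowPreserves.exists_gaussian_extremizer hA hB H
  tfae_have 3 → 1 := by
    rintro ⟨f, g, hf, hg, h⟩
    exact (FRBL.Datum.exists_equivalent_isGeometric_iff D).2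
      (FRBL.Datum.exists_isCritical_of_gaussian_extremizer hf hg h)
  tfae_finish
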